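/- Let $\mathfrak X$ be a complex Banach space. A generator $A$ of a strongly continuous semigroup is taken with the sign convention $U(t)=e^{-tA}$, i.e. $Ax=\lim_{t\to 0+}t^{-1}(x-U(t)x)$ on the set $\mathrm{dom}(A)$ of all $x$ for which the limit exists. Let $\theta\in(0,\pi/2]$ and $S_\theta=\{z\in\mathbb C: z\neq 0,\ |\arg z|<\theta\}$. Let $A$ be the generator of a holomorphic contraction semigroup of semi-angle $\theta$, that is, $\|e^{-tA}\|\le 1$ for all $t\ge 0$ and $\{e^{-tA}\}_{t>0}$ is the restriction to $(0,\infty)$ of a family $\{W(z)\}_{z\in S_\theta}$ of bounded operators which is holomorphic on $S_\theta$, satisfies $W(z_1)W(z_2)=W(z_1+z_2)$ there, and, for every $\epsilon\in(0,\theta)$, is bounded on $S_{\theta-\epsilon}$ and satisfies $W(z)x\to x$ for all $x\in\mathfrak X$ as $z\to 0$ in $S_{\theta-\epsilon}$. Let $B$ be the generator of a contraction semigroup on $\mathfrak X$. For $0<\alpha<1$ let $A^\alpha$ be the closure of the operator $x\mapsto \Gamma(-\alpha)^{-1}\int_0^\infty \lambda^{-\alpha-1}(e^{-\lambda A}-1)x\,d\lambda$,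 $x\in\mathrm{dom}(A)$, and let $A^0=1$ (with domain $\mathfrak X$). Let $A^*$, $B^*$ be the adjoint operators in the dual space $\mathfrak X^*$. Suppose that there is $\alpha\in[0,1)$ such that $\mathrm{dom}(A^\alpha)\subseteq\mathrm{dom}(B)$, and that $\mathrm{dom}(A^*)\subseteq\mathrm{dom}(B^*)$. Then $A+B$, with domain $\mathrm{dom}(A)\cap\mathrm{dom}(B)=\mathrm{dom}(A)$, is the generator of a contraction semigroup $\{e^{-t(A+B)}\}_{t\ge 0}$, and there are constants $M_1,M_2,\tilde M_2,\eta>0$ such that for all $t\ge 0$ and all integers $n>2$ $$\left\|\left(e^{-tB/n}e^{-tA/n}\right)^n-e^{-t(A+B)}\right\|\le e^{\eta t}\left(M_1+M_2\,t^{1-\alpha}\right)\frac{\ln n}{n^{1-\alpha}}\qquad\text{if }\alpha>0,$$ $$\left\|\left(e^{-tB/n}e^{-tA/n}\right)^n-e^{-t(A+B)}\right\|\le e^{\eta t}\left(M_1+\tilde M_2\,t\right)\frac{2(\ln n)^2}{n}\qquad\text{if }\alpha=0,$$ where $\|\cdot\|$ is the operator norm. -/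

import Mathlib

open Filter Topology MeasureTheory
open scoped NNReal

/-- A strongly continuous one-parameter semigroup `(U t)_{t ≥ 0}` of bounded linear operators on a
complex normed space `X`. -/
structure C0Semigroup (X : Type*) [NormedAddCommGroup X] [NormedSpace ℂ X] where
  /-- The operator at time `t`. -/
  op : ℝ≥0 → X →L[ℂ] X
  op_zero : op 0 = 1
  op_add : ∀ s t : ℝ≥0, op (s + t) = op s * op t
  tendsto_zero : ∀ x : X, Tendsto (fun t : ℝ≥0 => op t x) (𝓝[>] 0) (𝓝 x)

/-- The open sector `S_θ = {z ≠ 0 : |arg z| < θ}`. -/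
def openSector (θ : ℝ) : Set ℂ := {z : ℂ | z ≠ 0 ∧ |Complex.arg z| < θ}

/-- A bounded holomorphic semigroup of semi-angle `θ`: the family `W z`, `z ∈ S_θ` (the values of
`W` outside the sector play no role). -/
structure IsBoundedHolomorphicSemigroup {X : Type*} [NormedAddCommGroup X] [NormedSpace ℂ X]
    (θ : ℝ) (W : ℂ → X →L[ℂ] X) : Prop where
  bounded : ∀ ε : ℝ, 0 < ε → ε < θ → ∃ M : ℝ, ∀ z ∈ openSector (θ - ε), ‖W z‖ ≤ M
  mul : ∀ z₁ ∈ openSector θ, ∀ z₂ ∈ openSector θ, W z₁ * W z₂ = W (z₁ + z₂)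
  analytic : DifferentiableOn ℂ W (openSector θ)
  tendsto_zero : ∀ ε : ℝ, 0 < ε → ε < θ → ∀ x : X,
    Tendsto (fun z : ℂ => W z x) (𝓝[openSector (θ - ε)] 0) (𝓝 x)

namespace C0Semigroup

variable {X : Type*} [NormedAddCommGroup X] [NormedSpace ℂ X]

/-- A contraction semigroup: `‖U t‖ ≤ 1` for all `t ≥ 0`. -/
def IsContraction (U : C0Semigroup X) : Prop := ∀ t : ℝ≥0, ‖U.op t‖ ≤ 1

/-- A holomorphic contraction semigroup of semi-angle `θ`: a contraction semigroup which is the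
restriction to the half-line of a bounded holomorphic semigroup of semi-angle `θ`. -/
def IsHolomorphicContraction (U : C0Semigroup X) (θ : ℝ) : Prop :=
  U.IsContraction ∧ ∃ W : ℂ → X →L[ℂ] X, IsBoundedHolomorphicSemigroup θ W ∧
    ∀ t : ℝ≥0, 0 < t → W ((t : ℝ) : ℂ) = U.op t

/-- The difference quotient `(x - U t x) / t`. -/
noncomputable def diffQuot (U : C0Semigroup X) (x : X) (t : ℝ≥0) : X :=
  (((t : ℝ) : ℂ)⁻¹) • (x - U.op t x)

/-- The generator `A` of the semigroup, with the sign convention `U t = e^{-tA}`: its domain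
consists of all `x` for which `(x - U t x) / t` converges as `t → 0+`, and `A x` is the limit. -/
noncomputable def generator (U : C0Semigroup X) : X →ₗ.[ℂ] X where
  domain :=
    { carrier := {x : X | ∃ y : X, Tendsto (U.diffQuot x) (𝓝[>] 0) (𝓝 y)}
      zero_mem' := ⟨0, by
        refine tendsto_const_nhds.congr fun t => ?_
        simp [diffQuot]⟩
      add_mem' := by
        rintro x x' ⟨y, hy⟩ ⟨y', hy'⟩
        refine ⟨y + y', (hy.add hy').congr fun t => ?_⟩
        simp only [diffQuot, map_add, ← smul_add]
        congr 1
        abel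
      smul_mem' := by
        rintro c x ⟨y, hy⟩
        refine ⟨c • y, (hy.const_smul c).congr fun t => ?_⟩
        simp only [diffQuot, map_smul, ← smul_sub, smul_comm c] }
  toFun :=
    { toFun := fun x => x.2.choose
      map_add' := by
        intro x x'
        refine tendsto_nhds_unique (x + x').2.choose_spec
          ((x.2.choose_spec.add x'.2.choose_spec).congr fun t => ?_)
        simp only [diffQuot, Submodule.coe_add, map_add, ← smul_add]
        congr 1
        abel
      map_smul' := by
        intro c x
        refine tendsto_nhds_unique (c • x).2.choose_spec
          ((x.2.choose_spec.const_smul c).congr fun t => ?_)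
        simp only [diffQuot, Submodule.coe_smul, map_smul, ← smul_sub, smul_comm c] }

/-- The integrand `s^{-α-1} (U s - 1) x` of the integral formula for fractional powers. -/
noncomputable def fracIntegrand (U : C0Semigroup X) (α : ℝ) (x : X) (s : ℝ) : X :=
  s ^ (-α - 1) • (U.op s.toNNReal x - x)

/-- The operator `x ↦ Γ(-α)⁻¹ ∫₀^∞ s^{-α-1} (U s - 1) x ds` on those `x ∈ dom(A)` for which the
integral converges absolutely (for `0 < α < 1` and a bounded semigroup, this is all of
`dom(A)`). -/
noncomputable def fracPowCore (U : C0Semigroup X) (α : ℝ) : X →ₗ.[ℂ] X where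
  domain :=
    { carrier := {x : X | x ∈ U.generator.domain ∧
        IntegrableOn (U.fracIntegrand α x) (Set.Ioi 0)}
      zero_mem' := by
        refine ⟨zero_mem _, ?_⟩
        have : U.fracIntegrand α 0 = fun _ => 0 := by
          funext s
          simp [fracIntegrand]
        rw [this]
        exact integrableOn_zero
      add_mem' := by
        rintro x x' ⟨h, hx⟩ ⟨h', hx'⟩
        refine ⟨add_mem h h', (hx.add hx').congr (ae_of_all _ fun s => ?_)⟩
        simp only [fracIntegrand, Pi.add_apply, map_add, ← smul_add]
        congr 1
        abel
      smul_mem' := by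
        rintro c x ⟨h, hx⟩
        refine ⟨Submodule.smul_mem _ c h, (hx.smul c).congr (ae_of_all _ fun s => ?_)⟩
        simp only [fracIntegrand, Pi.smul_apply, map_smul, ← smul_sub, smul_comm c] }
  toFun :=
    { toFun := fun x => (Real.Gamma (-α))⁻¹ • ∫ s in Set.Ioi (0 : ℝ), U.fracIntegrand α x s
      map_add' := by
        intro x x'
        rw [← smul_add, ← integral_add x.2.2 x'.2.2]
        congr 2
        funext s
        simp only [fracIntegrand, Submodule.coe_add, map_add, ← smul_add]
        congr 1
        abel
      map_smul' := by
        intro c x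
        rw [RingHom.id_apply, smul_comm c, ← integral_smul c]
        congr 2
        funext s
        simp only [fracIntegrand, Submodule.coe_smul, map_smul, ← smul_sub, smul_comm c] }

/-- The fractional power `A^α`, `0 ≤ α < 1`, of the generator `A` of a bounded semigroup:
`A^0 = 1` on all of `X`, and for `0 < α < 1` the closed operator obtained as the closure of the
integral formula on `dom(A)`. -/
noncomputable def fracPow (U : C0Semigroup X) (α : ℝ) : X →ₗ.[ℂ] X :=
  open Classical in
  if α = 0 then (LinearMap.id : X →ₗ[ℂ] X).toPMap ⊤ else (U.fracPowCore α).closure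

end C0Semigroup

/-- The domain of the adjoint `A* : X* → X*` of a (densely defined) operator `A` in `X`: all bounded
functionals `φ` for which there is a bounded functional `ψ` (namely `A* φ`) with
`φ (A x) = ψ x` for all `x ∈ dom(A)`. -/
def adjointDomain {X : Type*} [NormedAddCommGroup X] [NormedSpace ℂ X] (A : X →ₗ.[ℂ] X) :
    Set (X →L[ℂ] ℂ) :=
  {φ : X →L[ℂ] ℂ | ∃ ψ : X →L[ℂ] ℂ, ∀ x : A.domain, φ (A x) = ψ x}

/-! Put `τ = t / n`, `F = e^{-τB} e^{-τA}` and `H = A + B`. The error is telescoped as `∑ F^(n-1-k)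
(F - e^{-τH}) e^{-kτH}`. One step alone costs `τ^(1-α)`, and `n` such terms do not tend to zero. The
gain comes from smoothing on both sides of the one-step error.

On the right, Cauchy's estimate gives `‖A e^{-tA}‖ ≤ C / t`, and splitting the defining integral at
`t` gives `‖A^α e^{-tA}‖ ≤ c t^(-α)`. By the closed graph theorem the inclusion `dom(A^α) ⊆ dom(B)`
turns this into `‖B e^{-tA}‖ ≤ c (1 + t^(-α))`. So `B` has `A`-bound zero, `A + B` is accretive with
`A + B + l` onto for large `l`, and Hille–Yosida produces `e^{-tH}`. Applying `B` to Duhamel's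
formula gives a weakly singular Volterra equation, whence `B e^{-sH} = O(s^(-α))` together with a
modulus of continuity in `s` (`exists_norm_gen_le`, `norm_gen_sub_le`).

On the left, comparing `F^m` with `e^{-mτA}` bounds `F^m A` by a multiple of `1 / (mτ) + τ^(-α) (1 +
log n)` (`norm_step_pow_gen_le`). The inclusion `dom(A*) ⊆ dom(B*)` and uniform boundedness make `(A
+ 1)⁻¹ B` bounded, so `F^m B` is controlled as well.

The one-step error is `∫₀^τ (e^{-(τ-s)A} B e^{-sH} - e^{-sB} B e^{-τA}) ds`. Dropping the outer
semigroups leaves errors in the ranges of `A` and of `A + 1`, which `F^m` absorbs; what remains is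
small by continuity of `B e^{-sH}` (`norm_step_pow_step_sub_le`). The `k`-th term becomes `τ^(1-α)
(1 / (n-k) + 1 / (k+1))` plus `τ^(1-α) (τ^(1-α) + τ) (1 + log n) (k+1)^(-α)`, up to constants, and
the sum is of order `log n / n^(1-α)`. Polynomial growth in `t` is absorbed by `e^t`. The argument
gives a single logarithm also for `α = 0`. -/

namespace C0Semigroup

variable {X : Type*} [NormedAddCommGroup X] [NormedSpace ℂ X]

/-! ### Calculus of contraction semigroups and their generators -/

/-- The semigroup as a function of a real time, constant on the negative half-line. -/
noncomputable def rop (U : C0Semigroup X) (s : ℝ) : X →L[ℂ] X := U.op s.toNNReal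

lemma rop_coe (U : C0Semigroup X) (t : ℝ≥0) : U.rop t = U.op t := by simp [rop]

@[simp] lemma rop_zero (U : C0Semigroup X) : U.rop 0 = 1 := by simp [rop, U.op_zero]

lemma rop_add (U : C0Semigroup X) {s t : ℝ} (hs : 0 ≤ s) (ht : 0 ≤ t) :
    U.rop (s + t) = U.rop s * U.rop t := by
  rw [rop, Real.toNNReal_add hs ht, U.op_add]; rfl

lemma rop_add_apply (U : C0Semigroup X) {s t : ℝ} (hs : 0 ≤ s) (ht : 0 ≤ t) (x : X) :
    U.rop (s + t) x = U.rop s (U.rop t x) := by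
  rw [U.rop_add hs ht]; rfl

lemma rop_comm_apply (U : C0Semigroup X) {s t : ℝ} (hs : 0 ≤ s) (ht : 0 ≤ t) (x : X) :
    U.rop s (U.rop t x) = U.rop t (U.rop s x) := by
  rw [← U.rop_add_apply hs ht, add_comm, U.rop_add_apply ht hs]

variable {U : C0Semigroup X}

lemma IsContraction.norm_rop_le (hU : U.IsContraction) (s : ℝ) : ‖U.rop s‖ ≤ 1 := hU _

lemma IsContraction.norm_rop_apply_le (hU : U.IsContraction) (s : ℝ) (x : X) :
    ‖U.rop s x‖ ≤ ‖x‖ := by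
  simpa using (U.rop s).le_of_opNorm_le (hU.norm_rop_le s) x

/-- For `s ≤ t` one has `U s x - U t x = U s (x - U (t - s) x)`, so contractivity carries right
continuity at `0` to every time, from both sides. -/
lemma IsContraction.continuous_op (hU : U.IsContraction) (x : X) :
    Continuous fun s => U.op s x := by
  have h0 : Tendsto (fun h => ‖U.op h x - x‖) (𝓝 0) (𝓝 0) := by
    have h1 : ContinuousWithinAt (fun h => U.op h x) (Set.Ioi 0) 0 := by
      simpa [ContinuousWithinAt, U.op_zero] using U.tendsto_zero x
    have h2 : ContinuousAt (fun h => U.op h x) 0 := by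
      rw [← continuousWithinAt_univ]
      have : (Set.univ : Set ℝ≥0) = Set.Ici 0 := by ext; simp
      rw [this]
      exact continuousWithinAt_Ioi_iff_Ici.1 h1
    have h3 := (h2.sub_const x).norm
    simpa [ContinuousAt, U.op_zero] using h3
  have key : ∀ s t : ℝ≥0, s ≤ t → ‖U.op s x - U.op t x‖ ≤ ‖U.op (nndist s t) x - x‖ := by
    intro s t hst
    have h1 : t = s + nndist s t := by
      apply NNReal.eq
      rw [NNReal.coe_add, coe_nndist, NNReal.dist_eq, abs_sub_comm, abs_of_nonneg]
      · ring
      · exact sub_nonneg.2 (by exact_mod_cast hst)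
    conv_lhs => rw [h1]
    rw [U.op_add, mul_apply_eq_comp, ← map_sub, norm_sub_rev]
    refine ((U.op s).le_of_opNorm_le (hU s) _).trans ?_
    rw [one_mul]
  rw [continuous_iff_continuousAt]
  intro t
  rw [ContinuousAt, tendsto_iff_norm_sub_tendsto_zero]
  have h4 : Tendsto (fun s => nndist s t) (𝓝 t) (𝓝 0) := by
    have : Continuous fun s : ℝ≥0 => nndist s t := by fun_prop
    simpa using this.tendsto t
  refine squeeze_zero (fun _ => norm_nonneg _) (fun s => ?_) (h0.comp h4)
  rcases le_total s t with h | h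
  · exact key s t h
  · rw [norm_sub_rev]; simpa [nndist_comm] using key t s h

lemma IsContraction.continuous_rop (hU : U.IsContraction) (x : X) :
    Continuous fun s => U.rop s x :=
  (hU.continuous_op x).comp continuous_real_toNNReal

/-- `U.IsGen x y` says that `x` is in the domain of the generator, which maps it to `y`. -/
def IsGen (U : C0Semigroup X) (x y : X) : Prop := Tendsto (U.diffQuot x) (𝓝[>] 0) (𝓝 y)

lemma IsGen.mem {x y : X} (h : U.IsGen x y) : x ∈ U.generator.domain := ⟨y, h⟩

lemma isGen_generator (x : U.generator.domain) : U.IsGen x (U.generator x) := x.2.choose_spec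

lemma IsGen.unique {x y z : X} (h : U.IsGen x y) (h' : U.IsGen x z) : y = z :=
  tendsto_nhds_unique h h'

lemma IsGen.generator_eq {x y : X} (h : U.IsGen x y) (hx : x ∈ U.generator.domain) :
    U.generator ⟨x, hx⟩ = y := (isGen_generator ⟨x, hx⟩).unique h

lemma exists_isGen {x : X} (h : x ∈ U.generator.domain) : ∃ y, U.IsGen x y := h

lemma IsGen.add {x y x' y' : X} (h : U.IsGen x y) (h' : U.IsGen x' y') :
    U.IsGen (x + x') (y + y') := by
  rw [← h.generator_eq h.mem, ← h'.generator_eq h'.mem, ← LinearPMap.map_add]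
  exact isGen_generator _

lemma IsGen.smul {x y : X} (h : U.IsGen x y) (c : ℂ) : U.IsGen (c • x) (c • y) := by
  rw [← h.generator_eq h.mem, ← LinearPMap.map_smul]
  exact isGen_generator _

lemma IsGen.sub {x y x' y' : X} (h : U.IsGen x y) (h' : U.IsGen x' y') :
    U.IsGen (x - x') (y - y') := by
  rw [← h.generator_eq h.mem, ← h'.generator_eq h'.mem, ← LinearPMap.map_sub]
  exact isGen_generator _

lemma isGen_zero : U.IsGen 0 0 := by
  have := isGen_generator (U := U) 0
  rwa [LinearPMap.map_zero] at this

lemma mem_graph_generator {p : X × X} : p ∈ U.generator.graph ↔ U.IsGen p.1 p.2 := by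
  rw [LinearPMap.mem_graph_iff]
  constructor
  · rintro ⟨x, h1, h2⟩
    rw [← h1, ← h2]; exact isGen_generator x
  · intro h
    exact ⟨⟨p.1, h.mem⟩, rfl, h.generator_eq _⟩

lemma isGen_iff_hasDerivWithinAt {x y : X} :
    U.IsGen x y ↔ HasDerivWithinAt (fun s : ℝ => U.rop s x) (-y) (Set.Ioi 0) 0 := by
  rw [hasDerivWithinAt_iff_tendsto_slope' (by simp)]
  have e1 : ∀ t : ℝ, 0 < t → slope (fun s : ℝ => U.rop s x) 0 t = - U.diffQuot x t.toNNReal := by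
    intro t ht
    rw [slope_def_module, diffQuot, Real.coe_toNNReal _ ht.le, ← smul_neg, neg_sub, rop_zero,
      sub_zero, ← Complex.ofReal_inv, Complex.coe_smul]
    rfl
  constructor
  · intro h
    have h1 : Tendsto Real.toNNReal (𝓝[>] 0) (𝓝[>] 0) := by
      refine tendsto_nhdsWithin_iff.2 ⟨?_, ?_⟩
      · have := continuous_real_toNNReal.tendsto 0
        simp only [Real.toNNReal_zero] at this
        exact this.mono_left nhdsWithin_le_nhds
      · filter_upwards [self_mem_nhdsWithin] with t ht using Real.toNNReal_pos.2 ht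
    refine (h.neg.comp h1).congr' ?_
    filter_upwards [self_mem_nhdsWithin] with t ht using (e1 t ht).symm
  · intro h
    have h1 : Tendsto ((↑) : ℝ≥0 → ℝ) (𝓝[>] 0) (𝓝[>] 0) := by
      refine tendsto_nhdsWithin_iff.2 ⟨?_, ?_⟩
      · exact (NNReal.continuous_coe.tendsto 0).mono_left nhdsWithin_le_nhds
      · filter_upwards [self_mem_nhdsWithin] with t ht using NNReal.coe_pos.2 ht
    have h2 := (h.comp h1).neg
    rw [neg_neg] at h2
    refine h2.congr' ?_
    filter_upwards [self_mem_nhdsWithin] with t ht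
    simp [Function.comp, e1 t (NNReal.coe_pos.2 ht)]

lemma IsGen.rop {x y : X} (h : U.IsGen x y) {t : ℝ} (ht : 0 ≤ t) :
    U.IsGen (U.rop t x) (U.rop t y) := by
  refine (((U.rop t).continuous.tendsto y).comp h).congr fun s => ?_
  simp only [Function.comp, diffQuot, map_smul, map_sub]
  congr 2
  have := U.rop_comm_apply ht s.2 x
  simpa [rop_coe] using this

lemma IsGen.hasDerivWithinAt {x y : X} (h : U.IsGen x y) {t : ℝ} (ht : 0 ≤ t) :
    HasDerivWithinAt (fun s : ℝ => U.rop s x) (-U.rop t y) (Set.Ioi t) t := by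
  have h1 := isGen_iff_hasDerivWithinAt.1 (h.rop ht)
  have h2 := HasDerivWithinAt.scomp (h := fun s : ℝ => s - t) (h' := 1) (t' := Set.Ioi 0)
    (s := Set.Ioi t) t (by simpa using h1) ((hasDerivWithinAt_id t _).sub_const t)
    (fun s hs => sub_pos.2 hs)
  rw [one_smul] at h2
  refine h2.congr (fun s hs => ?_) ?_
  · simp only [Function.comp]
    rw [← U.rop_add_apply (sub_nonneg.2 (le_of_lt hs)) ht, sub_add_cancel]
  · simp [Function.comp]

lemma IsContraction.intervalIntegrable_rop (hU : U.IsContraction) (x : X) (a b : ℝ) :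
    IntervalIntegrable (fun s => U.rop s x) volume a b :=
  (hU.continuous_rop x).intervalIntegrable a b

lemma IsContraction.norm_integral_rop_le (hU : U.IsContraction) (x : X) {t : ℝ} (ht : 0 ≤ t) :
    ‖∫ s in (0 : ℝ)..t, U.rop s x‖ ≤ t * ‖x‖ := by
  have := intervalIntegral.norm_integral_le_of_norm_le_const (a := 0) (b := t)
    (f := fun s => U.rop s x) (C := ‖x‖) fun s _ => hU.norm_rop_apply_le s x
  rwa [sub_zero, abs_of_nonneg ht, mul_comm] at this

/-- The integrated semigroup `x ↦ ∫₀ᵗ U s x ds`. -/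
noncomputable def intOp (U : C0Semigroup X) (hU : U.IsContraction) (t : ℝ≥0) : X →L[ℂ] X :=
  LinearMap.mkContinuous
    { toFun := fun x => ∫ s in (0 : ℝ)..t, U.rop s x
      map_add' := fun x y => by
        simp only [map_add]
        exact intervalIntegral.integral_add (hU.intervalIntegrable_rop x _ _)
          (hU.intervalIntegrable_rop y _ _)
      map_smul' := fun c x => by
        simp only [map_smul]
        exact intervalIntegral.integral_smul c _ } t fun x => hU.norm_integral_rop_le x t.2

lemma intOp_apply (hU : U.IsContraction) (t : ℝ≥0) (x : X) :
    U.intOp hU t x = ∫ s in (0 : ℝ)..t, U.rop s x := rfl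

lemma norm_intOp_apply_le (hU : U.IsContraction) (t : ℝ≥0) (x : X) :
    ‖U.intOp hU t x‖ ≤ t * ‖x‖ := hU.norm_integral_rop_le x t.2

variable [CompleteSpace X]

lemma IsGen.sub_rop_eq (hU : U.IsContraction) {x y : X} (h : U.IsGen x y) {t : ℝ} (ht : 0 ≤ t) :
    x - U.rop t x = ∫ s in (0 : ℝ)..t, U.rop s y := by
  have h1 := intervalIntegral.integral_eq_sub_of_hasDeriv_right_of_le ht
    (hU.continuous_rop x).continuousOn (fun s hs => h.hasDerivWithinAt hs.1.le)
    ((hU.continuous_rop y).neg.intervalIntegrable 0 t)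
  rw [intervalIntegral.integral_neg, rop_zero] at h1
  rw [one_apply_eq_self] at h1
  rw [← neg_inj, h1, neg_sub]

lemma IsGen.norm_sub_rop_le (hU : U.IsContraction) {x y : X} (h : U.IsGen x y) {t : ℝ}
    (ht : 0 ≤ t) : ‖x - U.rop t x‖ ≤ t * ‖y‖ := by
  rw [h.sub_rop_eq hU ht]; exact hU.norm_integral_rop_le y ht

lemma isGen_of_forall_integral (hU : U.IsContraction) {x y : X}
    (h : ∀ t : ℝ≥0, x - U.rop t x = U.intOp hU t y) : U.IsGen x y := by
  rw [isGen_iff_hasDerivWithinAt]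
  have h1 : HasDerivAt (fun t => ∫ s in (0 : ℝ)..t, U.rop s y) (U.rop 0 y) 0 :=
    intervalIntegral.integral_hasDerivAt_right (hU.intervalIntegrable_rop y _ _)
      ((hU.continuous_rop y).stronglyMeasurableAtFilter _ _) (hU.continuous_rop y).continuousAt
  have h2 := (h1.const_sub x).hasDerivWithinAt (s := Set.Ioi 0)
  rw [rop_zero, one_apply_eq_self] at h2
  refine h2.congr (fun s hs => ?_) (by simp)
  rw [eq_sub_iff_add_eq, add_comm, ← eq_sub_iff_add_eq]
  exact (h ⟨s, le_of_lt hs⟩).symm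

/-- This replaces the limit in the definition by identities between bounded operators, so that
membership in the graph survives limits and integrals. -/
lemma isGen_iff_forall_integral (hU : U.IsContraction) {x y : X} :
    U.IsGen x y ↔ ∀ t : ℝ≥0, x - U.rop t x = U.intOp hU t y :=
  ⟨fun h t => h.sub_rop_eq hU t.2, isGen_of_forall_integral hU⟩

lemma isClosed_graph_generator (hU : U.IsContraction) :
    IsClosed (U.generator.graph : Set (X × X)) := by
  have : (U.generator.graph : Set (X × X)) =
      ⋂ t : ℝ≥0, {p : X × X | p.1 - U.rop t p.1 = U.intOp hU t p.2} := by
    ext p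
    rw [SetLike.mem_coe, mem_graph_generator, isGen_iff_forall_integral hU, Set.mem_iInter]
    rfl
  rw [this]
  exact isClosed_iInter fun t => isClosed_eq (by fun_prop) (by fun_prop)

/-- Both sides of the integrated identity at time `h` are differences of orbit integrals over
shifted intervals, and the expression is symmetric in `h` and `t`. -/
lemma isGen_intOp (hU : U.IsContraction) (t : ℝ≥0) (x : X) :
    U.IsGen (U.intOp hU t x) (x - U.rop t x) := by
  have hi := hU.intervalIntegrable_rop x
  have key : ∀ h t : ℝ≥0, U.rop h (U.intOp hU t x) = ∫ s in (h : ℝ)..(h + t : ℝ), U.rop s x := by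
    intro h t
    rw [intOp_apply, ← ContinuousLinearMap.intervalIntegral_comp_comm _ (hi _ _)]
    have : ∫ s in (0 : ℝ)..t, U.rop h (U.rop s x) = ∫ s in (0 : ℝ)..t, U.rop (h + s) x := by
      refine intervalIntegral.integral_congr fun s hs => ?_
      rw [Set.uIcc_of_le (NNReal.coe_nonneg t)] at hs
      exact (U.rop_add_apply h.2 hs.1 x).symm
    rw [this, intervalIntegral.integral_comp_add_left (fun s => U.rop s x), add_zero]
  refine isGen_of_forall_integral hU fun h => ?_
  have e : U.intOp hU h (U.rop t x) = U.rop t (U.intOp hU h x) := by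
    rw [intOp_apply, intOp_apply, ← ContinuousLinearMap.intervalIntegral_comp_comm _ (hi _ _)]
    refine intervalIntegral.integral_congr fun s hs => ?_
    rw [Set.uIcc_of_le (NNReal.coe_nonneg h)] at hs
    exact U.rop_comm_apply hs.1 t.2 x
  rw [map_sub, e, key, key, intOp_apply, intOp_apply,
    ← intervalIntegral.integral_interval_sub_interval_comm (hi _ _) (hi _ _) (hi _ _),
    add_comm (t : ℝ) h]

/-- Hille's theorem: the bounded operators in the integrated identities commute with the integral.
Asking for interior points only allows integrands that are singular at an endpoint. -/
lemma IsGen.intervalIntegral (hU : U.IsContraction) {f g : ℝ → X} {a b : ℝ} (hab : a ≤ b)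
    (hf : IntervalIntegrable f volume a b) (hg : IntervalIntegrable g volume a b)
    (h : ∀ s ∈ Set.Ioo a b, U.IsGen (f s) (g s)) :
    U.IsGen (∫ s in a..b, f s) (∫ s in a..b, g s) := by
  refine isGen_of_forall_integral hU fun t => ?_
  rw [← ContinuousLinearMap.intervalIntegral_comp_comm _ hf,
    ← ContinuousLinearMap.intervalIntegral_comp_comm _ hg, ← intervalIntegral.integral_sub hf
    ⟨(U.rop t).integrable_comp hf.1, (U.rop t).integrable_comp hf.2⟩]
  simp only [intervalIntegral.integral_of_le hab, integral_Ioc_eq_integral_Ioo]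
  exact setIntegral_congr_fun measurableSet_Ioo fun s hs => (h s hs).sub_rop_eq hU t.2

end C0Semigroup

/-! ### Exponentials of bounded operators -/

lemma HasDerivAt.clm_apply_complex {X Y : Type*} [NormedAddCommGroup X] [NormedSpace ℂ X]
    [NormedAddCommGroup Y] [NormedSpace ℂ Y] {c : ℝ → X →L[ℂ] Y} {c' : X →L[ℂ] Y} {u : ℝ → X}
    {u' : X} {t : ℝ} (hc : HasDerivAt c c' t) (hu : HasDerivAt u u' t) :
    HasDerivAt (fun s => c s (u s)) (c' (u t) + c t u') t :=
  HasDerivAt.clm_apply (c := fun s => (c s).restrictScalars ℝ) (c' := c'.restrictScalars ℝ)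
    ((ContinuousLinearMap.restrictScalarsL ℂ X Y ℝ ℝ).hasFDerivAt.comp_hasDerivAt t hc) hu

section BoundedExponential

lemma norm_one_clm_le {X : Type*} [NormedAddCommGroup X] [NormedSpace ℂ X] :
    ‖(1 : X →L[ℂ] X)‖ ≤ 1 := ContinuousLinearMap.norm_id_le

lemma norm_exp_clm_le {X : Type*} [NormedAddCommGroup X] [NormedSpace ℂ X] (K : X →L[ℂ] X) :
    ‖NormedSpace.exp K‖ ≤ Real.exp ‖K‖ := by
  rw [NormedSpace.exp_eq_tsum ℂ]
  have h : HasSum (fun n : ℕ => ‖K‖ ^ n / n.factorial) (Real.exp ‖K‖) := by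
    rw [Real.exp_eq_exp_ℝ]; exact NormedSpace.expSeries_div_hasSum_exp ‖K‖
  refine tsum_of_norm_bounded h fun n => ?_
  rw [norm_smul, norm_inv, div_eq_inv_mul]
  have e : ‖((n.factorial : ℕ) : ℂ)‖ = n.factorial := by simp
  rw [e]
  gcongr
  rcases Nat.eq_zero_or_pos n with rfl | hn
  · simpa using norm_one_clm_le
  · exact norm_pow_le' K hn

variable {X : Type*} [NormedAddCommGroup X] [NormedSpace ℂ X] [CompleteSpace X]

lemma hasDerivAt_exp_neg (K : X →L[ℂ] X) (t : ℝ) :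
    HasDerivAt (fun s : ℝ => NormedSpace.exp (s • -K)) (NormedSpace.exp (t • -K) * -K) t :=
  hasDerivAt_exp_smul_const (𝕂 := ℝ) (-K) t

/-- Interpolate by `e^{-sK} e^{-(t-s)L} x`, whose derivative in `s` is `e^{-sK} e^{-(t-s)L} (L - K)
x` because `K` and `L` commute. -/
lemma norm_exp_sub_exp_apply_le {K L : X →L[ℂ] X} (hKL : Commute K L)
    (hK : ∀ t : ℝ, 0 ≤ t → ‖NormedSpace.exp (t • -K)‖ ≤ 1)
    (hL : ∀ t : ℝ, 0 ≤ t → ‖NormedSpace.exp (t • -L)‖ ≤ 1) {t : ℝ} (ht : 0 ≤ t) (x : X) :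
    ‖NormedSpace.exp (t • -K) x - NormedSpace.exp (t • -L) x‖ ≤ t * ‖K x - L x‖ := by
  let f : ℝ → X := fun s => NormedSpace.exp (s • -K) (NormedSpace.exp ((t - s) • -L) x)
  have hf : ∀ s, HasDerivAt f
      (NormedSpace.exp (s • -K) (NormedSpace.exp ((t - s) • -L) (L x - K x))) s := by
    intro s
    have h1 := hasDerivAt_exp_neg K s
    have h2 : HasDerivAt (fun s : ℝ => NormedSpace.exp ((t - s) • -L))
        ((-1 : ℝ) • (NormedSpace.exp ((t - s) • -L) * -L)) s :=
      (hasDerivAt_exp_neg L (t - s)).scomp s (by simpa using (hasDerivAt_id s).const_sub t)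
    have h3 := h1.mul h2
    have h4 := h3.clm_apply_complex (hasDerivAt_const s x)
    refine h4.congr_deriv ?_
    have hc : Commute (NormedSpace.exp ((t - s) • -L)) K :=
      ((hKL.symm.neg_left).smul_left (t - s)).exp_left
    have hc' : NormedSpace.exp ((t - s) • -L) (K x) = K (NormedSpace.exp ((t - s) • -L) x) :=
      DFunLike.congr_fun hc.eq x
    simp only [_root_.map_sub, hc']
    simp [sub_eq_add_neg, add_comm]
  have h := norm_image_sub_le_of_norm_deriv_le_segment' (f := f) (a := 0) (b := t)
    (C := ‖K x - L x‖) (fun s _ => (hf s).hasDerivWithinAt) (fun s hs => by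
      refine (ContinuousLinearMap.le_of_opNorm_le _ (hK s hs.1) _).trans ?_
      rw [one_mul]
      refine (ContinuousLinearMap.le_of_opNorm_le _ (hL _ (sub_nonneg.2 hs.2.le)) _).trans ?_
      rw [one_mul, norm_sub_rev]) t ⟨ht, le_rfl⟩
  have e0 : f 0 = NormedSpace.exp (t • -L) x := by simp [f]
  have e1 : f t = NormedSpace.exp (t • -K) x := by simp [f]
  rw [e0, e1, sub_zero] at h
  linarith

lemma norm_exp_sub_one_apply_le {K : X →L[ℂ] X}
    (hK : ∀ t : ℝ, 0 ≤ t → ‖NormedSpace.exp (t • -K)‖ ≤ 1) {t : ℝ} (ht : 0 ≤ t) (x : X) :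
    ‖NormedSpace.exp (t • -K) x - x‖ ≤ t * ‖K x‖ := by
  have := norm_exp_sub_exp_apply_le (Commute.zero_right K) hK (fun s _ => by
    simpa using norm_one_clm_le) ht x
  simpa using this

lemma norm_exp_sub_one_add_apply_le {K : X →L[ℂ] X} {t : ℝ} (ht : 0 ≤ t) (x : X) {C : ℝ}
    (hC : ∀ s ∈ Set.Icc 0 t, ‖NormedSpace.exp (s • -K) (K x) - K x‖ ≤ C) :
    ‖NormedSpace.exp (t • -K) x - x + t • K x‖ ≤ C * t := by
  let f : ℝ → X := fun s => NormedSpace.exp (s • -K) x + s • K x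
  have hf : ∀ s, HasDerivAt f (-(NormedSpace.exp (s • -K) (K x) - K x)) s := by
    intro s
    have h1 := (hasDerivAt_exp_neg K s).clm_apply_complex (hasDerivAt_const s x)
    have h2 := (hasDerivAt_id s).smul_const (K x)
    refine (h1.add h2).congr_deriv ?_
    simp
    abel
  have h := norm_image_sub_le_of_norm_deriv_le_segment' (f := f) (a := 0) (b := t)
    (C := C) (fun s _ => (hf s).hasDerivWithinAt) (fun s hs => by
      rw [norm_neg]; exact hC s ⟨hs.1, hs.2.le⟩) t ⟨ht, le_rfl⟩
  have e0 : f 0 = x := by simp [f]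
  rw [e0, sub_zero] at h
  simpa [f, add_sub_right_comm] using h

end BoundedExponential

/-! ### Accretive operators and resolvents -/

namespace LinearPMap

variable {X : Type*} [NormedAddCommGroup X] [NormedSpace ℂ X]

/-- Accretivity, in terms of norming functionals. -/
def IsAccretive (H : X →ₗ.[ℂ] X) : Prop :=
  ∀ p ∈ H.graph, ∀ φ : StrongDual ℂ X, ‖φ‖ ≤ 1 → φ p.1 = ‖p.1‖ → 0 ≤ (φ p.2).re

/-- Accretivity is required for every norming functional, so one and the same `φ` can be tested on
both summands. -/
lemma IsAccretive.add {A B : X →ₗ.[ℂ] X} (hA : A.IsAccretive) (hB : B.IsAccretive) :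
    (A + B).IsAccretive := by
  intro p hp φ hφ h
  obtain ⟨x, h1, h2⟩ := (LinearPMap.mem_graph_iff _).1 hp
  rw [LinearPMap.add_apply] at h2
  rw [← h2, _root_.map_add, Complex.add_re]
  rw [← h1] at h
  exact add_nonneg (hA _ (A.mem_graph ⟨x, x.2.1⟩) φ hφ h) (hB _ (B.mem_graph ⟨x, x.2.2⟩) φ hφ h)

lemma IsAccretive.le_norm {H : X →ₗ.[ℂ] X} (hH : H.IsAccretive) {x y : X}
    (h : (x, y) ∈ H.graph) (l : ℝ) : l * ‖x‖ ≤ ‖y + (l : ℂ) • x‖ := by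
  obtain ⟨φ, h1, h2⟩ := exists_dual_vector'' ℂ x
  have h3 := hH _ h φ h1 h2
  have h2' : φ x = ((‖x‖ : ℝ) : ℂ) := h2
  have h4 : (φ (y + (l : ℂ) • x)).re = (φ y).re + l * ‖x‖ := by
    rw [_root_.map_add, _root_.map_smul, h2', Complex.add_re, smul_eq_mul, ← Complex.ofReal_mul,
      Complex.ofReal_re]
  calc l * ‖x‖ ≤ (φ (y + (l : ℂ) • x)).re := by rw [h4]; simpa using h3
    _ ≤ ‖φ (y + (l : ℂ) • x)‖ := Complex.re_le_norm _
    _ ≤ 1 * ‖y + (l : ℂ) • x‖ := φ.le_of_opNorm_le h1 _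
    _ = _ := one_mul _

lemma IsAccretive.exists_resolvent {H : X →ₗ.[ℂ] X} (hH : H.IsAccretive) {l : ℝ} (hl : 0 < l)
    (hs : ∀ y, ∃ x z, (x, z) ∈ H.graph ∧ z + (l : ℂ) • x = y) :
    ∃ R : X →L[ℂ] X, ‖R‖ ≤ l⁻¹ ∧ (∀ y, (R y, y - (l : ℂ) • R y) ∈ H.graph) ∧
      ∀ x y, (x, y) ∈ H.graph → R (y + (l : ℂ) • x) = x := by
  choose r z hr hz using hs
  have hinj : ∀ x x' y y', (x, y) ∈ H.graph → (x', y') ∈ H.graph →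
      y + (l : ℂ) • x = y' + (l : ℂ) • x' → x = x' := by
    intro x x' y y' h h' e
    have := hH.le_norm (H.graph.sub_mem h h') l
    have e2 : y - y' + (l : ℂ) • (x - x') = 0 := by
      rw [smul_sub, sub_add_sub_comm, e, sub_self]
    rw [e2, norm_zero] at this
    have : ‖x - x'‖ ≤ 0 := by
      by_contra hc
      push Not at hc
      have := mul_pos hl hc
      linarith
    exact sub_eq_zero.1 (norm_le_zero_iff.1 this)
  let R : X →L[ℂ] X := LinearMap.mkContinuous
    { toFun := r
      map_add' := fun x y => by
        refine hinj _ _ _ _ (hr (x + y)) (H.graph.add_mem (hr x) (hr y)) ?_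
        rw [hz, smul_add, add_add_add_comm, hz, hz]
      map_smul' := fun c x => by
        refine hinj _ _ _ _ (hr (c • x)) (H.graph.smul_mem c (hr x)) ?_
        rw [hz, smul_comm, RingHom.id_apply, ← smul_add, hz] } l⁻¹ fun y => by
          have := hH.le_norm (hr y) l
          rw [hz] at this
          rw [inv_mul_eq_div, le_div_iff₀ hl, mul_comm]
          exact this
  refine ⟨R, LinearMap.mkContinuous_norm_le _ (by positivity) _, fun y => ?_, fun x y h => ?_⟩
  · have : y - (l : ℂ) • R y = z y := by
      rw [sub_eq_iff_eq_add]; exact (hz y).symm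
    rw [this]; exact hr y
  · exact hinj _ _ _ _ (hr _) h (hz _)

end LinearPMap

namespace C0Semigroup

variable {X : Type*} [NormedAddCommGroup X] [NormedSpace ℂ X] {U : C0Semigroup X}

lemma IsContraction.isAccretive (hU : U.IsContraction) : U.generator.IsAccretive := by
  intro p hp φ hφ h
  have h1 : Tendsto (fun t => (φ (U.diffQuot p.1 t)).re) (𝓝[>] 0) (𝓝 (φ p.2).re) :=
    ((Complex.continuous_re.comp φ.continuous).tendsto _).comp (mem_graph_generator.1 hp)
  refine ge_of_tendsto' h1 fun t => ?_
  rw [diffQuot, map_smul, map_sub, h, smul_eq_mul, ← Complex.ofReal_inv, Complex.re_ofReal_mul,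
    Complex.sub_re, Complex.ofReal_re]
  refine mul_nonneg (by positivity) (sub_nonneg.2 ?_)
  refine (Complex.re_le_norm _).trans ?_
  refine (φ.le_of_opNorm_le hφ _).trans ?_
  rw [one_mul]
  simpa using (U.op t).le_of_opNorm_le (hU t) p.1

/-- The rescaled semigroup `e^{-lt} U t`. -/
noncomputable def rescale (U : C0Semigroup X) (l : ℝ) : C0Semigroup X where
  op t := (Real.exp (-(l * t)) : ℂ) • U.op t
  op_zero := by simp [U.op_zero]
  op_add s t := by
    rw [U.op_add, smul_mul_smul_comm, ← Complex.ofReal_mul, ← Real.exp_add]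
    congr 3
    push_cast
    ring_nf
  tendsto_zero x := by
    have h1 : Tendsto (fun t : ℝ≥0 => (Real.exp (-(l * t)) : ℂ)) (𝓝[>] 0) (𝓝 1) := by
      have : Continuous fun t : ℝ≥0 => (Real.exp (-(l * t)) : ℂ) := by fun_prop
      simpa using (this.tendsto 0).mono_left nhdsWithin_le_nhds
    simpa using h1.smul (U.tendsto_zero x)

lemma rescale_rop (U : C0Semigroup X) (l : ℝ) {s : ℝ} (hs : 0 ≤ s) :
    (U.rescale l).rop s = Real.exp (-(l * s)) • U.rop s := by
  rw [← Complex.coe_smul]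
  simp only [rop, rescale, Real.coe_toNNReal _ hs]

lemma IsContraction.norm_rescale_le (hU : U.IsContraction) (l : ℝ) (t : ℝ≥0) :
    ‖(U.rescale l).op t‖ ≤ Real.exp (-(l * t)) := by
  simp only [rescale]
  rw [norm_smul, Complex.norm_real, Real.norm_of_nonneg (Real.exp_nonneg _)]
  exact mul_le_of_le_one_right (Real.exp_nonneg _) (hU t)

lemma IsContraction.rescale (hU : U.IsContraction) {l : ℝ} (hl : 0 ≤ l) :
    (U.rescale l).IsContraction := fun t =>
  (hU.norm_rescale_le l t).trans (Real.exp_le_one_iff.2 (by have := t.2; simpa using by positivity))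

lemma IsGen.of_rescale {l : ℝ} {x y : X} (h : (U.rescale l).IsGen x y) :
    U.IsGen x (y - (l : ℂ) • x) := by
  rw [isGen_iff_hasDerivWithinAt] at h ⊢
  have h1 : HasDerivAt (fun s : ℝ => Real.exp (l * s)) l 0 := by
    simpa using ((hasDerivAt_id (0 : ℝ)).const_mul l).exp
  have h2 := h1.hasDerivWithinAt.smul h
  have e : ∀ s : ℝ, 0 ≤ s → U.rop s x = Real.exp (l * s) • (U.rescale l).rop s x := by
    intro s hs
    rw [rescale_rop U l hs]
    simp only [smul_apply, smul_smul, ← Real.exp_add]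
    simp
  refine (h2.congr (fun s hs => e s (le_of_lt hs)) (e 0 le_rfl)).congr_deriv ?_
  simp
  abel

variable [CompleteSpace X]

/-- With `V s = e^{-ls} U s` one has `(A + l) ∫₀¹ V s w ds = w - V 1 w`, and `1 - V 1` is invertible
by a Neumann series since `‖V 1‖ ≤ e^{-l} < 1`. -/
lemma IsContraction.generator_surj (hU : U.IsContraction) {l : ℝ} (hl : 0 < l) (y : X) :
    ∃ x z, (x, z) ∈ U.generator.graph ∧ z + (l : ℂ) • x = y := by
  have hc := hU.rescale hl.le
  have h1 : ‖(U.rescale l).rop 1‖ < 1 := by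
    have := hU.norm_rescale_le l 1
    have e : (U.rescale l).op 1 = (U.rescale l).rop 1 := by simp [rop]
    rw [e] at this
    refine this.trans_lt ?_
    rw [Real.exp_lt_one_iff]; simpa using hl
  obtain ⟨K, hK⟩ := isUnit_one_sub_of_norm_lt_one h1
  let w := (↑K⁻¹ : X →L[ℂ] X) y
  have hw : w - (U.rescale l).rop 1 w = y := by
    have : (K * ↑K⁻¹ : X →L[ℂ] X) y = y := by simp
    rw [hK] at this
    simpa using this
  have h2 := isGen_intOp hc 1 w
  rw [NNReal.coe_one, hw] at h2
  exact ⟨_, _, mem_graph_generator.2 h2.of_rescale, by simp⟩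

lemma IsContraction.exists_resolvent (hU : U.IsContraction) {l : ℝ} (hl : 0 < l) :
    ∃ R : X →L[ℂ] X, ‖R‖ ≤ l⁻¹ ∧ (∀ y, U.IsGen (R y) (y - (l : ℂ) • R y)) ∧
      ∀ x y, U.IsGen x y → R (y + (l : ℂ) • x) = x := by
  simpa only [mem_graph_generator] using hU.isAccretive.exists_resolvent hl (hU.generator_surj hl)

end C0Semigroup

/-! ### The Hille–Yosida theorem -/

lemma isClosed_setOf_tendsto_clm {X : Type*} [NormedAddCommGroup X] [NormedSpace ℂ X]
    {ι : Type*} {l : Filter ι} (E : ι → X →L[ℂ] X) (L : X →L[ℂ] X) {C : ℝ}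
    (hE : ∀ᶠ i in l, ‖E i‖ ≤ C) : IsClosed {x | Tendsto (fun i => E i x) l (𝓝 (L x))} := by
  rw [← isSeqClosed_iff_isClosed]
  intro u x hu hux
  rw [Set.mem_ofPred_eq, Metric.tendsto_nhds]
  intro ε hε
  have hC : 0 < |C| + ‖L‖ + 1 := by positivity
  obtain ⟨k, hk⟩ := (Metric.tendsto_nhds.1 hux (ε / (2 * (|C| + ‖L‖ + 1))) (by positivity)).exists
  filter_upwards [Metric.tendsto_nhds.1 (hu k) (ε / 2) (by positivity), hE] with i hi hiC
  rw [dist_eq_norm] at *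
  have h1 : E i x - L x = (E i (u k) - L (u k)) + (L (u k - x) - E i (u k - x)) := by
    simp only [map_sub]; abel
  rw [h1]
  refine (norm_add_le _ _).trans_lt ?_
  have h2 : ‖L (u k - x) - E i (u k - x)‖ ≤ (|C| + ‖L‖ + 1) * ‖u k - x‖ := by
    refine (norm_sub_le _ _).trans ?_
    have := (E i).le_of_opNorm_le (hiC.trans (le_abs_self C)) (u k - x)
    have := L.le_opNorm (u k - x)
    nlinarith [norm_nonneg (u k - x)]
  rw [lt_div_iff₀ (by positivity)] at hk
  linarith

section HilleYosida

variable {X : Type*} [NormedAddCommGroup X] [NormedSpace ℂ X] [CompleteSpace X]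

/-- The Hille–Yosida theorem for contraction semigroups. -/
theorem exists_semigroup_of_isAccretive {H : X →ₗ.[ℂ] X} (hH : H.IsAccretive)
    (hd : Dense (H.domain : Set X)) {l₀ : ℝ}
    (hs : ∀ l : ℝ, l₀ ≤ l → ∀ y, ∃ x z, (x, z) ∈ H.graph ∧ z + (l : ℂ) • x = y) :
    ∃ U : C0Semigroup X, U.IsContraction ∧ U.generator = H := by
  let l : ℕ → ℝ := fun n => |l₀| + 1 + n
  have hl : ∀ n, 0 < l n := fun n => by positivity
  have hl0 : ∀ n, l₀ ≤ l n := fun n => by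
    have := le_abs_self l₀
    have : (0 : ℝ) ≤ n := by positivity
    simp only [l]; linarith
  have hlt : Tendsto l atTop atTop :=
    tendsto_atTop_add_const_left _ _ tendsto_natCast_atTop_atTop
  choose R hR1 hR2 hR3 using fun n => hH.exists_resolvent (hl n) (hs _ (hl0 n))
  have hRle : ∀ n x, ‖R n x‖ ≤ (l n)⁻¹ * ‖x‖ := fun n x => (R n).le_of_opNorm_le (hR1 n) x
  -- Every limit statement below is checked on the dense domain and extended because equiboundedness
  -- makes its set of validity closed.
  have hdom : ∀ {P : X → Prop}, IsClosed {x | P x} → (∀ x y, (x, y) ∈ H.graph → P x) →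
      ∀ x, P x := by
    intro P hP h x
    have : closure (H.domain : Set X) ⊆ {x | P x} :=
      closure_minimal (fun x hx => h x _ (H.mem_graph ⟨x, hx⟩)) hP
    exact this (hd x)
  -- the resolvents commute
  have hres : ∀ n m y, R n y = R m y + ((l m : ℂ) - l n) • R n (R m y) := by
    intro n m y
    have h1 := hR3 n _ _ (hR2 m y)
    have h2 : y - (l m : ℂ) • R m y + (l n : ℂ) • R m y =
      y - ((l m : ℂ) - l n) • R m y := by rw [sub_smul]; abel
    rw [h2, map_sub, map_smul, sub_eq_iff_eq_add] at h1
    exact h1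
  have hcomm : ∀ n m, Commute (R n) (R m) := by
    intro n m
    by_cases hnm : l n = l m
    · have : R n = R m := by
        ext y; have := hres n m y; simpa [hnm] using this
      rw [this]
    · ext y
      have h1 := hres n m y
      have h2 := hres m n y
      have h3 : ((l m : ℂ) - l n) • (R n (R m y) - R m (R n y)) = 0 := by
        linear_combination (norm := module) (-1 : ℂ) • h1 - (1 : ℂ) • h2
      have h4 : (l m : ℂ) - l n ≠ 0 := by
        rw [sub_ne_zero]; intro h; exact hnm (by exact_mod_cast h.symm)
      exact sub_eq_zero.1 ((smul_eq_zero.1 h3).resolve_left h4)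
  -- approximation of the identity
  have happ : ∀ x, Tendsto (fun n => ((l n : ℂ) • R n) x) atTop (𝓝 x) := by
    refine hdom (isClosed_setOf_tendsto_clm (fun n => (l n : ℂ) • R n) 1 (C := 1)
      (Eventually.of_forall fun n => ?_)) fun x y h => ?_
    · rw [norm_smul, Complex.norm_real, Real.norm_of_nonneg (hl n).le]
      calc _ ≤ l n * (l n)⁻¹ := mul_le_mul_of_nonneg_left (hR1 n) (hl n).le
        _ = 1 := mul_inv_cancel₀ (hl n).ne'
    · have h1 : ∀ n, ((l n : ℂ) • R n) x = x - R n y := by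
        intro n
        have := hR3 n x y h
        rw [map_add, map_smul] at this
        rw [smul_apply, eq_sub_iff_add_eq, add_comm, this]
      simp only [h1]
      have h2 : Tendsto (fun n => R n y) atTop (𝓝 0) := by
        refine squeeze_zero_norm (fun n => hRle n y) ?_
        simpa using (tendsto_inv_atTop_zero.comp hlt).mul_const ‖y‖
      simpa using h2.const_sub x
  -- Yosida approximation
  let K : ℕ → X →L[ℂ] X := fun n => (l n : ℂ) • (1 - (l n : ℂ) • R n)
  have hK : ∀ n x y, (x, y) ∈ H.graph → K n x = ((l n : ℂ) • R n) y := by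
    intro n x y h
    have := hR3 n x y h
    rw [map_add, map_smul] at this
    simp only [K, smul_apply, sub_apply, one_apply_eq_self]
    congr 1
    rw [sub_eq_iff_eq_add, this]
  have hKt : ∀ x y, (x, y) ∈ H.graph → Tendsto (fun n => K n x) atTop (𝓝 y) := by
    intro x y h
    simp only [hK _ x y h]
    exact happ y
  have hKcomm : ∀ n m, Commute (K n) (K m) := by
    intro n m
    refine Commute.smul_left (Commute.smul_right ?_ _) _
    refine ((Commute.one_right _).sub_right (Commute.smul_right ?_ _))
    exact (Commute.one_left _).sub_left ((hcomm n m).smul_left _)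
  let E : ℕ → ℝ → X →L[ℂ] X := fun n t => NormedSpace.exp (t • -K n)
  have hE : ∀ n t, 0 ≤ t → ‖E n t‖ ≤ 1 := by
    intro n t ht
    -- `-K n = -l + l (l R)` with `‖l R‖ ≤ 1`, so the exponential is bounded by `e^{-tl} e^{tl} =
    -- 1`.
    have e : t • -K n = (-(t * l n) : ℝ) • (1 : X →L[ℂ] X) + (t * l n) • ((l n : ℂ) • R n) := by
      simp only [K, ← Complex.coe_smul]
      push_cast
      module
    let _ : NormedAlgebra ℚ (X →L[ℂ] X) := NormedAlgebra.restrictScalars ℚ ℂ _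
    have e1 : NormedSpace.exp ((-(t * l n) : ℝ) • (1 : X →L[ℂ] X)) =
        Real.exp (-(t * l n)) • (1 : X →L[ℂ] X) := by
      have := NormedSpace.algebraMap_exp_comm (𝕂 := ℝ) (𝔸 := X →L[ℂ] X) (-(t * l n))
      rw [Algebra.algebraMap_eq_smul_one, Algebra.algebraMap_eq_smul_one,
        ← Real.exp_eq_exp_ℝ] at this
      exact this.symm
    simp only [E]
    rw [e, NormedSpace.exp_add_of_commute ((Commute.one_left _).smul_left _), e1, smul_mul_assoc,
      one_mul, norm_smul, Real.norm_of_nonneg (Real.exp_nonneg _)]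
    calc _ ≤ Real.exp (-(t * l n)) * Real.exp (t * l n) := by
          gcongr
          refine (norm_exp_clm_le _).trans (Real.exp_le_exp.2 ?_)
          rw [norm_smul, norm_smul, Complex.norm_real, Real.norm_of_nonneg (hl n).le,
            Real.norm_of_nonneg (mul_nonneg ht (hl n).le)]
          refine mul_le_of_le_one_right (mul_nonneg ht (hl n).le) ?_
          calc _ ≤ l n * (l n)⁻¹ := mul_le_mul_of_nonneg_left (hR1 n) (hl n).le
            _ = 1 := mul_inv_cancel₀ (hl n).ne'
      _ = 1 := by rw [← Real.exp_add]; simp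
  have hEx : ∀ n t x, 0 ≤ t → ‖E n t x‖ ≤ ‖x‖ := fun n t x ht => by
    simpa using (E n t).le_of_opNorm_le (hE n t ht) x
  have hcau : ∀ t, 0 ≤ t → ∀ x, CauchySeq fun n => E n t x := by
    intro t ht
    have hdiff : ∀ n m x, ‖E n t x - E m t x‖ ≤ t * ‖K n x - K m x‖ := fun n m x =>
      norm_exp_sub_exp_apply_le (hKcomm n m) (hE n) (hE m) ht x
    refine hdom ?_ fun x y h => ?_
    · rw [← isSeqClosed_iff_isClosed]
      intro u x hu hux
      rw [Set.mem_ofPred_eq, Metric.cauchySeq_iff]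
      intro ε hε
      obtain ⟨k, hk⟩ := (Metric.tendsto_nhds.1 hux (ε / 3) (by positivity)).exists
      obtain ⟨N, hN⟩ := Metric.cauchySeq_iff.1 (hu k) (ε / 3) (by positivity)
      refine ⟨N, fun n hn m hm => ?_⟩
      have h1 := hN n hn m hm
      have h2 := hEx n t (u k - x) ht
      have h3 := hEx m t (u k - x) ht
      rw [dist_eq_norm] at *
      have : E n t x - E m t x =
          (E n t (u k) - E m t (u k)) - E n t (u k - x) + E m t (u k - x) := by
        simp only [map_sub]; abel
      rw [this]
      refine (norm_add_le _ _).trans_lt ?_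
      have := norm_sub_le (E n t (u k) - E m t (u k)) (E n t (u k - x))
      linarith
    · have hc := (hKt x y h).cauchySeq
      rw [Metric.cauchySeq_iff] at hc ⊢
      intro ε hε
      obtain ⟨N, hN⟩ := hc (ε / (t + 1)) (by positivity)
      refine ⟨N, fun n hn m hm => ?_⟩
      have h1 := hN n hn m hm
      rw [dist_eq_norm] at *
      refine (hdiff n m x).trans_lt ?_
      rw [lt_div_iff₀ (by positivity)] at h1
      nlinarith [norm_nonneg (K n x - K m x)]
  choose v hv using fun (t : ℝ≥0) x => cauchySeq_tendsto_of_complete (hcau t t.2 x)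
  let V : ℝ≥0 → X →L[ℂ] X := fun t =>
    continuousLinearMapOfTendsto (fun n => E n t) (tendsto_pi_nhds.2 (hv t))
  have hV : ∀ (t : ℝ≥0) x, Tendsto (fun n => E n t x) atTop (𝓝 (V t x)) := hv
  have hV1 : ∀ t, ‖V t‖ ≤ 1 := fun t => ContinuousLinearMap.opNorm_le_bound _ zero_le_one
    fun x => by
      rw [one_mul]
      exact le_of_tendsto (hV t x).norm (Eventually.of_forall fun n => hEx n t x t.2)
  have hVx : ∀ t x, ‖V t x‖ ≤ ‖x‖ := fun t x => by
    simpa using (V t).le_of_opNorm_le (hV1 t) x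
  have hVD : ∀ x y, (x, y) ∈ H.graph → ∀ t, ‖V t x - x‖ ≤ t * ‖y‖ := by
    intro x y h t
    refine le_of_tendsto_of_tendsto' ((hV t x).sub_const x).norm
      ((hKt x y h).norm.const_mul (t : ℝ)) fun n => ?_
    exact norm_exp_sub_one_apply_le (hE n) t.2 x
  let U : C0Semigroup X :=
    { op := V
      op_zero := by
        ext x
        refine tendsto_nhds_unique (hV 0 x) ?_
        simp [E]
      op_add := fun s t => by
        ext x
        refine tendsto_nhds_unique (hV (s + t) x) ?_
        have e : ∀ n, E n (s + t) x = E n s (V t x) + E n s (E n t x - V t x) := by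
          intro n
          have : E n (s + t) = E n s * E n t := by
            let _ : NormedAlgebra ℚ (X →L[ℂ] X) := NormedAlgebra.restrictScalars ℚ ℂ _
            simp only [E]
            rw [add_smul, NormedSpace.exp_add_of_commute]
            exact ((Commute.refl _).smul_left _).smul_right _
          rw [this]; simp [map_sub]
        have h0 : Tendsto (fun n => E n s (E n t x - V t x)) atTop (𝓝 0) := by
          refine squeeze_zero_norm (fun n => hEx n s _ s.2) ?_
          simpa using ((hV t x).sub_const (V t x)).norm
        have := (hV s (V t x)).add h0
        rw [add_zero] at this
        exact this.congr fun n => (e n).symm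
      tendsto_zero := by
        refine hdom (isClosed_setOf_tendsto_clm (fun t => V t) 1 (C := 1)
          (Eventually.of_forall hV1)) fun x y h => ?_
        rw [tendsto_iff_norm_sub_tendsto_zero]
        refine squeeze_zero (fun _ => norm_nonneg _) (fun t => hVD x y h t) ?_
        have : Continuous fun t : ℝ≥0 => (t : ℝ) * ‖y‖ := by fun_prop
        simpa using (this.tendsto 0).mono_left nhdsWithin_le_nhds }
  have hU : U.IsContraction := hV1
  refine ⟨U, hU, ?_⟩
  have hle : ∀ x y, (x, y) ∈ H.graph → U.IsGen x y := by
    intro x y h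
    -- `K n x` need not lie in the domain, so it is compared with a domain element `z` near `y`; the
    -- bound is proved for the approximants and passed to the limit.
    have hb : ∀ z w, (z, w) ∈ H.graph → ∀ t : ℝ≥0,
        ‖V t x - x + (t : ℝ) • y‖ ≤ (2 * ‖y - z‖ + t * ‖w‖) * t := by
      intro z w hzw t
      have hlim : Tendsto (fun n => (2 * ‖K n x - z‖ + t * ‖K n z‖) * (t : ℝ)) atTop
          (𝓝 ((2 * ‖y - z‖ + t * ‖w‖) * t)) :=
        (((((hKt x y h).sub_const z).norm).const_mul 2).add
          ((hKt z w hzw).norm.const_mul _)).mul_const _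
      refine le_of_tendsto_of_tendsto' (((hV t x).sub_const x).add
        ((hKt x y h).const_smul (t : ℝ))).norm hlim fun n => ?_
      refine norm_exp_sub_one_add_apply_le t.2 x fun s hs => ?_
      have e : E n s (K n x) - K n x = E n s (K n x - z) - (K n x - z) + (E n s z - z) := by
        simp only [map_sub]; abel
      have h1 := hEx n s (K n x - z) hs.1
      have h2 : ‖E n s z - z‖ ≤ s * ‖K n z‖ := norm_exp_sub_one_apply_le (hE n) hs.1 z
      have h3 : s * ‖K n z‖ ≤ t * ‖K n z‖ := mul_le_mul_of_nonneg_right hs.2 (norm_nonneg _)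
      change ‖E n s (K n x) - K n x‖ ≤ _
      rw [e]
      have := norm_add_le (E n s (K n x - z) - (K n x - z)) (E n s z - z)
      have := norm_sub_le (E n s (K n x - z)) (K n x - z)
      linarith
    rw [C0Semigroup.IsGen, Metric.tendsto_nhds]
    intro ε hε
    obtain ⟨z, hz, hz'⟩ := Metric.dense_iff.1 hd y (ε / 4) (by positivity)
    have hc : Tendsto (fun t : ℝ≥0 => 2 * ‖y - z‖ + t * ‖H ⟨z, hz'⟩‖) (𝓝[>] 0)
        (𝓝 (2 * ‖y - z‖)) := by
      have : Continuous fun t : ℝ≥0 => 2 * ‖y - z‖ + t * ‖H ⟨z, hz'⟩‖ := by fun_prop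
      simpa using (this.tendsto 0).mono_left nhdsWithin_le_nhds
    have hlt : 2 * ‖y - z‖ < ε := by
      rw [Metric.mem_ball, dist_comm, dist_eq_norm] at hz
      linarith
    filter_upwards [hc.eventually (gt_mem_nhds hlt), self_mem_nhdsWithin] with t ht ht0
    have htp : (0 : ℝ) < t := ht0
    have e : U.diffQuot x t - y = -((t : ℝ)⁻¹ • (V t x - x + (t : ℝ) • y)) := by
      rw [C0Semigroup.diffQuot, ← Complex.ofReal_inv, Complex.coe_smul, smul_add,
        inv_smul_smul₀ htp.ne', neg_add, ← smul_neg, neg_sub, sub_eq_add_neg]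
    rw [dist_eq_norm, e, norm_neg, norm_smul, norm_inv, Real.norm_of_nonneg htp.le,
      inv_mul_eq_div, div_lt_iff₀ htp]
    exact (hb z _ (H.mem_graph ⟨z, hz'⟩) t).trans_lt (mul_lt_mul_of_pos_right ht htp)
  -- `H` is contained in the generator; equality follows since `H + l` is onto while the generator
  -- plus `l` is injective.
  refine LinearPMap.eq_of_eq_graph (le_antisymm ?_ ?_)
  · rintro ⟨x, y⟩ hp
    have hxy := hp
    obtain ⟨x', z', h1, h2⟩ := hs (l 0) (hl0 0) (y + (l 0 : ℂ) • x)
    have h3 : (x', z') ∈ U.generator.graph := C0Semigroup.mem_graph_generator.2 (hle _ _ h1)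
    have h4 := hU.isAccretive.le_norm (U.generator.graph.sub_mem hxy h3) (l 0)
    have h5 : y - z' + (l 0 : ℂ) • (x - x') = 0 := by
      rw [smul_sub, sub_add_sub_comm, h2, sub_self]
    rw [h5, norm_zero] at h4
    have h6 : ‖x - x'‖ ≤ 0 := by
      by_contra hc
      push Not at hc
      have := mul_pos (hl 0) hc
      linarith
    have h7 : x = x' := sub_eq_zero.1 (norm_le_zero_iff.1 h6)
    rw [← h7] at h1 h2
    rw [add_right_cancel h2] at h1
    exact h1
  · rintro ⟨x, y⟩ hp
    exact C0Semigroup.mem_graph_generator.2 (hle x y hp)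

end HilleYosida

/-! ### Smoothing by holomorphic semigroups -/

lemma openSector_mem_nhds_one {θ : ℝ} (hθ : 0 < θ) : openSector θ ∈ 𝓝 (1 : ℂ) := by
  have h1 : ∀ᶠ z in 𝓝 (1 : ℂ), z ≠ 0 := isOpen_ne.mem_nhds one_ne_zero
  have h2 : ContinuousAt (fun z : ℂ => |Complex.arg z|) 1 :=
    (Complex.continuousAt_arg (by simp)).abs
  have h3 := h2.eventually_lt (continuousAt_const (y := θ)) (by simpa using hθ)
  filter_upwards [h1, h3] with z hz hz' using ⟨hz, hz'⟩

/-- The sector is invariant under positive dilations, so a ball around `1` can be scaled. A radius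
proportional to `t` is what makes Cauchy's estimate produce `1 / t`. -/
lemma exists_ball_subset_openSector {θ : ℝ} (hθ : 0 < θ) :
    ∃ c > 0, ∀ t : ℝ, 0 < t → Metric.closedBall (t : ℂ) (c * t) ⊆ openSector θ := by
  obtain ⟨c, hc, h⟩ := Metric.nhds_basis_closedBall.mem_iff.1 (openSector_mem_nhds_one hθ)
  refine ⟨c, hc, fun t ht z hz => ?_⟩
  have htc : (t : ℂ) ≠ 0 := by exact_mod_cast ht.ne'
  have e : z = t * (z / t) := by field_simp
  have h1 : z / t ∈ openSector θ := by
    apply h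
    rw [Metric.mem_closedBall, dist_eq_norm] at hz ⊢
    have : z / t - 1 = (z - t) / t := by field_simp
    rw [this, norm_div, Complex.norm_real, Real.norm_of_nonneg ht.le, div_le_iff₀ ht]
    exact hz
  rw [e]
  exact ⟨mul_ne_zero htc h1.1, by rw [Complex.arg_real_mul _ ht]; exact h1.2⟩

namespace C0Semigroup

variable {X : Type*} [NormedAddCommGroup X] [NormedSpace ℂ X]

/-- The smoothing estimates of a bounded holomorphic semigroup `U` on the half-line: `U` is
norm differentiable with derivative `-D t`, where `D t = A U t` and `‖D t‖ ≤ C / t`. -/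
structure IsSmoothing (U : C0Semigroup X) (D : ℝ → X →L[ℂ] X) (C : ℝ) : Prop where
  hasDerivAt : ∀ t, 0 < t → HasDerivAt U.rop (-D t) t
  norm_le : ∀ t, 0 < t → ‖D t‖ ≤ C / t
  isGen : ∀ t, 0 < t → ∀ x, U.IsGen (U.rop t x) (D t x)

variable {U : C0Semigroup X}

lemma isGen_of_hasDerivAt_rop {D : X →L[ℂ] X} {t : ℝ} (ht : 0 < t)
    (h : HasDerivAt U.rop (-D) t) (x : X) : U.IsGen (U.rop t x) (D x) := by
  rw [isGen_iff_hasDerivWithinAt]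
  have h1 : HasDerivAt (fun s : ℝ => U.rop (s + t)) (-D) 0 := by
    have := HasDerivAt.comp_add_const (f := U.rop) 0 t (by simpa using h)
    simpa using this
  have h2 := (h1.clm_apply_complex (hasDerivAt_const 0 x)).hasDerivWithinAt (s := Set.Ioi 0)
  rw [map_zero, add_zero] at h2
  refine h2.congr (fun s hs => ?_) ?_
  · exact (U.rop_add_apply (le_of_lt hs) ht.le x).symm
  · simp

lemma IsHolomorphicContraction.exists_isSmoothing [CompleteSpace X] {θ : ℝ} (hθ : 0 < θ)
    (h : U.IsHolomorphicContraction θ) : ∃ D C, U.IsSmoothing D C := by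
  obtain ⟨-, W, hW, hWU⟩ := h
  -- Boundedness is available only on strictly smaller sectors; half the angle is used for the
  -- Cauchy estimate.
  obtain ⟨M, hM⟩ := hW.bounded (θ / 2) (by positivity) (by linarith)
  rw [sub_half] at hM
  obtain ⟨c, hc, hball⟩ := exists_ball_subset_openSector (half_pos hθ)
  have hsub : openSector (θ / 2) ⊆ openSector θ := fun z hz => ⟨hz.1, by linarith [hz.2]⟩
  have hder : ∀ t : ℝ, 0 < t → HasDerivAt U.rop (deriv W t) t := by
    intro t ht
    have h1 : openSector θ ∈ 𝓝 (t : ℂ) :=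
      mem_of_superset (Metric.closedBall_mem_nhds _ (by positivity)) ((hball t ht).trans hsub)
    have h2 := HasDerivAt.scomp t (hW.analytic.differentiableAt h1).hasDerivAt
      Complex.ofRealCLM.hasDerivAt
    rw [Complex.ofRealCLM_apply, Complex.ofReal_one, one_smul] at h2
    refine h2.congr_of_eventuallyEq ?_
    filter_upwards [lt_mem_nhds ht] with s hs
    have := hWU s.toNNReal (Real.toNNReal_pos.2 hs)
    rw [Real.coe_toNNReal _ hs.le] at this
    exact this.symm
  refine ⟨fun t => -deriv W t, M / c, fun t ht => ?_, fun t ht => ?_, fun t ht x => ?_⟩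
  · rw [neg_neg]; exact hder t ht
  · rw [norm_neg, div_div]
    refine Complex.norm_deriv_le_of_forall_mem_sphere_norm_le (by positivity)
      (hW.analytic.diffContOnCl_ball ((hball t ht).trans hsub)) fun z hz => hM z ?_
    exact hball t ht (Metric.sphere_subset_closedBall hz)
  · refine isGen_of_hasDerivAt_rop ht ?_ x
    rw [neg_neg]; exact hder t ht

namespace IsSmoothing

variable {D : ℝ → X →L[ℂ] X} {C : ℝ}

lemma nonneg (h : U.IsSmoothing D C) : 0 ≤ C := by
  have := (norm_nonneg _).trans (h.norm_le 1 one_pos)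
  simpa using this

lemma apply_eq (h : U.IsSmoothing D C) {x y : X} (hx : U.IsGen x y) {t : ℝ} (ht : 0 < t) :
    D t x = U.rop t y := (h.isGen t ht x).unique (hx.rop ht.le)

lemma norm_sub_le (h : U.IsSmoothing D C) {a b : ℝ} (ha : 0 < a) (hab : a ≤ b) :
    ‖U.rop b - U.rop a‖ ≤ C / a * (b - a) := by
  refine norm_image_sub_le_of_norm_deriv_le_segment' (f := U.rop) (f' := fun s => -D s)
    (fun s hs => (h.hasDerivAt s (ha.trans_le hs.1)).hasDerivWithinAt) (fun s hs => ?_) b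
    ⟨hab, le_rfl⟩
  rw [norm_neg]
  exact (h.norm_le s (ha.trans_le hs.1)).trans
    (div_le_div_of_nonneg_left h.nonneg ha hs.1)

end IsSmoothing

lemma rop_tendsto_zero (U : C0Semigroup X) (hU : U.IsContraction) (x : X) :
    Tendsto (fun t : ℝ => U.rop t x) (𝓝[>] 0) (𝓝 x) := by
  have := (hU.continuous_rop x).tendsto 0
  rw [rop_zero] at this
  exact this.mono_left nhdsWithin_le_nhds

lemma IsSmoothing.dense_domain {D : ℝ → X →L[ℂ] X} {C : ℝ} (h : U.IsSmoothing D C)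
    (hU : U.IsContraction) : Dense (U.generator.domain : Set X) := fun x =>
  mem_closure_of_tendsto (U.rop_tendsto_zero hU x) (by
    filter_upwards [self_mem_nhdsWithin] with t ht using (h.isGen t ht x).mem)

/-! ### Fractional powers composed with the semigroup -/

section FractionalPower

variable {D : ℝ → X →L[ℂ] X} {C α : ℝ}

lemma fracIntegrand_eq (x : X) (s : ℝ) :
    U.fracIntegrand α x s = s ^ (-α - 1) • (U.rop s x - x) := rfl

lemma IsContraction.continuousOn_fracIntegrand (hU : U.IsContraction) (x : X) :
    ContinuousOn (U.fracIntegrand α x) (Set.Ioi 0) := by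
  have h : ContinuousOn (fun s : ℝ => s ^ (-α - 1)) (Set.Ioi 0) := fun s hs =>
    (Real.continuousAt_rpow_const _ _ (Or.inl (ne_of_gt hs))).continuousWithinAt
  exact h.smul ((hU.continuous_rop x).sub continuous_const).continuousOn

lemma integrableOn_Ioc_rpow_neg {a : ℝ} (ha : a < 1) (t : ℝ) (ht : 0 ≤ t) :
    IntegrableOn (fun s : ℝ => s ^ (-a)) (Set.Ioc 0 t) :=
  (intervalIntegrable_iff_integrableOn_Ioc_of_le ht).1
    (intervalIntegral.intervalIntegrable_rpow' (by linarith))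

lemma integral_rpow_neg {a : ℝ} (ha : a < 1) (t : ℝ) :
    ∫ s in (0 : ℝ)..t, s ^ (-a) = t ^ (1 - a) / (1 - a) := by
  rw [integral_rpow (Or.inl (by linarith)), Real.zero_rpow (by linarith)]
  ring_nf

lemma IsContraction.norm_fracIntegrand_le (hU : U.IsContraction) (x : X) {s : ℝ}
    (hs : 0 < s) : ‖U.fracIntegrand α x s‖ ≤ s ^ (-α - 1) * (2 * ‖x‖) := by
  rw [fracIntegrand_eq, norm_smul, Real.norm_of_nonneg (by positivity)]
  gcongr
  refine (norm_sub_le _ _).trans ?_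
  linarith [hU.norm_rop_apply_le s x]

lemma fracPowCore_apply {x : X} (hx : x ∈ (U.fracPowCore α).domain) :
    U.fracPowCore α ⟨x, hx⟩ =
      (Real.Gamma (-α))⁻¹ • ∫ s in Set.Ioi (0 : ℝ), U.fracIntegrand α x s := rfl

variable [CompleteSpace X]

lemma IsGen.norm_fracIntegrand_le (hU : U.IsContraction) {x y : X} (h : U.IsGen x y) {s : ℝ}
    (hs : 0 < s) : ‖U.fracIntegrand α x s‖ ≤ s ^ (-α) * ‖y‖ := by
  rw [fracIntegrand_eq, norm_smul, Real.norm_of_nonneg (by positivity), norm_sub_rev]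
  calc _ ≤ s ^ (-α - 1) * (s * ‖y‖) := by gcongr; exact h.norm_sub_rop_le hU hs.le
    _ = s ^ (-α) * ‖y‖ := by
      rw [← mul_assoc, ← Real.rpow_add_one hs.ne']; ring_nf

lemma IsGen.integrableOn_fracIntegrand (hU : U.IsContraction) {x y : X} (h : U.IsGen x y)
    (h0 : 0 < α) (h1 : α < 1) {t : ℝ} (ht : 0 < t) :
    IntegrableOn (U.fracIntegrand α x) (Set.Ioc 0 t) ∧
    IntegrableOn (U.fracIntegrand α x) (Set.Ioi t) := by
  have hc := hU.continuousOn_fracIntegrand (α := α) x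
  constructor
  · refine Integrable.mono' ((integrableOn_Ioc_rpow_neg h1 t ht.le).mul_const ‖y‖)
      ((hc.mono Set.Ioc_subset_Ioi_self).aestronglyMeasurable measurableSet_Ioc) ?_
    exact (ae_restrict_mem measurableSet_Ioc).mono fun s hs => h.norm_fracIntegrand_le hU hs.1
  · refine Integrable.mono' ((integrableOn_Ioi_rpow_of_lt (a := -α - 1) (by linarith) ht).mul_const
      (2 * ‖x‖)) ((hc.mono (Set.Ioi_subset_Ioi ht.le)).aestronglyMeasurable measurableSet_Ioi) ?_
    exact (ae_restrict_mem measurableSet_Ioi).mono fun s hs =>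
      hU.norm_fracIntegrand_le x (ht.trans hs)

/-- Near `0` the integrand is bounded through `y = A x`, near infinity through contractivity. When
`‖y‖` is of order `1 / t`, cutting at this same `t` makes both parts of order `t^(-α)`. -/
lemma IsGen.norm_integral_fracIntegrand_le (hU : U.IsContraction) {x y : X} (h : U.IsGen x y)
    (h0 : 0 < α) (h1 : α < 1) {t : ℝ} (ht : 0 < t) :
    ‖∫ s in Set.Ioi (0 : ℝ), U.fracIntegrand α x s‖ ≤
      t ^ (1 - α) / (1 - α) * ‖y‖ + t ^ (-α) / α * (2 * ‖x‖) := by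
  obtain ⟨i1, i2⟩ := h.integrableOn_fracIntegrand hU h0 h1 ht
  rw [← Set.Ioc_union_Ioi_eq_Ioi ht.le, setIntegral_union Set.Ioc_disjoint_Ioi_same
    measurableSet_Ioi i1 i2]
  refine (norm_add_le _ _).trans (add_le_add ?_ ?_)
  · refine (norm_integral_le_of_norm_le
      ((integrableOn_Ioc_rpow_neg h1 t ht.le).mul_const ‖y‖)
      ((ae_restrict_mem measurableSet_Ioc).mono fun s hs =>
        h.norm_fracIntegrand_le hU hs.1)).trans_eq ?_
    rw [integral_mul_const, ← intervalIntegral.integral_of_le ht.le, integral_rpow_neg h1]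
  · refine (norm_integral_le_of_norm_le
      ((integrableOn_Ioi_rpow_of_lt (a := -α - 1) (by linarith) ht).mul_const (2 * ‖x‖))
      ((ae_restrict_mem measurableSet_Ioi).mono fun s hs =>
        hU.norm_fracIntegrand_le x (ht.trans hs))).trans_eq ?_
    rw [integral_mul_const, integral_Ioi_rpow_of_lt (by linarith) ht, sub_add_cancel,
      neg_div_neg_eq]

lemma IsGen.mem_fracPowCore (hU : U.IsContraction) {x y : X} (h : U.IsGen x y)
    (h0 : 0 < α) (h1 : α < 1) : x ∈ (U.fracPowCore α).domain := by
  refine ⟨h.mem, ?_⟩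
  obtain ⟨i1, i2⟩ := h.integrableOn_fracIntegrand hU h0 h1 one_pos
  rw [← Set.Ioc_union_Ioi_eq_Ioi zero_le_one]
  exact i1.union i2

lemma IsSmoothing.mem_fracPowCore (hD : U.IsSmoothing D C) (hU : U.IsContraction)
    (h0 : 0 < α) (h1 : α < 1) {t : ℝ} (ht : 0 < t) (x : X) :
    U.rop t x ∈ (U.fracPowCore α).domain := (hD.isGen t ht x).mem_fracPowCore hU h0 h1

lemma IsSmoothing.norm_fracPowCore_le (hD : U.IsSmoothing D C) (hU : U.IsContraction)
    (h0 : 0 < α) (h1 : α < 1) {t : ℝ} (ht : 0 < t) (x : X) :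
    ‖U.fracPowCore α ⟨_, hD.mem_fracPowCore hU h0 h1 ht x⟩‖ ≤
      |(Real.Gamma (-α))⁻¹| * (C / (1 - α) + 2 / α) * t ^ (-α) * ‖x‖ := by
  rw [fracPowCore_apply, norm_smul, Real.norm_eq_abs, mul_assoc, mul_assoc]
  refine mul_le_mul_of_nonneg_left ?_ (abs_nonneg _)
  refine ((hD.isGen t ht x).norm_integral_fracIntegrand_le hU h0 h1 ht).trans ?_
  have h2 : ‖D t x‖ ≤ C / t * ‖x‖ := (D t).le_of_opNorm_le (hD.norm_le t ht) x
  have h3 := hU.norm_rop_apply_le t x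
  have h4 : 0 < 1 - α := by linarith
  calc _ ≤ t ^ (1 - α) / (1 - α) * (C / t * ‖x‖) + t ^ (-α) / α * (2 * ‖x‖) := by gcongr
    _ = (C / (1 - α) + 2 / α) * (t ^ (-α) * ‖x‖) := by
      rw [show 1 - α = -α + 1 by ring, Real.rpow_add_one ht.ne']
      field_simp

lemma IsSmoothing.rop_fracPowCore (hD : U.IsSmoothing D C) (hU : U.IsContraction)
    (h0 : 0 < α) (h1 : α < 1) {t : ℝ} (ht : 0 < t) (x : (U.fracPowCore α).domain) :
    U.rop t (U.fracPowCore α x) = U.fracPowCore α ⟨_, hD.mem_fracPowCore hU h0 h1 ht x⟩ := by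
  obtain ⟨x, hx⟩ := x
  rw [fracPowCore_apply, fracPowCore_apply, ← Complex.coe_smul, map_smul, Complex.coe_smul,
    ← ContinuousLinearMap.integral_comp_comm _ hx.2]
  congr 1
  refine setIntegral_congr_fun measurableSet_Ioi fun s hs => ?_
  simp only [fracIntegrand_eq]
  rw [← Complex.coe_smul, map_smul, Complex.coe_smul, map_sub, U.rop_comm_apply ht.le (le_of_lt hs)]

/-- `U t` commutes with the operator, and the product is bounded for `t > 0`, so `‖U t z‖ ≤ k t *
‖x‖` on the closure of the graph. If `x = 0` then `U t z = 0`, and `t → 0` gives `z = 0`. Without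
closability `LinearPMap.closure` would return the operator unchanged. -/
lemma IsSmoothing.isClosable_fracPowCore (hD : U.IsSmoothing D C) (hU : U.IsContraction)
    (h0 : 0 < α) (h1 : α < 1) : (U.fracPowCore α).IsClosable := by
  let k : ℝ → ℝ := fun t => |(Real.Gamma (-α))⁻¹| * (C / (1 - α) + 2 / α) * t ^ (-α)
  have key : ∀ p ∈ (U.fracPowCore α).graph.topologicalClosure, ∀ t, 0 < t →
      ‖U.rop t p.2‖ ≤ k t * ‖p.1‖ := by
    intro p hp t ht
    have hcl : IsClosed {p : X × X | ‖U.rop t p.2‖ ≤ k t * ‖p.1‖} :=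
      isClosed_le (by fun_prop) (by fun_prop)
    refine closure_minimal (fun q hq => ?_) hcl hp
    obtain ⟨x, h1, h2⟩ := (LinearPMap.mem_graph_iff _).1 hq
    rw [Set.mem_ofPred_eq, ← h1, ← h2, hD.rop_fracPowCore hU h0 ‹_› ht]
    exact hD.norm_fracPowCore_le hU h0 ‹_› ht _
  refine ⟨(U.fracPowCore α).graph.topologicalClosure.toLinearPMap, ?_⟩
  rw [Submodule.toLinearPMap_graph_eq]
  intro p hp hp0
  have h2 : ∀ t, 0 < t → U.rop t p.2 = 0 := by
    intro t ht
    have := key p hp t ht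
    rw [hp0, norm_zero, mul_zero] at this
    exact norm_le_zero_iff.1 this
  refine tendsto_nhds_unique (U.rop_tendsto_zero hU p.2) ?_
  refine tendsto_const_nhds.congr' ?_
  filter_upwards [self_mem_nhdsWithin] with t ht using (h2 t ht).symm

/-- The fractional powers are closed and `‖A^α U t‖ ≤ c t^{-α}`. -/
lemma IsSmoothing.fracPow_smoothing (hD : U.IsSmoothing D C) (hU : U.IsContraction)
    (h0 : 0 ≤ α) (h1 : α < 1) : (U.fracPow α).IsClosed ∧
      ∃ c : ℝ, ∀ t, 0 < t → ∀ x, ∃ z, (U.rop t x, z) ∈ (U.fracPow α).graph ∧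
        ‖z‖ ≤ c * t ^ (-α) * ‖x‖ := by
  rcases h0.eq_or_lt with rfl | h0
  · have e : U.fracPow 0 = (LinearMap.id : X →ₗ[ℂ] X).toPMap ⊤ := by simp [fracPow]
    have hg : ∀ p : X × X, p ∈ (U.fracPow 0).graph ↔ p.1 = p.2 := by
      intro p
      rw [e, LinearPMap.mem_graph_iff]
      constructor
      · rintro ⟨y, h1, h2⟩
        rw [← h1, ← h2]; rfl
      · intro h
        exact ⟨⟨p.1, trivial⟩, rfl, h⟩
    refine ⟨?_, 1, fun t ht x => ⟨U.rop t x, (hg _).2 rfl, ?_⟩⟩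
    · have : ((U.fracPow 0).graph : Set (X × X)) = {p | p.1 = p.2} := by
        ext p; exact hg p
      rw [LinearPMap.IsClosed, this]
      exact isClosed_eq continuous_fst continuous_snd
    · simpa using hU.norm_rop_apply_le t x
  · have e : U.fracPow α = (U.fracPowCore α).closure := by simp [fracPow, h0.ne']
    have hcl := hD.isClosable_fracPowCore hU h0 h1
    rw [e]
    refine ⟨hcl.closure_isClosed, _, fun t ht x => ⟨_, ?_, hD.norm_fracPowCore_le hU h0 h1 ht x⟩⟩
    exact LinearPMap.le_graph_of_le (LinearPMap.le_closure _) 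
      (LinearPMap.mem_graph (U.fracPowCore α) ⟨_, hD.mem_fracPowCore hU h0 h1 ht x⟩)

end FractionalPower

/-! ### Relative boundedness of `B` and generation by `A + B` -/

variable [CompleteSpace X]

/-- The closed graph theorem, applied to `(x, P x) ↦ A x` on the graph of `P`, which is a Banach
space because `P` is closed. -/
lemma exists_bound_of_domain_le {P : X →ₗ.[ℂ] X} (hP : P.IsClosed) (hU : U.IsContraction)
    (h : P.domain ≤ U.generator.domain) :
    ∃ c : ℝ, 0 ≤ c ∧ ∀ x z, (x, z) ∈ P.graph → ∀ y, U.IsGen x y → ‖y‖ ≤ c * (‖x‖ + ‖z‖) := by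
  have hmem : ∀ p : P.graph, (LinearMap.fst ℂ X X ∘ₗ P.graph.subtype) p ∈ U.generator.domain :=
    fun p => h (LinearPMap.mem_domain_of_mem_graph (y := p.1.2) p.2)
  let T : P.graph →ₗ[ℂ] X :=
    U.generator.toFun ∘ₗ (LinearMap.fst ℂ X X ∘ₗ P.graph.subtype).codRestrict _ hmem
  have hT : ∀ p : P.graph, U.IsGen p.1.1 (T p) := fun p => isGen_generator ⟨p.1.1, hmem p⟩
  have : CompleteSpace P.graph := 
    (show IsClosed (P.graph : Set (X × X)) from hP).completeSpace_coe
  have hc : Continuous T := by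
    refine T.continuous_of_isClosed_graph ?_
    have e : (T.graph : Set (P.graph × X)) =
        (fun q : P.graph × X => (q.1.1.1, q.2)) ⁻¹' (U.generator.graph : Set (X × X)) := by
      ext q
      rw [SetLike.mem_coe, LinearMap.mem_graph_iff, Set.mem_preimage, SetLike.mem_coe,
        mem_graph_generator]
      exact ⟨fun h => h ▸ hT q.1, fun h => h.unique (hT q.1)⟩
    rw [e]
    exact (isClosed_graph_generator hU).preimage (by fun_prop)
  let T' : P.graph →L[ℂ] X := ⟨T, hc⟩
  refine ⟨‖T'‖, T'.opNorm_nonneg, fun x z hxz y hy => ?_⟩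
  have h1 := T'.le_opNorm ⟨(x, z), hxz⟩
  have h2 : T' ⟨(x, z), hxz⟩ = y := (hT ⟨(x, z), hxz⟩).unique hy
  rw [h2] at h1
  refine h1.trans (mul_le_mul_of_nonneg_left ?_ T'.opNorm_nonneg)
  exact max_le (le_add_of_nonneg_right (norm_nonneg _)) (le_add_of_nonneg_left (norm_nonneg _))

end C0Semigroup

lemma one_add_rpow_neg_le {α s T : ℝ} (h0 : 0 ≤ α) (h1 : α ≤ 1) (hs : 0 < s) (hT : s ≤ T) :
    1 + s ^ (-α) ≤ (2 + T) * s ^ (-α) := by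
  have h2 : 1 ≤ (1 + T) * s ^ (-α) := by
    rw [Real.rpow_neg hs.le, ← div_eq_mul_inv, one_le_div (by positivity)]
    rcases le_total s 1 with h | h
    · exact (Real.rpow_le_one hs.le h h0).trans (by linarith)
    · calc s ^ α ≤ s ^ (1 : ℝ) := Real.rpow_le_rpow_of_exponent_le h h1
        _ ≤ 1 + T := by rw [Real.rpow_one]; linarith
  linarith

lemma two_rpow_le_two {α : ℝ} (h1 : α ≤ 1) : (2 : ℝ) ^ α ≤ 2 := by
  calc (2 : ℝ) ^ α ≤ 2 ^ (1 : ℝ) := Real.rpow_le_rpow_of_exponent_le (by norm_num) h1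
    _ = 2 := Real.rpow_one 2

lemma half_rpow_neg_le {α a : ℝ} (h1 : α ≤ 1) (ha : 0 < a) : (a / 2) ^ (-α) ≤ 2 * a ^ (-α) := by
  rw [Real.div_rpow ha.le (by norm_num), div_eq_mul_inv, ← Real.rpow_neg (by norm_num), neg_neg,
    mul_comm]
  gcongr
  exact two_rpow_le_two h1

namespace C0Semigroup

variable {X : Type*} [NormedAddCommGroup X] [NormedSpace ℂ X]

lemma exists_clm_isGen (U : C0Semigroup X) (T : X →L[ℂ] X) {k : ℝ} (hk : 0 ≤ k)
    (h : ∀ x, ∃ z, U.IsGen (T x) z ∧ ‖z‖ ≤ k * ‖x‖) :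
    ∃ G : X →L[ℂ] X, (∀ x, U.IsGen (T x) (G x)) ∧ ‖G‖ ≤ k := by
  choose z hz hk' using h
  let L : X →ₗ[ℂ] X :=
    { toFun := z
      map_add' := fun x y => (hz (x + y)).unique (by rw [map_add]; exact (hz x).add (hz y))
      map_smul' := fun a x => (hz (a • x)).unique (by rw [map_smul]; exact (hz x).smul a) }
  exact ⟨L.mkContinuous k hk', hz, L.mkContinuous_norm_le hk hk'⟩

/-- The semigroups `UA`, `UB` with generators `A`, `B` are contractive, `UA` is smoothing, and
`g t = B UA t` is bounded with norm `O(1 + t ^ (-α))`. -/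
structure IsRelativelySmoothing (UA UB : C0Semigroup X) (D g : ℝ → X →L[ℂ] X) (C c α : ℝ) :
    Prop where
  contrA : UA.IsContraction
  contrB : UB.IsContraction
  smoothing : UA.IsSmoothing D C
  isGen : ∀ t, 0 < t → ∀ x, UB.IsGen (UA.rop t x) (g t x)
  norm_le : ∀ t, 0 < t → ‖g t‖ ≤ c * (1 + t ^ (-α))
  c_nonneg : 0 ≤ c
  nonneg : 0 ≤ α
  lt_one : α < 1

variable {UA UB : C0Semigroup X} {D g : ℝ → X →L[ℂ] X} {C c α : ℝ}

lemma exists_isRelativelySmoothing [CompleteSpace X] (hA : UA.IsContraction)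
    (hD : UA.IsSmoothing D C) (hB : UB.IsContraction) (h0 : 0 ≤ α) (h1 : α < 1)
    (hdom : (UA.fracPow α).domain ≤ UB.generator.domain) :
    ∃ g c, IsRelativelySmoothing UA UB D g C c α := by
  obtain ⟨hcl, c', hc'⟩ := hD.fracPow_smoothing hA h0 h1
  obtain ⟨k, hk0, hk⟩ := exists_bound_of_domain_le hcl hB hdom
  have key : ∀ t, 0 < t → ∀ x, ∃ z, UB.IsGen (UA.rop t x) z ∧
      ‖z‖ ≤ k * (1 + |c'|) * (1 + t ^ (-α)) * ‖x‖ := by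
    intro t ht x
    obtain ⟨z, hz, hz'⟩ := hc' t ht x
    obtain ⟨y, hy⟩ := exists_isGen (hdom (LinearPMap.mem_domain_of_mem_graph hz))
    refine ⟨y, hy, (hk _ _ hz y hy).trans ?_⟩
    have h3 := hA.norm_rop_apply_le t x
    have h4 : c' * t ^ (-α) * ‖x‖ ≤ |c'| * t ^ (-α) * ‖x‖ := by
      gcongr; exact le_abs_self _
    rw [mul_assoc, mul_assoc]
    refine mul_le_mul_of_nonneg_left ?_ hk0
    have h5 : 0 ≤ t ^ (-α) * ‖x‖ := by positivity
    have h6 : 0 ≤ |c'| * ‖x‖ := by positivity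
    nlinarith
  choose! g hg using fun t (ht : 0 < t) =>
    exists_clm_isGen UB (UA.rop t) (by positivity) (key t ht)
  exact ⟨g, k * (1 + |c'|), hA, hB, hD, fun t ht => (hg t ht).1, fun t ht => (hg t ht).2,
    by positivity, h0, h1⟩

namespace IsRelativelySmoothing

lemma norm_g_le (h : IsRelativelySmoothing UA UB D g C c α) {s T : ℝ} (hs : 0 < s)
    (hT : s ≤ T) : ‖g s‖ ≤ c * (2 + T) * s ^ (-α) := by
  refine (h.norm_le s hs).trans ?_
  rw [mul_assoc]
  exact mul_le_mul_of_nonneg_left (one_add_rpow_neg_le h.nonneg h.lt_one.le hs hT) h.c_nonneg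

lemma g_add (h : IsRelativelySmoothing UA UB D g C c α) {s t : ℝ} (hs : 0 < s) (ht : 0 ≤ t) :
    g (s + t) = g s * UA.rop t := by
  ext x
  refine (h.isGen (s + t) (by positivity) x).unique ?_
  rw [UA.rop_add_apply hs.le ht]
  exact h.isGen s hs _

/-- Factor `g b = g (a/2) U (b - a/2)`, and likewise `g a`: half of the time pays for `B`, the other
half for the Lipschitz bound `C / (a/2)`. -/
lemma norm_g_sub_le (h : IsRelativelySmoothing UA UB D g C c α) {a b T : ℝ} (ha : 0 < a)
    (hab : a ≤ b) (hT : a ≤ T) :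
    ‖g b - g a‖ ≤ 4 * C * (c * (2 + T)) * (b - a) * a ^ (-1 - α) := by
  have e1 : g b = g (a / 2) * UA.rop (b - a / 2) := by
    rw [← h.g_add (by positivity) (by linarith)]; congr 1; ring
  have e2 : g a = g (a / 2) * UA.rop (a / 2) := by
    rw [← h.g_add (by positivity) (by linarith)]; congr 1; ring
  rw [e1, e2, ← mul_sub]
  have hC := h.smoothing.nonneg
  have hc := h.c_nonneg
  have hT0 : 0 < T := ha.trans_le hT
  have h1 := h.norm_g_le (s := a / 2) (T := T) (by positivity) (by linarith)
  have h2 := h.smoothing.norm_sub_le (a := a / 2) (b := b - a / 2) (by positivity) (by linarith)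
  have h3 := half_rpow_neg_le h.lt_one.le ha
  calc ‖g (a / 2) * (UA.rop (b - a / 2) - UA.rop (a / 2))‖
      ≤ ‖g (a / 2)‖ * ‖UA.rop (b - a / 2) - UA.rop (a / 2)‖ := norm_mul_le _ _
    _ ≤ (c * (2 + T) * (2 * a ^ (-α))) * (C / (a / 2) * (b - a / 2 - a / 2)) := by
      gcongr
      exact h1.trans (by gcongr)
    _ = _ := by
      rw [show -1 - α = -α - 1 by ring, Real.rpow_sub_one ha.ne']
      field_simp
      ring

lemma continuousOn_g (h : IsRelativelySmoothing UA UB D g C c α) :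
    ContinuousOn g (Set.Ioi 0) := by
  intro t ht
  have ht' : (0 : ℝ) < t := ht
  have h1 : ContinuousAt (fun s => g (t / 2) * UA.rop (s - t / 2)) t := by
    have : ContinuousAt UA.rop (t - t / 2) :=
      (h.smoothing.hasDerivAt _ (by linarith)).continuousAt
    exact continuousAt_const.mul
      (ContinuousAt.comp (f := fun s => s - t / 2) this (by fun_prop))
  refine (h1.congr ?_).continuousWithinAt
  filter_upwards [lt_mem_nhds (half_lt_self ht')] with s hs
  rw [← h.g_add (by positivity) (by linarith)]
  congr 1; ring

lemma continuousOn_g_apply (h : IsRelativelySmoothing UA UB D g C c α) {b : ℝ → X}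
    {f : ℝ → ℝ} {S : Set ℝ} (hb : ContinuousOn b S) (hf : ContinuousOn f S)
    (hS : ∀ s ∈ S, 0 < f s) : ContinuousOn (fun s => g (f s) (b s)) S :=
  (h.continuousOn_g.comp hf hS).clm_apply hb

variable [CompleteSpace X]

/-- Apply `B` to `x = ∫₀ˢ U r y dr + U s x`. The first part costs a multiple of `s^(1-α) ‖y‖`, which
is small for small `s`; the second costs `‖g s‖ ‖x‖`. -/
lemma relative_bound (h : IsRelativelySmoothing UA UB D g C c α) {ε : ℝ} (hε : 0 < ε) :
    ∃ K : ℝ, 0 ≤ K ∧ ∀ x y, UA.IsGen x y → ∃ z, UB.IsGen x z ∧ ‖z‖ ≤ ε * ‖y‖ + K * ‖x‖ := by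
  have h1 : 0 < 1 - α := by linarith [h.lt_one]
  have hc := h.c_nonneg
  obtain ⟨s, hs0, hs1, hs⟩ : ∃ s : ℝ, 0 < s ∧ s ≤ 1 ∧
      c * (2 + 1) * (s ^ (1 - α) / (1 - α)) ≤ ε := by
    have hlim : Tendsto (fun s : ℝ => c * (2 + 1) * (s ^ (1 - α) / (1 - α))) (𝓝[>] 0)
        (𝓝 0) := by
      have : ContinuousAt (fun s : ℝ => c * (2 + 1) * (s ^ (1 - α) / (1 - α))) 0 :=
        ((Real.continuousAt_rpow_const _ _ (Or.inr h1.le)).div_const _).const_mul _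
      have := this.tendsto
      simp only [Real.zero_rpow h1.ne', zero_div, mul_zero] at this
      exact this.mono_left nhdsWithin_le_nhds
    obtain ⟨s, h2, h3, h4⟩ := ((hlim.eventually (gt_mem_nhds hε)).and
      (Ioc_mem_nhdsGT one_pos)).exists
    exact ⟨s, h3, h4, h2.le⟩
  refine ⟨‖g s‖, norm_nonneg _, fun x y hxy => ?_⟩
  have hbd : ∀ r ∈ Set.Ioc 0 s, ‖g r y‖ ≤ c * (2 + 1) * r ^ (-α) * ‖y‖ := fun r hr =>
    (g r).le_of_opNorm_le (h.norm_g_le hr.1 (hr.2.trans hs1)) y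
  have hint : IntegrableOn (fun r => c * (2 + 1) * r ^ (-α) * ‖y‖) (Set.Ioc 0 s) :=
    ((integrableOn_Ioc_rpow_neg h.lt_one s hs0.le).const_mul _).mul_const _
  have hg : IntervalIntegrable (fun r => g r y) volume 0 s := by
    rw [intervalIntegrable_iff_integrableOn_Ioc_of_le hs0.le]
    refine Integrable.mono' hint ?_ ((ae_restrict_mem measurableSet_Ioc).mono hbd)
    refine ContinuousOn.aestronglyMeasurable ?_ measurableSet_Ioc
    exact h.continuousOn_g_apply continuousOn_const continuousOn_id fun r hr => hr.1
  have h2 := (IsGen.intervalIntegral h.contrB hs0.le (h.contrA.intervalIntegrable_rop y 0 s) hg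
    fun r hr => h.isGen r hr.1 y).add (h.isGen s hs0 x)
  rw [← hxy.sub_rop_eq h.contrA hs0.le, sub_add_cancel] at h2
  refine ⟨_, h2, (norm_add_le _ _).trans (add_le_add ?_ ((g s).le_opNorm x))⟩
  rw [intervalIntegral.integral_of_le hs0.le]
  refine (norm_integral_le_of_norm_le hint ((ae_restrict_mem measurableSet_Ioc).mono hbd)).trans ?_
  rw [integral_mul_const, integral_const_mul, ← intervalIntegral.integral_of_le hs0.le,
    integral_rpow_neg h.lt_one]
  exact mul_le_mul_of_nonneg_right hs (norm_nonneg _)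

lemma mem_domain (h : IsRelativelySmoothing UA UB D g C c α) {x : X}
    (hx : x ∈ UA.generator.domain) : x ∈ UB.generator.domain := by
  obtain ⟨K, -, hK⟩ := h.relative_bound one_pos
  obtain ⟨y, hy⟩ := exists_isGen hx
  obtain ⟨z, hz, -⟩ := hK x y hy
  exact hz.mem

/-- On the range of `R = (A + l)⁻¹`, `A + B + l` is `1 + B R` after `A + l`. For `l ≥ 4 K` the
relative bound `1/8` gives `‖B R‖ ≤ 1/8 * 2 + 1/4 = 1/2`, so a Neumann series yields surjectivity.
-/
lemma exists_semigroup (h : IsRelativelySmoothing UA UB D g C c α) :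
    ∃ UH : C0Semigroup X, UH.IsContraction ∧ UH.generator = UA.generator + UB.generator := by
  obtain ⟨K, hK0, hK⟩ := h.relative_bound (ε := 1 / 8) (by norm_num)
  refine exists_semigroup_of_isAccretive (h.contrA.isAccretive.add h.contrB.isAccretive) ?_
    (l₀ := 4 * K + 1) fun l hl y => ?_
  · have : ((UA.generator + UB.generator).domain : Set X) = UA.generator.domain := by
      ext x
      exact ⟨fun hx => hx.1, fun hx => ⟨hx, h.mem_domain hx⟩⟩
    rw [this]
    exact h.smoothing.dense_domain h.contrA
  · have hl0 : 0 < l := by linarith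
    obtain ⟨R, hR1, hR2, -⟩ := h.contrA.exists_resolvent hl0
    have hRn : ∀ y, l * ‖R y‖ ≤ ‖y‖ := fun y => by
      have := R.le_of_opNorm_le hR1 y
      rwa [inv_mul_eq_div, le_div_iff₀ hl0, mul_comm] at this
    obtain ⟨G, hG, hG'⟩ := exists_clm_isGen UB R (k := 1 / 2) (by norm_num) fun y => by
      obtain ⟨z, hz, hz'⟩ := hK _ _ (hR2 y)
      refine ⟨z, hz, hz'.trans ?_⟩
      have h1 := norm_sub_le y ((l : ℂ) • R y)
      rw [norm_smul, Complex.norm_real, Real.norm_of_nonneg hl0.le] at h1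
      have h2 := hRn y
      have h3 : 4 * (K * ‖R y‖) ≤ l * ‖R y‖ := by
        rw [← mul_assoc]
        exact mul_le_mul_of_nonneg_right (by linarith) (norm_nonneg _)
      linarith
    obtain ⟨u, hu⟩ := isUnit_one_sub_of_norm_lt_one (x := -G) (by rw [norm_neg]; linarith)
    let w := (↑u⁻¹ : X →L[ℂ] X) y
    have hw : w + G w = y := by
      have : (u * ↑u⁻¹ : X →L[ℂ] X) y = y := by simp
      rw [hu] at this
      simpa using this
    refine ⟨R w, (w - (l : ℂ) • R w) + G w, ?_, ?_⟩
    · rw [LinearPMap.mem_graph_iff]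
      refine ⟨⟨R w, (hR2 w).mem, (hG w).mem⟩, rfl, ?_⟩
      rw [LinearPMap.add_apply, (hR2 w).generator_eq, (hG w).generator_eq]
    · rw [← hw]; abel

end IsRelativelySmoothing

end C0Semigroup

/-! ### Duhamel's formula for the perturbed semigroup -/

namespace C0Semigroup

variable {X : Type*} [NormedAddCommGroup X] [NormedSpace ℂ X]

lemma IsGen.rop_all {U : C0Semigroup X} {x y : X} (h : U.IsGen x y) (s : ℝ) :
    U.IsGen (U.rop s x) (U.rop s y) := by
  have := h.rop (NNReal.coe_nonneg s.toNNReal)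
  rwa [rop_coe] at this

lemma IsContraction.continuous_rop_apply {U : C0Semigroup X} (hU : U.IsContraction) {p : ℝ → ℝ}
    {f : ℝ → X} (hp : Continuous p) (hf : Continuous f) : Continuous fun s => U.rop (p s) (f s) := by
  rw [continuous_iff_continuousAt]
  intro s
  rw [ContinuousAt, tendsto_iff_norm_sub_tendsto_zero]
  have h1 : Continuous fun r => ‖f r - f s‖ + ‖U.rop (p r) (f s) - U.rop (p s) (f s)‖ :=
    (hf.sub continuous_const).norm.add
      (((hU.continuous_rop (f s)).comp hp).sub continuous_const).norm
  have h2 := h1.tendsto s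
  simp only [sub_self, norm_zero, add_zero] at h2
  refine squeeze_zero (fun _ => norm_nonneg _) (fun r => ?_) h2
  have e : U.rop (p r) (f r) - U.rop (p s) (f s) =
    U.rop (p r) (f r - f s) + (U.rop (p r) (f s) - U.rop (p s) (f s)) := by
    rw [map_sub]; abel
  rw [e]
  exact (norm_add_le _ _).trans (add_le_add_left (hU.norm_rop_apply_le _ _) _)

open Classical in
/-- The generator as a function, with value zero outside the domain. -/
noncomputable def gen (U : C0Semigroup X) (x : X) : X :=
  if h : x ∈ U.generator.domain then U.generator ⟨x, h⟩ else 0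

lemma isGen_gen {U : C0Semigroup X} {x : X} (h : x ∈ U.generator.domain) :
    U.IsGen x (U.gen x) := by
  rw [gen, dif_pos h]; exact isGen_generator ⟨x, h⟩

lemma IsGen.gen_eq {U : C0Semigroup X} {x y : X} (h : U.IsGen x y) : U.gen x = y :=
  (isGen_gen h.mem).unique h

/-- In addition to `IsRelativelySmoothing`, the semigroup `UH` has the generator `A + B`. -/
structure IsPerturbed (UA UB UH : C0Semigroup X) (D g : ℝ → X →L[ℂ] X) (C c α : ℝ) : Prop
    extends IsRelativelySmoothing UA UB D g C c α where
  contrH : UH.IsContraction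
  generator_eq : UH.generator = UA.generator + UB.generator

variable {UA UB UH : C0Semigroup X} {D g : ℝ → X →L[ℂ] X} {C c α : ℝ}

namespace IsPerturbed

lemma isGen_iff (h : IsPerturbed UA UB UH D g C c α) {x w : X} :
    UH.IsGen x w ↔ ∃ y z, UA.IsGen x y ∧ UB.IsGen x z ∧ w = y + z := by
  have h1 := mem_graph_generator (U := UH) (p := (x, w))
  rw [← h1, h.generator_eq, LinearPMap.mem_graph_iff]
  constructor
  · rintro ⟨⟨x', hx1, hx2⟩, h2, h3⟩
    simp only at h2 h3
    subst h2
    exact ⟨_, _, isGen_generator ⟨x', hx1⟩, isGen_generator ⟨x', hx2⟩, h3.symm⟩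
  · rintro ⟨y, z, hy, hz, rfl⟩
    refine ⟨⟨x, hy.mem, hz.mem⟩, rfl, ?_⟩
    rw [LinearPMap.add_apply, hy.generator_eq, hz.generator_eq]

variable [CompleteSpace X]

lemma domain_eq (h : IsPerturbed UA UB UH D g C c α) :
    UH.generator.domain = UA.generator.domain := by
  ext x
  constructor
  · intro hx
    obtain ⟨w, hw⟩ := exists_isGen hx
    obtain ⟨y, z, hy, -⟩ := h.isGen_iff.1 hw
    exact hy.mem
  · intro hx
    exact (h.isGen_iff.2 ⟨_, _, isGen_gen hx, isGen_gen (h.mem_domain hx), rfl⟩).mem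

lemma rop_mem (h : IsPerturbed UA UB UH D g C c α) {x : X} (hx : x ∈ UA.generator.domain)
    (s : ℝ) : UH.rop s x ∈ UA.generator.domain := by
  rw [← h.domain_eq] at hx ⊢
  obtain ⟨w, hw⟩ := exists_isGen hx
  exact (hw.rop_all s).mem

lemma isGenB (h : IsPerturbed UA UB UH D g C c α) {x : X} (hx : x ∈ UA.generator.domain)
    (s : ℝ) : UB.IsGen (UH.rop s x) (UB.gen (UH.rop s x)) :=
  isGen_gen (h.mem_domain (h.rop_mem hx s))

/-- From `‖B x‖ ≤ ‖A x‖ / 2 + K ‖x‖` and `A x = H x - B x` the term in `B x` is absorbed. Since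
orbits are continuous in the graph norm of `H`, this makes `s ↦ B e^{-sH} x` continuous on the
domain. -/
lemma norm_B_le (h : IsPerturbed UA UB UH D g C c α) :
    ∃ K : ℝ, ∀ x w z, UH.IsGen x w → UB.IsGen x z → ‖z‖ ≤ ‖w‖ + K * ‖x‖ := by
  obtain ⟨K, hK0, hK⟩ := h.relative_bound (ε := 1 / 2) (by norm_num)
  refine ⟨2 * K, fun x w z hw hz => ?_⟩
  obtain ⟨y, z', hy, hz', rfl⟩ := h.isGen_iff.1 hw
  obtain ⟨z'', hz'', hb⟩ := hK x y hy
  obtain rfl := hz.unique hz'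
  obtain rfl := hz.unique hz''
  have : ‖y‖ ≤ ‖y + z‖ + ‖z‖ := by simpa using norm_sub_le (y + z) z
  linarith

lemma continuous_gen (h : IsPerturbed UA UB UH D g C c α) {x : X}
    (hx : x ∈ UA.generator.domain) : Continuous fun s => UB.gen (UH.rop s x) := by
  obtain ⟨K, hK⟩ := h.norm_B_le
  rw [← h.domain_eq] at hx
  obtain ⟨w, hw⟩ := exists_isGen hx
  rw [h.domain_eq] at hx
  have hgen : ∀ s, UH.IsGen (UH.rop s x) (UH.rop s w) := hw.rop_all
  rw [continuous_iff_continuousAt]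
  intro s
  rw [ContinuousAt, tendsto_iff_norm_sub_tendsto_zero]
  have hlim : Tendsto (fun r => ‖UH.rop r w - UH.rop s w‖ + K * ‖UH.rop r x - UH.rop s x‖)
      (𝓝 s) (𝓝 0) := by
    have h1 := (h.contrH.continuous_rop w).sub (continuous_const (y := UH.rop s w))
    have h2 := (h.contrH.continuous_rop x).sub (continuous_const (y := UH.rop s x))
    have h3 : Continuous fun r => ‖UH.rop r w - UH.rop s w‖ + K * ‖UH.rop r x - UH.rop s x‖ :=
      h1.norm.add (h2.norm.const_mul K)
    simpa using h3.tendsto s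
  exact squeeze_zero (fun _ => norm_nonneg _) (fun r =>
    hK _ _ _ ((hgen r).sub (hgen s)) ((h.isGenB hx r).sub (h.isGenB hx s))) hlim

/-- Integrate the derivative of `e^{-(t-s)A} e^{-sH} x`. The factor on the left is norm
differentiable for `s < t`, and continuity up to `s = t` suffices at the endpoint. -/
lemma duhamel (h : IsPerturbed UA UB UH D g C c α) {x : X} (hx : x ∈ UA.generator.domain)
    {t : ℝ} (ht : 0 ≤ t) :
    UH.rop t x = UA.rop t x - ∫ s in (0 : ℝ)..t, UA.rop (t - s) (UB.gen (UH.rop s x)) := by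
  have hx' := hx
  rw [← h.domain_eq] at hx'
  obtain ⟨w, hw⟩ := exists_isGen hx'
  have hder : ∀ s ∈ Set.Ioo 0 t, HasDerivAt (fun s => UA.rop (t - s) (UH.rop s x))
      (-UA.rop (t - s) (UB.gen (UH.rop s x))) s := by
    intro s hs
    have h1 : HasDerivAt (fun s => UA.rop (t - s)) (D (t - s)) s := by
      have := (h.smoothing.hasDerivAt (t - s) (sub_pos.2 hs.2)).scomp s
        ((hasDerivAt_id s).const_sub t)
      simpa [Function.comp_def] using this
    have h2 : HasDerivAt (fun s => UH.rop s x) (-UH.rop s w) s := by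
      have e : ∀ r, 0 ≤ r → UH.rop r x = x - ∫ q in (0 : ℝ)..r, UH.rop q w := fun r hr => by
        rw [← hw.sub_rop_eq h.contrH hr, sub_sub_cancel]
      have h3 : HasDerivAt (fun r => ∫ q in (0 : ℝ)..r, UH.rop q w) (UH.rop s w) s :=
        intervalIntegral.integral_hasDerivAt_right (h.contrH.intervalIntegrable_rop w _ _)
          ((h.contrH.continuous_rop w).stronglyMeasurableAtFilter _ _)
          (h.contrH.continuous_rop w).continuousAt
      refine (h3.const_sub x).congr_of_eventuallyEq ?_
      filter_upwards [lt_mem_nhds hs.1] with r hr using e r hr.le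
    refine (h1.clm_apply_complex h2).congr_deriv ?_
    obtain ⟨y, z, hy, hz, e⟩ := h.isGen_iff.1 (hw.rop hs.1.le)
    rw [h.smoothing.apply_eq hy (sub_pos.2 hs.2), hz.gen_eq, e, map_neg, map_add]
    abel
  have h4 := intervalIntegral.integral_eq_sub_of_hasDerivAt_of_le ht
    (h.contrA.continuous_rop_apply (by fun_prop) (h.contrH.continuous_rop x)).continuousOn hder
    ((h.contrA.continuous_rop_apply (by fun_prop) (h.continuous_gen hx)).neg.intervalIntegrable 0 t)
  rw [intervalIntegral.integral_neg] at h4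
  simp only [sub_self, sub_zero, rop_zero, one_apply_eq_self] at h4
  rw [sub_eq_add_neg, h4]
  abel

lemma intervalIntegrable_kernel (h : IsPerturbed UA UB UH D g C c α) {x : X}
    (hx : x ∈ UA.generator.domain) {p q t : ℝ} (hp : 0 ≤ p) (hpq : p ≤ q) (hqt : q ≤ t) :
    IntervalIntegrable (fun s => g (t - s) (UB.gen (UH.rop s x))) volume p q := by
  have hc := h.continuous_gen hx
  obtain ⟨M, hM⟩ := (isCompact_Icc (a := p) (b := q)).exists_bound_of_continuousOn hc.continuousOn
  have h0 : IntervalIntegrable (fun s : ℝ => s ^ (-α)) volume (t - p) (t - q) :=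
    intervalIntegral.intervalIntegrable_rpow' (by linarith [h.lt_one])
  have h1 : IntervalIntegrable (fun s => c * (2 + t) * (t - s) ^ (-α) * M) volume p q := by
    have := (h0.comp_sub_left t)
    simp only [sub_sub_cancel] at this
    exact (this.const_mul _).mul_const _
  rw [intervalIntegrable_iff_integrableOn_Ioo_of_le hpq] at h1 ⊢
  refine Integrable.mono' h1 ?_ ((ae_restrict_mem measurableSet_Ioo).mono fun s hs => ?_)
  · refine ContinuousOn.aestronglyMeasurable ?_ measurableSet_Ioo
    exact h.continuousOn_g_apply hc.continuousOn (by fun_prop) fun r hr => by linarith [hr.2]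
  · have h2 : 0 < t - s := by linarith [hs.2]
    have h3 := h.norm_g_le h2 (T := t) (by linarith [hs.1])
    exact ((g (t - s)).le_of_opNorm_le h3 _).trans (mul_le_mul_of_nonneg_left
      (hM s ⟨hs.1.le, hs.2.le⟩) ((norm_nonneg _).trans h3))

/-- A Volterra equation for `B e^{-tH} x` with kernel `g (t - s)`, weakly singular at `s = t`; all
later bounds on `B e^{-tH}` come from it. -/
lemma gen_duhamel (h : IsPerturbed UA UB UH D g C c α) {x : X} (hx : x ∈ UA.generator.domain)
    {t : ℝ} (ht : 0 < t) :
    UB.gen (UH.rop t x) = g t x - ∫ s in (0 : ℝ)..t, g (t - s) (UB.gen (UH.rop s x)) := by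
  rw [h.duhamel hx ht.le]
  refine IsGen.gen_eq ((h.isGen t ht x).sub ?_)
  exact IsGen.intervalIntegral h.contrB ht.le
    ((h.contrA.continuous_rop_apply (by fun_prop) (h.continuous_gen hx)).intervalIntegrable 0 t)
    (h.intervalIntegrable_kernel hx le_rfl ht.le le_rfl) fun s hs => h.isGen _ (by linarith [hs.2]) _

end IsPerturbed

end C0Semigroup

/-! ### Integrals of weakly singular kernels -/

section SingularKernels

variable {X : Type*} [NormedAddCommGroup X] [NormedSpace ℝ X]

lemma intervalIntegrable_sub_rpow_neg {α : ℝ} (h1 : α < 1) (t p q : ℝ) :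
    IntervalIntegrable (fun s : ℝ => (t - s) ^ (-α)) volume p q := by
  have h0 : IntervalIntegrable (fun s : ℝ => s ^ (-α)) volume (t - p) (t - q) :=
    intervalIntegral.intervalIntegrable_rpow' (by linarith)
  simpa only [sub_sub_cancel] using h0.comp_sub_left t

lemma norm_integral_le_of_sub_rpow {α A p q t : ℝ} {f : ℝ → X} (h1 : α < 1) (hA : 0 ≤ A)
    (hpq : p ≤ q) (hqt : q ≤ t) (hf : ∀ s ∈ Set.Ioo p q, ‖f s‖ ≤ A * (t - s) ^ (-α)) :
    ‖∫ s in p..q, f s‖ ≤ A * ((t - p) ^ (1 - α) / (1 - α)) := by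
  have hi := (intervalIntegrable_sub_rpow_neg h1 t p q).const_mul A
  refine (intervalIntegral.norm_integral_le_of_norm_le hpq (g := fun s => A * (t - s) ^ (-α))
    ?_ hi).trans ?_
  · have : ∀ᵐ s : ℝ, s ≠ q := by simp [ae_iff]
    filter_upwards [this] with s hs hs' using hf s ⟨hs'.1, lt_of_le_of_ne hs'.2 hs⟩
  · rw [intervalIntegral.integral_const_mul,
      intervalIntegral.integral_comp_sub_left (fun s : ℝ => s ^ (-α)),
      integral_rpow (Or.inl (by linarith))]
    refine mul_le_mul_of_nonneg_left ?_ hA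
    have h3 : (0 : ℝ) ≤ (t - q) ^ (-α + 1) := Real.rpow_nonneg (by linarith) _
    rw [show -α + 1 = 1 - α by ring] at *
    exact div_le_div_of_nonneg_right (by linarith) (by linarith)

/-- A crude beta integral: at each `s` one of the two factors is at most `(t/2)^(-α)`, so the
product is at most this times their sum. -/
lemma norm_integral_le_of_beta {α A t : ℝ} {f : ℝ → X} (h0 : 0 ≤ α) (h1 : α < 1) (hA : 0 ≤ A)
    (ht : 0 < t) (hf : ∀ s ∈ Set.Ioo 0 t, ‖f s‖ ≤ A * ((t - s) ^ (-α) * s ^ (-α))) :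
    ‖∫ s in (0 : ℝ)..t, f s‖ ≤ A * (4 / (1 - α)) * (t ^ (1 - α) * t ^ (-α)) := by
  have h2 : 0 < 1 - α := by linarith
  have hi1 := intervalIntegrable_sub_rpow_neg h1 t 0 t
  have hi2 : IntervalIntegrable (fun s : ℝ => s ^ (-α)) volume 0 t :=
    intervalIntegral.intervalIntegrable_rpow' (by linarith)
  have key : ∀ s ∈ Set.Ioo 0 t,
      ‖f s‖ ≤ A * (t / 2) ^ (-α) * ((t - s) ^ (-α) + s ^ (-α)) := by
    intro s hs
    refine (hf s hs).trans ?_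
    rw [mul_assoc]
    refine mul_le_mul_of_nonneg_left ?_ hA
    have hp1 : 0 ≤ (t - s) ^ (-α) := Real.rpow_nonneg (by linarith [hs.2]) _
    have hp2 : 0 ≤ s ^ (-α) := Real.rpow_nonneg hs.1.le _
    have hp3 : 0 ≤ (t / 2) ^ (-α) := by positivity
    rcases le_total s (t / 2) with h | h
    · have : (t - s) ^ (-α) ≤ (t / 2) ^ (-α) :=
        Real.rpow_le_rpow_of_nonpos (by positivity) (by linarith) (by linarith)
      nlinarith
    · have : s ^ (-α) ≤ (t / 2) ^ (-α) :=
        Real.rpow_le_rpow_of_nonpos (by positivity) h (by linarith)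
      nlinarith
  refine (intervalIntegral.norm_integral_le_of_norm_le ht.le
    (g := fun s => A * (t / 2) ^ (-α) * ((t - s) ^ (-α) + s ^ (-α))) ?_
    ((hi1.add hi2).const_mul _)).trans ?_
  · have : ∀ᵐ s : ℝ, s ≠ t := by simp [ae_iff]
    filter_upwards [this] with s hs hs' using key s ⟨hs'.1, lt_of_le_of_ne hs'.2 hs⟩
  · rw [intervalIntegral.integral_const_mul, intervalIntegral.integral_add hi1 hi2,
      intervalIntegral.integral_comp_sub_left (fun s : ℝ => s ^ (-α)), sub_self, sub_zero,
      C0Semigroup.integral_rpow_neg h1]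
    have h3 := half_rpow_neg_le h1.le ht
    calc _ ≤ A * (2 * t ^ (-α)) * (t ^ (1 - α) / (1 - α) + t ^ (1 - α) / (1 - α)) := by gcongr
      _ = _ := by field_simp; ring

end SingularKernels

/-! ### Size of `B e^{-sH}`, and the adjoint condition -/

namespace C0Semigroup

variable {X : Type*} [NormedAddCommGroup X] [NormedSpace ℂ X] [CompleteSpace X]
  {UA UB UH : C0Semigroup X} {D g : ℝ → X →L[ℂ] X} {C c α : ℝ}

/-- Let `K` be the supremum of `s^α ‖B e^{-sH} x‖` on `(0, T]`, finite by continuity. For small `T`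
the Volterra equation gives `K ≤ κ ‖x‖ + K / 2`. Times beyond `T` are reached by restarting at time
`s - T`. -/
lemma IsPerturbed.exists_norm_gen_le (h : IsPerturbed UA UB UH D g C c α) :
    ∃ K : ℝ, 0 ≤ K ∧ ∀ x ∈ UA.generator.domain, ∀ s, 0 < s →
      ‖UB.gen (UH.rop s x)‖ ≤ K * (1 + s ^ (-α)) * ‖x‖ := by
  have h1 : 0 < 1 - α := by linarith [h.lt_one]
  have hc := h.c_nonneg
  have h0 := h.nonneg
  set κ : ℝ := c * (2 + 1) with hκ
  have hκ0 : 0 ≤ κ := by positivity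
  obtain ⟨T, hT0, hT1, hT⟩ : ∃ T : ℝ, 0 < T ∧ T ≤ 1 ∧ κ * (4 / (1 - α)) * T ^ (1 - α) ≤ 1 / 2 := by
    have hlim : Tendsto (fun s : ℝ => κ * (4 / (1 - α)) * s ^ (1 - α)) (𝓝[>] 0) (𝓝 0) := by
      have : ContinuousAt (fun s : ℝ => κ * (4 / (1 - α)) * s ^ (1 - α)) 0 :=
        (Real.continuousAt_rpow_const _ _ (Or.inr h1.le)).const_mul _
      have := this.tendsto
      simp only [Real.zero_rpow h1.ne', mul_zero] at this
      exact this.mono_left nhdsWithin_le_nhds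
    obtain ⟨s, h2, h3, h4⟩ := ((hlim.eventually (gt_mem_nhds (by norm_num : (0 : ℝ) < 1 / 2))).and
      (Ioc_mem_nhdsGT one_pos)).exists
    exact ⟨s, h3, h4, h2.le⟩
  have small : ∀ x ∈ UA.generator.domain, ∀ s, 0 < s → s ≤ T →
      ‖UB.gen (UH.rop s x)‖ ≤ 2 * κ * s ^ (-α) * ‖x‖ := by
    intro x hx
    set b : ℝ → X := fun s => UB.gen (UH.rop s x) with hb
    have hbc : Continuous b := h.continuous_gen hx
    let φ : ℝ → ℝ := fun s => s ^ α * ‖b s‖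
    have hφ : Continuous φ := (Real.continuous_rpow_const h0).mul hbc.norm
    set K := sSup (φ '' Set.Ioc 0 T) with hK
    have hbdd : BddAbove (φ '' Set.Ioc 0 T) :=
      (isCompact_Icc.bddAbove_image hφ.continuousOn).mono (Set.image_mono Set.Ioc_subset_Icc_self)
    have hle : ∀ s, 0 < s → s ≤ T → φ s ≤ K := fun s hs hs' =>
      le_csSup hbdd ⟨s, ⟨hs, hs'⟩, rfl⟩
    have hφ0 : ∀ s, 0 < s → 0 ≤ φ s := fun s hs => by positivity
    have hK0 : 0 ≤ K := (hφ0 T hT0).trans (hle T hT0 le_rfl)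
    have hbφ : ∀ s, 0 < s → ‖b s‖ = s ^ (-α) * φ s := fun s hs => by
      simp only [φ]
      rw [← mul_assoc, ← Real.rpow_add hs, neg_add_cancel, Real.rpow_zero, one_mul]
    have hstep : ∀ s, 0 < s → s ≤ T → φ s ≤ κ * ‖x‖ + K / 2 := by
      intro s hs hsT
      have e : b s = g s x - ∫ r in (0 : ℝ)..s, g (s - r) (b r) := h.gen_duhamel hx hs
      have h2 : ‖∫ r in (0 : ℝ)..s, g (s - r) (b r)‖ ≤
          κ * K * (4 / (1 - α)) * (s ^ (1 - α) * s ^ (-α)) := by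
        refine norm_integral_le_of_beta h0 h.lt_one (by positivity) hs fun r hr => ?_
        have h3 := h.norm_g_le (s := s - r) (T := 1) (by linarith [hr.2]) (by linarith [hr.1])
        refine ((g (s - r)).le_of_opNorm_le h3 _).trans ?_
        rw [hbφ r hr.1]
        have h4 := hle r hr.1 (hr.2.le.trans hsT)
        have h5 : 0 ≤ (s - r) ^ (-α) := Real.rpow_nonneg (by linarith [hr.2]) _
        have h6 : 0 ≤ r ^ (-α) := Real.rpow_nonneg hr.1.le _
        calc κ * (s - r) ^ (-α) * (r ^ (-α) * φ r) ≤ κ * (s - r) ^ (-α) * (r ^ (-α) * K) := by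
              gcongr
          _ = _ := by ring
      have h7 : ‖g s x‖ ≤ κ * s ^ (-α) * ‖x‖ :=
        (g s).le_of_opNorm_le (h.norm_g_le hs (hsT.trans hT1)) x
      have h8 : ‖b s‖ ≤ κ * s ^ (-α) * ‖x‖ + κ * K * (4 / (1 - α)) * (s ^ (1 - α) * s ^ (-α)) := by
        rw [e]
        exact (norm_sub_le _ _).trans (add_le_add h7 h2)
      have h9 : s ^ α * s ^ (-α) = 1 := by
        rw [← Real.rpow_add hs, add_neg_cancel, Real.rpow_zero]
      have h10 : s ^ (1 - α) ≤ T ^ (1 - α) := Real.rpow_le_rpow hs.le hsT h1.le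
      calc φ s ≤ s ^ α * (κ * s ^ (-α) * ‖x‖ +
            κ * K * (4 / (1 - α)) * (s ^ (1 - α) * s ^ (-α))) := by
              simp only [φ]; gcongr
        _ = (s ^ α * s ^ (-α)) * (κ * ‖x‖ + κ * (4 / (1 - α)) * s ^ (1 - α) * K) := by ring
        _ = κ * ‖x‖ + κ * (4 / (1 - α)) * s ^ (1 - α) * K := by rw [h9, one_mul]
        _ ≤ κ * ‖x‖ + κ * (4 / (1 - α)) * T ^ (1 - α) * K := by gcongr
        _ ≤ κ * ‖x‖ + 1 / 2 * K := by gcongr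
        _ = _ := by ring
    have hK2 : K ≤ κ * ‖x‖ + K / 2 := by
      refine csSup_le ⟨_, T, ⟨hT0, le_rfl⟩, rfl⟩ ?_
      rintro _ ⟨s, hs, rfl⟩
      exact hstep s hs.1 hs.2
    intro s hs hsT
    have h2 := hle s hs hsT
    change ‖b s‖ ≤ _
    rw [hbφ s hs]
    calc s ^ (-α) * φ s ≤ s ^ (-α) * (2 * κ * ‖x‖) := by gcongr; linarith
      _ = _ := by ring
  refine ⟨2 * κ * (1 + T ^ (-α)), by positivity, fun x hx s hs => ?_⟩
  have hp1 : 0 ≤ s ^ (-α) := Real.rpow_nonneg hs.le _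
  have hp2 : 0 ≤ T ^ (-α) := Real.rpow_nonneg hT0.le _
  rcases le_total s T with hsT | hsT
  · refine (small x hx s hs hsT).trans ?_
    refine mul_le_mul_of_nonneg_right ?_ (norm_nonneg _)
    rw [mul_assoc (2 * κ)]
    refine mul_le_mul_of_nonneg_left ?_ (by positivity)
    nlinarith
  · have e : UH.rop s x = UH.rop T (UH.rop (s - T) x) := by
      rw [← UH.rop_add_apply hT0.le (by linarith)]; congr 2; ring
    rw [e]
    refine (small _ (h.rop_mem hx _) T hT0 le_rfl).trans ?_
    have h2 := h.contrH.norm_rop_apply_le (s - T) x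
    rw [mul_assoc (2 * κ) (1 + T ^ (-α))]
    gcongr
    nlinarith

/-- For each functional `φ`, `φ ∘ R` lies in `dom(A*)`, hence in `dom(B*)`, so `φ (R B y)` is
bounded over the unit ball of `dom(B)`. Uniform boundedness, read in the bidual, removes the
dependence on `φ`. -/
lemma exists_norm_resolvent_comp_le {X : Type*} [NormedAddCommGroup X] [NormedSpace ℂ X]
    {UA UB : C0Semigroup X} {R : X →L[ℂ] X} {l : ℝ}
    (hR : ∀ x y, UA.IsGen x y → R (y + (l : ℂ) • x) = x)
    (hadj : adjointDomain UA.generator ⊆ adjointDomain UB.generator) :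
    ∃ K : ℝ, 0 ≤ K ∧ ∀ y z, UB.IsGen y z → ‖R z‖ ≤ K * ‖y‖ := by
  let ι := {p : X × X // UB.IsGen p.1 p.2 ∧ ‖p.1‖ ≤ 1}
  obtain ⟨K, hK⟩ := banach_steinhaus
    (g := fun i : ι => NormedSpace.inclusionInDoubleDual ℂ X (R i.1.2)) (by
      intro φ
      have h1 : (φ.comp R : X →L[ℂ] ℂ) ∈ adjointDomain UA.generator := by
        refine ⟨φ - (l : ℂ) • φ.comp R, fun x => ?_⟩
        have h2 := hR _ _ (isGen_generator x)
        rw [map_add, map_smul, ← eq_sub_iff_add_eq] at h2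
        simp [h2]
      obtain ⟨ψ, hψ⟩ := hadj h1
      refine ⟨‖ψ‖, fun i => ?_⟩
      rw [NormedSpace.dual_def]
      have h3 := hψ ⟨i.1.1, i.2.1.mem⟩
      rw [i.2.1.generator_eq] at h3
      have h4 : φ (R i.1.2) = ψ i.1.1 := h3
      rw [h4]
      exact (ψ.le_opNorm _).trans (mul_le_of_le_one_right (norm_nonneg _) i.2.2))
  have hK' : ∀ i : ι, ‖R i.1.2‖ ≤ K := fun i => by
    rw [← (NormedSpace.inclusionInDoubleDualLi ℂ (E := X)).norm_map]
    exact hK i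
  have hK0 : 0 ≤ K := (norm_nonneg _).trans (hK' ⟨(0, 0), isGen_zero, by simp⟩)
  refine ⟨K, hK0, fun y z hyz => ?_⟩
  rcases eq_or_ne y 0 with rfl | hy
  · rw [hyz.unique isGen_zero]; simp
  · have hy0 : 0 < ‖y‖ := norm_pos_iff.2 hy
    have := hK' ⟨(((‖y‖⁻¹ : ℝ) : ℂ) • y, ((‖y‖⁻¹ : ℝ) : ℂ) • z), hyz.smul _, by
      rw [norm_smul, Complex.norm_real, norm_inv, norm_norm, inv_mul_cancel₀ hy0.ne']⟩
    simp only [map_smul] at this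
    rw [norm_smul, Complex.norm_real, norm_inv, norm_norm, inv_mul_eq_div, div_le_iff₀ hy0] at this
    exact this

end C0Semigroup

/-! ### Telescoping, and powers of the Trotter step -/

/-- The sequence is arbitrary because powers of `F` are compared both with `e^{-kτA} y` and with
`e^{-kτH} x`. -/
lemma pow_apply_sub_eq_sum {X : Type*} [NormedAddCommGroup X] [NormedSpace ℂ X] (F : X →L[ℂ] X)
    (u : ℕ → X) (n : ℕ) :
    (F ^ n) (u 0) - u n = ∑ k ∈ Finset.range n, (F ^ (n - 1 - k)) (F (u k) - u (k + 1)) := by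
  induction n with
  | zero => simp
  | succ n ih =>
    rw [Finset.sum_range_succ]
    have h1 : ∀ k ∈ Finset.range n, (F ^ (n + 1 - 1 - k)) (F (u k) - u (k + 1)) =
        F ((F ^ (n - 1 - k)) (F (u k) - u (k + 1))) := by
      intro k hk
      have : n + 1 - 1 - k = (n - 1 - k) + 1 := by have := Finset.mem_range.1 hk; omega
      rw [this, pow_succ']; rfl
    rw [Finset.sum_congr rfl h1, ← map_sum, ← ih, map_sub, pow_succ']
    simp

lemma sum_inv_le {m n : ℕ} (h : m ≤ n) :
    ∑ k ∈ Finset.range m, ((k : ℝ) + 1)⁻¹ ≤ 1 + Real.log n := by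
  rcases Nat.eq_zero_or_pos m with rfl | hm
  · simp only [Finset.range_zero, Finset.sum_empty]
    have := Real.log_natCast_nonneg n
    linarith
  have h1 := harmonic_le_one_add_log m
  have h2 : ((harmonic m : ℚ) : ℝ) = ∑ k ∈ Finset.range m, ((k : ℝ) + 1)⁻¹ := by
    simp [harmonic]
  rw [← h2]
  refine h1.trans ?_
  gcongr

namespace C0Semigroup

variable {X : Type*} [NormedAddCommGroup X] [NormedSpace ℂ X]

/-- Quantitative bounds, up to the time `t`, for the perturbation of `A` by `B`. -/
structure HasTrotterBounds (UA UB UH : C0Semigroup X) (D g : ℝ → X →L[ℂ] X)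
    (C c α κ l K t : ℝ) : Prop extends IsPerturbed UA UB UH D g C c α where
  κ_nonneg : 0 ≤ κ
  l_nonneg : 0 ≤ l
  K_nonneg : 0 ≤ K
  norm_g_le_rpow : ∀ s, 0 < s → s ≤ t → ‖g s‖ ≤ κ * s ^ (-α)
  norm_g_sub_le_rpow : ∀ a b, 0 < a → a ≤ b → a ≤ t →
    ‖g b - g a‖ ≤ 4 * C * κ * (b - a) * a ^ (-1 - α)
  norm_gen_le : ∀ x ∈ UA.generator.domain, ∀ s, 0 < s → s ≤ t →
    ‖UB.gen (UH.rop s x)‖ ≤ κ * s ^ (-α) * ‖x‖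
  left_smoothing : ∀ s, 0 ≤ s → ∀ y, ∃ p w, UA.IsGen p w ∧
    w + (l : ℂ) • p = y - UB.rop s y ∧ ‖p‖ ≤ K * s * ‖y‖

namespace HasTrotterBounds

variable {UA UB UH : C0Semigroup X} {D g : ℝ → X →L[ℂ] X} {C c α κ l K t : ℝ}

lemma norm_step_pow_le (h : HasTrotterBounds UA UB UH D g C c α κ l K t) (τ : ℝ) (m : ℕ)
    (x : X) : ‖((UB.rop τ * UA.rop τ) ^ m) x‖ ≤ ‖x‖ := by
  induction m generalizing x with
  | zero => simp
  | succ m ih =>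
    rw [pow_succ]
    exact (ih _).trans ((h.contrB.norm_rop_apply_le _ _).trans (h.contrA.norm_rop_apply_le _ _))

/-- A uniform bound for `∫ g (q - r) B UH r y` when `B UH r y` is bounded. -/
lemma norm_integral_kernel_le (h : HasTrotterBounds UA UB UH D g C c α κ l K t) {b : ℝ → X}
    {p q β : ℝ} (hp : 0 ≤ p) (hpq : p ≤ q) (hqt : q ≤ t)
    (hβ : ∀ r, p ≤ r → r ≤ q → ‖b r‖ ≤ β) :
    ‖∫ r in p..q, g (q - r) (b r)‖ ≤ κ * β * ((q - p) ^ (1 - α) / (1 - α)) := by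
  have hβ0 : 0 ≤ β := (norm_nonneg _).trans (hβ p le_rfl hpq)
  refine norm_integral_le_of_sub_rpow h.lt_one (mul_nonneg h.κ_nonneg hβ0) hpq le_rfl
    fun r hr => ?_
  have h1 := h.norm_g_le_rpow (q - r) (by linarith [hr.2]) (by linarith [hr.1])
  refine ((g _).le_of_opNorm_le h1 _).trans ?_
  rw [mul_right_comm]
  exact mul_le_mul_of_nonneg_right (mul_le_mul_of_nonneg_left (hβ r hr.1.le hr.2.le) h.κ_nonneg)
    (Real.rpow_nonneg (by linarith [hr.2]) _) |>.trans_eq' (by ring)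

variable [CompleteSpace X]

/-- Telescope `F^m A z` against `e^{-mτA} A z`, which is at most `C / (mτ) * ‖z‖`. The `k`-th defect
is `(e^{-τB} - 1) e^{-σA} A z` with `σ = (k+1) τ`, bounded by `τ ‖B e^{-σA} A z‖`; its size `τ^(-α)
/ (k+1)` sums to the logarithm. -/
lemma norm_step_pow_gen_le (h : HasTrotterBounds UA UB UH D g C c α κ l K t) {τ : ℝ}
    (hτ : 0 < τ) {m n : ℕ} (hm : 0 < m) (hmn : m ≤ n) (hmt : m * τ ≤ t) {z y : X}
    (hz : UA.IsGen z y) :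
    ‖((UB.rop τ * UA.rop τ) ^ m) y‖ ≤
      (C / (m * τ) + 4 * C * κ * τ ^ (-α) * (1 + Real.log n)) * ‖z‖ := by
  set F := UB.rop τ * UA.rop τ with hF
  have hC := h.smoothing.nonneg
  have hκ := h.κ_nonneg
  let u : ℕ → X := fun k => UA.rop (k * τ) y
  have hu0 : u 0 = y := by simp [u]
  have hus : ∀ k, u (k + 1) = UA.rop τ (u k) := fun k => by
    simp only [u]
    rw [← UA.rop_add_apply hτ.le (by positivity)]; congr 2; push_cast; ring
  have hm' : (0 : ℝ) < m := by exact_mod_cast hm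
  have hum : ‖u m‖ ≤ C / (m * τ) * ‖z‖ := by
    have h1 : (0 : ℝ) < m * τ := by positivity
    simp only [u]
    rw [← h.smoothing.apply_eq hz h1]
    exact (D _).le_of_opNorm_le (h.smoothing.norm_le _ h1) z
  have hterm : ∀ k ∈ Finset.range m, ‖(F ^ (m - 1 - k)) (F (u k) - u (k + 1))‖ ≤
      4 * C * κ * τ ^ (-α) * ‖z‖ * ((k : ℝ) + 1)⁻¹ := by
    intro k hk
    have hk1 : (k : ℝ) + 1 ≤ m := by exact_mod_cast Finset.mem_range.1 hk
    refine (h.norm_step_pow_le τ _ _).trans ?_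
    have e1 : F (u k) = UB.rop τ (u (k + 1)) := by rw [hus]; rfl
    set σ : ℝ := ((k : ℝ) + 1) * τ with hσ
    have hσ0 : 0 < σ := by positivity
    have hσt : σ ≤ t := (mul_le_mul_of_nonneg_right hk1 hτ.le).trans hmt
    -- Half of the time `σ` is spent on `A`, the other half on `B`.
    have e2 : u (k + 1) = UA.rop (σ / 2) (D (σ / 2) z) := by
      rw [h.smoothing.apply_eq hz (by positivity), ← UA.rop_add_apply (by positivity)
        (by positivity), add_halves]
      simp only [u, hσ]; push_cast; rfl
    have h2 : UB.IsGen (u (k + 1)) (g (σ / 2) (D (σ / 2) z)) := by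
      rw [e2]; exact h.isGen _ (by positivity) _
    rw [e1, norm_sub_rev]
    refine (h2.norm_sub_rop_le h.contrB hτ.le).trans ?_
    have h3 : ‖g (σ / 2)‖ ≤ κ * (2 * σ ^ (-α)) :=
      (h.norm_g_le_rpow _ (by positivity) (by linarith)).trans
        (mul_le_mul_of_nonneg_left (half_rpow_neg_le h.lt_one.le hσ0) hκ)
    have h4 : ‖D (σ / 2) z‖ ≤ C / (σ / 2) * ‖z‖ :=
      (D _).le_of_opNorm_le (h.smoothing.norm_le _ (by positivity)) z
    have h5 : σ ^ (-α) ≤ τ ^ (-α) := by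
      refine Real.rpow_le_rpow_of_nonpos hτ ?_ (by linarith [h.nonneg])
      rw [hσ]
      exact le_mul_of_one_le_left hτ.le (by linarith [(Nat.cast_nonneg k : (0 : ℝ) ≤ k)])
    calc τ * ‖g (σ / 2) (D (σ / 2) z)‖
        ≤ τ * (κ * (2 * σ ^ (-α)) * (C / (σ / 2) * ‖z‖)) := by
          gcongr
          exact ((g _).le_of_opNorm_le h3 _).trans (mul_le_mul_of_nonneg_left h4 (by positivity))
      _ ≤ τ * (κ * (2 * τ ^ (-α)) * (C / (σ / 2) * ‖z‖)) := by gcongr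
      _ = _ := by
        rw [hσ]; field_simp; ring
  have h6 := pow_apply_sub_eq_sum F u m
  rw [hu0, sub_eq_iff_eq_add] at h6
  rw [h6, add_comm, add_mul]
  refine (norm_add_le _ _).trans (add_le_add hum ?_)
  refine (norm_sum_le_of_le _ hterm).trans ?_
  rw [← Finset.mul_sum, mul_right_comm]
  have := sum_inv_le hmn
  gcongr

/-- Subtract the Volterra equations at `q + τ` and `q + s` and cut the integrals at `q - τ`. The
recent pieces have length at most `2τ` and are estimated separately. On the distant piece the
kernels differ by at most a multiple of `τ (q-r)^(-1-α) ≤ τ^(1-α) (q-r)⁻¹`, whose integral is the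
logarithm. -/
lemma norm_gen_sub_le (h : HasTrotterBounds UA UB UH D g C c α κ l K t) {y : X}
    (hy : y ∈ UA.generator.domain) {τ q s β : ℝ} (hτ : 0 < τ) (hq : τ ≤ q) (hs0 : 0 ≤ s)
    (hs : s ≤ τ) (hqt : q + τ ≤ t)
    (hβ : ∀ r, 0 ≤ r → r ≤ q + τ → ‖UB.gen (UH.rop r y)‖ ≤ β) :
    ‖UB.gen (UH.rop (q + τ) y) - UB.gen (UH.rop (q + s) y)‖ ≤
      4 * C * κ * τ * q ^ (-1 - α) * ‖y‖ + 4 * κ * β * (τ ^ (1 - α) / (1 - α)) +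
        4 * C * κ * β * τ ^ (1 - α) * Real.log (q / τ) := by
  have hC := h.smoothing.nonneg
  have hκ := h.κ_nonneg
  have h0 := h.nonneg
  have h1 : 0 < 1 - α := by linarith [h.lt_one]
  have hq0 : 0 < q := hτ.trans_le hq
  have hβ0 : 0 ≤ β := (norm_nonneg _).trans (hβ 0 le_rfl (by linarith))
  set b : ℝ → X := fun r => UB.gen (UH.rop r y) with hb
  have split : ∀ v, 0 ≤ v → v ≤ τ → b (q + v) = g (q + v) y -
      ((∫ r in (0 : ℝ)..(q - τ), g (q + v - r) (b r)) +
        ∫ r in (q - τ)..(q + v), g (q + v - r) (b r)) := by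
    intro v hv0 hv
    rw [intervalIntegral.integral_add_adjacent_intervals
      (h.intervalIntegrable_kernel hy le_rfl (by linarith) (by linarith))
      (h.intervalIntegrable_kernel hy (by linarith) (by linarith) le_rfl)]
    exact h.gen_duhamel hy (by linarith)
  have near : ∀ v, 0 ≤ v → v ≤ τ → ‖∫ r in (q - τ)..(q + v), g (q + v - r) (b r)‖ ≤
      2 * κ * β * (τ ^ (1 - α) / (1 - α)) := by
    intro v hv0 hv
    refine (h.norm_integral_kernel_le (by linarith) (by linarith) (by linarith)
      fun r hr hr' => hβ r (by linarith) (by linarith)).trans ?_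
    have h2 : (q + v - (q - τ)) ^ (1 - α) ≤ 2 * τ ^ (1 - α) := by
      calc (q + v - (q - τ)) ^ (1 - α) ≤ (2 * τ) ^ (1 - α) :=
            Real.rpow_le_rpow (by linarith) (by linarith) h1.le
        _ = 2 ^ (1 - α) * τ ^ (1 - α) := Real.mul_rpow (by norm_num) hτ.le
        _ ≤ 2 * τ ^ (1 - α) := by gcongr; exact two_rpow_le_two (by linarith)
    calc _ ≤ κ * β * (2 * τ ^ (1 - α) / (1 - α)) := by gcongr
      _ = _ := by ring
  have first : ‖g (q + τ) y - g (q + s) y‖ ≤ 4 * C * κ * τ * q ^ (-1 - α) * ‖y‖ := by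
    rw [← sub_apply]
    refine ContinuousLinearMap.le_of_opNorm_le _ ?_ y
    refine (h.norm_g_sub_le_rpow _ _ (by linarith) (by linarith) (by linarith)).trans ?_
    have h3 : (q + s) ^ (-1 - α) ≤ q ^ (-1 - α) :=
      Real.rpow_le_rpow_of_nonpos hq0 (by linarith) (by linarith)
    have h4 : q + τ - (q + s) ≤ τ := by linarith
    have h5 : 0 ≤ (q + s) ^ (-1 - α) := Real.rpow_nonneg (by linarith) _
    gcongr
  have far : ‖(∫ r in (0 : ℝ)..(q - τ), g (q + τ - r) (b r)) -
      ∫ r in (0 : ℝ)..(q - τ), g (q + s - r) (b r)‖ ≤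
        4 * C * κ * β * τ ^ (1 - α) * Real.log (q / τ) := by
    rw [← intervalIntegral.integral_sub
      (h.intervalIntegrable_kernel hy le_rfl (by linarith) (by linarith))
      (h.intervalIntegrable_kernel hy le_rfl (by linarith) (by linarith))]
    have hint : IntervalIntegrable (fun r : ℝ => (q - r)⁻¹) volume 0 (q - τ) := by
      refine ContinuousOn.intervalIntegrable (ContinuousOn.inv₀ (by fun_prop) fun r hr => ?_)
      rw [Set.uIcc_of_le (by linarith)] at hr
      linarith [hr.2]
    refine (intervalIntegral.norm_integral_le_of_norm_le (by linarith)
      (g := fun r => 4 * C * κ * β * τ ^ (1 - α) * (q - r)⁻¹)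
      (ae_of_all _ fun r hr => ?_) (hint.const_mul _)).trans_eq ?_
    · have hr1 := hr.1
      have hr2 := hr.2
      have hqr : τ ≤ q - r := by linarith
      have hqr0 : 0 < q - r := by linarith
      rw [← sub_apply]
      have h2 := h.norm_g_sub_le_rpow (q + s - r) (q + τ - r) (by linarith) (by linarith)
        (by linarith)
      have h3 : (q + s - r) ^ (-1 - α) ≤ (q - r)⁻¹ * τ ^ (-α) := by
        calc (q + s - r) ^ (-1 - α) ≤ (q - r) ^ (-1 - α) :=
              Real.rpow_le_rpow_of_nonpos hqr0 (by linarith) (by linarith)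
          _ = (q - r)⁻¹ * (q - r) ^ (-α) := by
              rw [sub_eq_add_neg (-1), Real.rpow_add hqr0, Real.rpow_neg_one]
          _ ≤ _ := by
              gcongr ?_ * ?_
              exact Real.rpow_le_rpow_of_nonpos hτ hqr (by linarith)
      have h4 : q + τ - r - (q + s - r) ≤ τ := by linarith
      have h5 : 0 ≤ (q + s - r) ^ (-1 - α) := Real.rpow_nonneg (by linarith) _
      calc _ ≤ 4 * C * κ * (q + τ - r - (q + s - r)) * (q + s - r) ^ (-1 - α) * ‖b r‖ :=
            ContinuousLinearMap.le_of_opNorm_le _ h2 _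
        _ ≤ 4 * C * κ * τ * ((q - r)⁻¹ * τ ^ (-α)) * β := by
            gcongr
            exact hβ r hr1.le (by linarith)
        _ = _ := by
            rw [show 1 - α = -α + 1 by ring, Real.rpow_add_one hτ.ne']; ring
    · rw [intervalIntegral.integral_const_mul,
        intervalIntegral.integral_comp_sub_left (fun r : ℝ => r⁻¹), sub_sub_cancel, sub_zero,
        integral_inv_of_pos hτ hq0]
  have e := split τ hτ.le le_rfl
  have e' := split s hs0 hs
  have n1 := near τ hτ.le le_rfl
  have n2 := near s hs0 hs
  change ‖b (q + τ) - b (q + s)‖ ≤ _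
  rw [e, e']
  set I1 := ∫ r in (0 : ℝ)..(q - τ), g (q + τ - r) (b r)
  set I2 := ∫ r in (0 : ℝ)..(q - τ), g (q + s - r) (b r)
  set I3 := ∫ r in (q - τ)..(q + τ), g (q + τ - r) (b r)
  set I4 := ∫ r in (q - τ)..(q + s), g (q + s - r) (b r)
  have e2 : g (q + τ) y - (I1 + I3) - (g (q + s) y - (I2 + I4)) =
      (g (q + τ) y - g (q + s) y) - (I1 - I2) - (I3 - I4) := by abel
  rw [e2]
  have t1 := norm_sub_le ((g (q + τ) y - g (q + s) y) - (I1 - I2)) (I3 - I4)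
  have t2 := norm_sub_le (g (q + τ) y - g (q + s) y) (I1 - I2)
  have t3 := norm_sub_le I3 I4
  linarith

end HasTrotterBounds

end C0Semigroup

/-! ### The one-step error between the two smoothing factors -/

namespace C0Semigroup

variable {X : Type*} [NormedAddCommGroup X] [NormedSpace ℂ X]

namespace HasTrotterBounds

variable {UA UB UH : C0Semigroup X} {D g : ℝ → X →L[ℂ] X} {C c α κ l K t : ℝ}

/-- `y - e^{-rB} y` equals `(A + l) p` with `‖p‖ ≤ K r ‖y‖`, so the bound for `F^m A` applies. This
is where the adjoint condition is used. -/
lemma norm_step_pow_sub_ropB_le (h : HasTrotterBounds UA UB UH D g C c α κ l K t) {τ N : ℝ}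
    {m : ℕ} (hN0 : 0 ≤ N)
    (hN : ∀ z y, UA.IsGen z y → ‖((UB.rop τ * UA.rop τ) ^ m) y‖ ≤ N * ‖z‖)
    {r : ℝ} (hr : 0 ≤ r) (y : X) :
    ‖((UB.rop τ * UA.rop τ) ^ m) (y - UB.rop r y)‖ ≤ (N + l) * K * (r * ‖y‖) := by
  obtain ⟨p, w, h1, h2, h3⟩ := h.left_smoothing r hr y
  have hl := h.l_nonneg
  rw [← h2, map_add, map_smul]
  refine (norm_add_le _ _).trans ?_
  rw [norm_smul, Complex.norm_real, Real.norm_of_nonneg hl]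
  calc _ ≤ N * ‖p‖ + l * ‖p‖ := by
        gcongr
        · exact hN _ _ h1
        · exact h.norm_step_pow_le τ m p
    _ = (N + l) * ‖p‖ := by ring
    _ ≤ (N + l) * (K * r * ‖y‖) := by gcongr
    _ = _ := by ring

variable [CompleteSpace X]

lemma norm_step_pow_sub_ropA_le (h : HasTrotterBounds UA UB UH D g C c α κ l K t) {τ N : ℝ}
    {m : ℕ} (hN0 : 0 ≤ N)
    (hN : ∀ z y, UA.IsGen z y → ‖((UB.rop τ * UA.rop τ) ^ m) y‖ ≤ N * ‖z‖)
    {r : ℝ} (hr : 0 ≤ r) (y : X) :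
    ‖((UB.rop τ * UA.rop τ) ^ m) (y - UA.rop r y)‖ ≤ N * (r * ‖y‖) := by
  lift r to ℝ≥0 using hr
  exact (hN _ _ (isGen_intOp h.contrA r y)).trans
    (mul_le_mul_of_nonneg_left (norm_intOp_apply_le h.contrA r y) hN0)

/-- Split the error as `(e^{-τB} - 1) e^{-τA} v + (e^{-τA} - e^{-τH}) v`; the second difference is
Duhamel's integral. -/
lemma step_sub_eq (h : HasTrotterBounds UA UB UH D g C c α κ l K t) {v : X}
    (hv : v ∈ UA.generator.domain) {τ : ℝ} (hτ : 0 < τ) :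
    (UB.rop τ * UA.rop τ) v - UH.rop τ v =
      ∫ s in (0 : ℝ)..τ, (UA.rop (τ - s) (UB.gen (UH.rop s v)) - UB.rop s (g τ v)) := by
  rw [intervalIntegral.integral_sub
    ((h.contrA.continuous_rop_apply (by fun_prop) (h.continuous_gen hv)).intervalIntegrable 0 τ)
    (h.contrB.intervalIntegrable_rop _ 0 τ), ← (h.isGen τ hτ v).sub_rop_eq h.contrB hτ.le,
    h.duhamel hv hτ.le, mul_apply_eq_comp]
  abel

/-- A bound without cancellation, kept for the few extreme terms of the telescoping sum where
smoothing is missing. -/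
lemma norm_step_sub_le (h : HasTrotterBounds UA UB UH D g C c α κ l K t) {v : X}
    (hv : v ∈ UA.generator.domain) {τ : ℝ} (hτ : 0 < τ) (hτt : τ ≤ t) :
    ‖(UB.rop τ * UA.rop τ) v - UH.rop τ v‖ ≤ 2 * κ * (τ ^ (1 - α) / (1 - α)) * ‖v‖ := by
  have hκ := h.κ_nonneg
  have h1 : 0 < 1 - α := by linarith [h.lt_one]
  rw [h.step_sub_eq hv hτ, intervalIntegral.integral_sub
    ((h.contrA.continuous_rop_apply (by fun_prop) (h.continuous_gen hv)).intervalIntegrable 0 τ)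
    (h.contrB.intervalIntegrable_rop _ 0 τ)]
  have n1 : ‖∫ s in (0 : ℝ)..τ, UA.rop (τ - s) (UB.gen (UH.rop s v))‖ ≤
      κ * ‖v‖ * (τ ^ (1 - α) / (1 - α)) := by
    have hi := (integrableOn_Ioc_rpow_neg h.lt_one τ hτ.le).const_mul (κ * ‖v‖)
    rw [← integral_rpow_neg h.lt_one, ← intervalIntegral.integral_const_mul]
    refine intervalIntegral.norm_integral_le_of_norm_le hτ.le (ae_of_all _ fun s hs => ?_)
      ((intervalIntegrable_iff_integrableOn_Ioc_of_le hτ.le).2 hi)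
    refine (h.contrA.norm_rop_apply_le _ _).trans ?_
    refine (h.norm_gen_le v hv s hs.1 (hs.2.trans hτt)).trans_eq (by ring)
  have n2 : ‖∫ s in (0 : ℝ)..τ, UB.rop s (g τ v)‖ ≤ κ * ‖v‖ * (τ ^ (1 - α) / (1 - α)) := by
    refine (h.contrB.norm_integral_rop_le _ hτ.le).trans ?_
    have h2 : ‖g τ v‖ ≤ κ * τ ^ (-α) * ‖v‖ :=
      (g τ).le_of_opNorm_le (h.norm_g_le_rpow τ hτ hτt) v
    calc τ * ‖g τ v‖ ≤ τ * (κ * τ ^ (-α) * ‖v‖) := by gcongr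
      _ = κ * ‖v‖ * τ ^ (1 - α) := by
        rw [show 1 - α = -α + 1 by ring, Real.rpow_add_one hτ.ne']; ring
      _ ≤ _ := by
        gcongr
        rw [le_div_iff₀ h1]
        have : 0 ≤ τ ^ (1 - α) := by positivity
        nlinarith [h.nonneg]
  refine (norm_sub_le _ _).trans ((add_le_add n1 n2).trans_eq (by ring))

/-- With `b s = B e^{-sH} v` and `G = B e^{-τA} v`, replace `e^{-(τ-s)A} b s` by `b s` and `e^{-sB}
G` by `G`; `F^m` absorbs both changes. The rest is `(b s - b τ) + (b τ - G)`: the first bracket is a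
continuity estimate, the second one step of the Volterra equation. -/
lemma norm_step_pow_step_sub_le (h : HasTrotterBounds UA UB UH D g C c α κ l K t) {x : X}
    (hx : x ∈ UA.generator.domain) {τ w N : ℝ} (hτ : 0 < τ) (hw : 2 * τ ≤ w) (hwt : w + τ ≤ t)
    {m : ℕ} (hN0 : 0 ≤ N)
    (hN : ∀ z y, UA.IsGen z y → ‖((UB.rop τ * UA.rop τ) ^ m) y‖ ≤ N * ‖z‖) :
    ‖((UB.rop τ * UA.rop τ) ^ m)
      ((UB.rop τ * UA.rop τ) (UH.rop w x) - UH.rop τ (UH.rop w x))‖ ≤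
      τ * (τ * (κ * w ^ (-α)) * (1 + κ * (τ ^ (1 - α) / (1 - α))) * (1 + K) * (N + l) +
        16 * C * κ * τ * w ^ (-1 - α) + 9 * κ * (κ * w ^ (-α)) * (τ ^ (1 - α) / (1 - α)) +
        8 * C * κ * (κ * w ^ (-α)) * τ ^ (1 - α) * Real.log (w / τ)) * ‖x‖ := by
  have hC := h.smoothing.nonneg
  have hκ := h.κ_nonneg
  have hl := h.l_nonneg
  have hK := h.K_nonneg
  have h0 := h.nonneg
  have h1 : 0 < 1 - α := by linarith [h.lt_one]
  have hw0 : 0 < w := by linarith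
  set F := UB.rop τ * UA.rop τ with hF
  set v := UH.rop w x with hv
  have hvd : v ∈ UA.generator.domain := h.rop_mem hx w
  set S := τ ^ (1 - α) / (1 - α) with hS
  have hS0 : 0 ≤ S := by positivity
  set β := κ * w ^ (-α) * ‖x‖ with hβ
  have hβ0 : 0 ≤ β := by positivity
  set b : ℝ → X := fun s => UB.gen (UH.rop s v) with hb
  have hbβ : ∀ s, 0 ≤ s → s ≤ τ → ‖b s‖ ≤ β := by
    intro s hs hs'
    simp only [hb, hv]
    rw [← UH.rop_add_apply hs hw0.le]
    refine (h.norm_gen_le x hx (s + w) (by linarith) (by linarith)).trans ?_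
    have : (s + w) ^ (-α) ≤ w ^ (-α) :=
      Real.rpow_le_rpow_of_nonpos hw0 (by linarith) (by linarith)
    simp only [hβ]; gcongr
  set G := g τ v with hG
  have hbG : ‖b τ - G‖ ≤ κ * β * S := by
    have e : b τ = G - ∫ r in (0 : ℝ)..τ, g (τ - r) (b r) := h.gen_duhamel hvd hτ
    rw [e, sub_sub_cancel_left, norm_neg]
    have := h.norm_integral_kernel_le (b := b) (p := 0) (q := τ) (β := β) le_rfl hτ.le
      (by linarith) hbβ
    rwa [sub_zero] at this
  have hGβ : ‖G‖ ≤ β * (1 + κ * S) := by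
    have := norm_sub_le (b τ) (b τ - G)
    rw [sub_sub_cancel] at this
    linarith [hbβ τ hτ.le le_rfl]
  set hol := 16 * C * κ * τ * w ^ (-1 - α) * ‖x‖ + 8 * κ * β * S +
    8 * C * κ * β * τ ^ (1 - α) * Real.log (w / τ) with hhol
  have hbb : ∀ s, 0 ≤ s → s ≤ τ → ‖b s - b τ‖ ≤ hol := by
    intro s hs hs'
    have hq0 : 0 < w / 2 := by positivity
    have e : ∀ r, 0 ≤ r → b r = UB.gen (UH.rop (w / 2 + r) (UH.rop (w / 2) x)) := by
      intro r hr
      simp only [hb, hv]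
      rw [← UH.rop_add_apply hr hw0.le, ← UH.rop_add_apply (by linarith) hq0.le]
      congr 3; ring
    rw [e s hs, e τ hτ.le, norm_sub_rev]
    -- Restarting at time `w / 2` keeps `B e^{-rH}` below `2 * β` on the whole memory interval, away
    -- from the singularity at `0`. It needs `τ ≤ w / 2`.
    refine (h.norm_gen_sub_le (β := 2 * β) (h.rop_mem hx _) hτ (by linarith) hs hs' (by linarith)
      fun r hr hr' => ?_).trans ?_
    · rw [← UH.rop_add_apply hr hq0.le]
      refine (h.norm_gen_le x hx _ (by linarith) (by linarith)).trans ?_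
      have : (r + w / 2) ^ (-α) ≤ 2 * w ^ (-α) :=
        (Real.rpow_le_rpow_of_nonpos hq0 (by linarith) (by linarith)).trans
          (half_rpow_neg_le h.lt_one.le hw0)
      calc _ ≤ κ * (2 * w ^ (-α)) * ‖x‖ := by gcongr
        _ = _ := by rw [hβ]; ring
    · have h2 : (w / 2) ^ (-1 - α) ≤ 4 * w ^ (-1 - α) := by
        rw [sub_eq_add_neg, Real.rpow_add hq0, Real.rpow_add hw0, Real.rpow_neg_one,
          Real.rpow_neg_one]
        calc (w / 2)⁻¹ * (w / 2) ^ (-α) ≤ (w / 2)⁻¹ * (2 * w ^ (-α)) := by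
              gcongr; exact half_rpow_neg_le h.lt_one.le hw0
          _ = _ := by field_simp; ring
      have h3 := h.contrH.norm_rop_apply_le (w / 2) x
      have h4 : Real.log (w / 2 / τ) ≤ Real.log (w / τ) := by
        gcongr; linarith
      calc _ ≤ 4 * C * κ * τ * (4 * w ^ (-1 - α)) * ‖x‖ + 4 * κ * (2 * β) * S +
          4 * C * κ * (2 * β) * τ ^ (1 - α) * Real.log (w / τ) := by gcongr
        _ = _ := by rw [hhol]; ring
  have hpt : ∀ s ∈ Set.Ioc 0 τ, ‖(F ^ m) (UA.rop (τ - s) (b s) - UB.rop s G)‖ ≤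
      N * (τ * β) + (N + l) * K * (τ * (β * (1 + κ * S))) + (hol + κ * β * S) := by
    intro s hs
    have e : (F ^ m) (UA.rop (τ - s) (b s) - UB.rop s G) =
        -(F ^ m) (b s - UA.rop (τ - s) (b s)) + (F ^ m) (G - UB.rop s G) +
          (F ^ m) ((b s - b τ) + (b τ - G)) := by
      simp only [map_sub, map_add]; abel
    rw [e]
    refine (norm_add₃_le).trans (add_le_add (add_le_add ?_ ?_) ?_)
    · rw [norm_neg]
      refine (h.norm_step_pow_sub_ropA_le hN0 hN (by linarith [hs.2]) (b s)).trans ?_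
      have := hbβ s hs.1.le hs.2
      have h2 : τ - s ≤ τ := by linarith [hs.1]
      gcongr
    · refine (h.norm_step_pow_sub_ropB_le hN0 hN hs.1.le G).trans ?_
      have := hs.2
      gcongr
    · refine (h.norm_step_pow_le τ m _).trans ((norm_add_le _ _).trans ?_)
      exact add_le_add (hbb s hs.1.le hs.2) hbG
  have hint : IntervalIntegrable (fun s => UA.rop (τ - s) (b s) - UB.rop s G) volume 0 τ :=
    ((h.contrA.continuous_rop_apply (by fun_prop) (h.continuous_gen hvd)).sub
      (h.contrB.continuous_rop G)).intervalIntegrable 0 τ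
  rw [h.step_sub_eq hvd hτ, ← ContinuousLinearMap.intervalIntegral_comp_comm _ hint]
  have h5 := intervalIntegral.norm_integral_le_of_norm_le_const (a := 0) (b := τ)
    (f := fun s => (F ^ m) (UA.rop (τ - s) (b s) - UB.rop s G))
    (fun s hs => hpt s (by rwa [Set.uIoc_of_le hτ.le] at hs))
  rw [sub_zero, abs_of_pos hτ] at h5
  refine h5.trans ?_
  have h6 : N * (τ * β) ≤ τ * β * (1 + κ * S) * N := by
    have : 0 ≤ N * (τ * β) * (κ * S) := by positivity
    nlinarith
  have h7 : 0 ≤ τ * β * (1 + κ * S) * l := by positivity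
  have h8 : N * (τ * β) + (N + l) * K * (τ * (β * (1 + κ * S))) + (hol + κ * β * S) ≤
      τ * β * (1 + κ * S) * (1 + K) * (N + l) + (hol + κ * β * S) := by nlinarith
  rw [mul_comm]
  refine (mul_le_mul_of_nonneg_left h8 hτ.le).trans_eq ?_
  rw [hhol, hβ]; ring

end HasTrotterBounds

end C0Semigroup

/-! ### Summation of the telescoped error -/

/-- Comparison with `∫ s^(-α)`; Bernoulli's inequality for `(1 - 1/(n+1))^(1-α)` is the induction
step. -/
lemma sum_rpow_neg_le {α : ℝ} (h0 : 0 ≤ α) (h1 : α < 1) (n : ℕ) :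
    ∑ k ∈ Finset.range n, ((k : ℝ) + 1) ^ (-α) ≤ (n : ℝ) ^ (1 - α) / (1 - α) := by
  have ha : 0 < 1 - α := by linarith
  induction n with
  | zero => simp [Real.zero_rpow ha.ne']
  | succ n ih =>
    rw [Finset.sum_range_succ]
    have hn : (0 : ℝ) < n + 1 := by positivity
    have hb : (1 + -((n : ℝ) + 1)⁻¹) ^ (1 - α) ≤ 1 + (1 - α) * -((n : ℝ) + 1)⁻¹ := by
      refine rpow_one_add_le_one_add_mul_self ?_ ha.le (by linarith)
      rw [neg_le_neg_iff]
      exact inv_le_one_of_one_le₀ (by linarith [(Nat.cast_nonneg n : (0 : ℝ) ≤ n)])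
    have e1 : (n : ℝ) = (n + 1) * (1 + -((n : ℝ) + 1)⁻¹) := by field_simp; ring
    have hb0 : 0 ≤ 1 + -((n : ℝ) + 1)⁻¹ := by
      have : ((n : ℝ) + 1)⁻¹ ≤ 1 :=
        inv_le_one_of_one_le₀ (by linarith [(Nat.cast_nonneg n : (0 : ℝ) ≤ n)])
      linarith
    have e2 : (n : ℝ) ^ (1 - α) ≤
        ((n : ℝ) + 1) ^ (1 - α) - (1 - α) * ((n : ℝ) + 1) ^ (-α) := by
      calc (n : ℝ) ^ (1 - α) = ((n : ℝ) + 1) ^ (1 - α) * (1 + -((n : ℝ) + 1)⁻¹) ^ (1 - α) := by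
            rw [← Real.mul_rpow hn.le hb0, ← e1]
        _ ≤ ((n : ℝ) + 1) ^ (1 - α) * (1 + (1 - α) * -((n : ℝ) + 1)⁻¹) := by gcongr
        _ = _ := by
            rw [show 1 - α = -α + 1 by ring, Real.rpow_add_one hn.ne']; field_simp; ring
    push_cast
    rw [le_div_iff₀ ha] at ih ⊢
    linarith

namespace C0Semigroup

variable {X : Type*} [NormedAddCommGroup X] [NormedSpace ℂ X]

namespace HasTrotterBounds

variable {UA UB UH : C0Semigroup X} {D g : ℝ → X →L[ℂ] X} {C c α κ l K t : ℝ}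
  [CompleteSpace X]

/-- The constant in the bound for the terms of the telescoping sum; `P` stands for
`1 + κ * (τ ^ (1 - α) / (1 - α))`. -/
noncomputable def termConst (C κ l K a P : ℝ) : ℝ :=
  κ * P * (1 + K) * (C + 4 * C * κ + l) + 16 * C * κ + 9 * κ ^ 2 / a + 8 * C * κ ^ 2 + 2 * κ / a

lemma le_termConst_mul {C κ l K a P E x₁ x₂ x₃ x₄ x₅ x₆ : ℝ} (hC : 0 ≤ C) (hκ : 0 ≤ κ)
    (hl : 0 ≤ l) (hK : 0 ≤ K) (ha : 0 < a) (hP : 0 ≤ P) (hE : 0 ≤ E) (h₁ : x₁ ≤ E) (h₂ : x₂ ≤ E)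
    (h₃ : x₃ ≤ E) (h₄ : x₄ ≤ E) (h₅ : x₅ ≤ E) (h₆ : x₆ ≤ E) :
    κ * P * (1 + K) * (C * x₁ + 4 * C * κ * x₂ + l * x₃) + 16 * C * κ * x₄ +
      9 * κ ^ 2 / a * x₅ + 8 * C * κ ^ 2 * x₆ ≤ termConst C κ l K a P * E := by
  calc _ ≤ κ * P * (1 + K) * (C * E + 4 * C * κ * E + l * E) + 16 * C * κ * E +
        9 * κ ^ 2 / a * E + 8 * C * κ ^ 2 * E := by gcongr
    _ = (termConst C κ l K a P - 2 * κ / a) * E := by simp only [termConst]; ring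
    _ ≤ termConst C κ l K a P * E := by
      gcongr
      exact sub_le_self _ (by positivity)

lemma norm_telescope_term_le (h : HasTrotterBounds UA UB UH D g C c α κ l K t) {x : X}
    (hx : x ∈ UA.generator.domain) {τ : ℝ} (hτ : 0 < τ) {n k : ℕ} (hn : n * τ = t) (hk : k < n) :
    ‖((UB.rop τ * UA.rop τ) ^ (n - 1 - k))
      ((UB.rop τ * UA.rop τ) (UH.rop (k * τ) x) - UH.rop τ (UH.rop (k * τ) x))‖ ≤
      termConst C κ l K (1 - α) (1 + κ * (τ ^ (1 - α) / (1 - α))) *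
        (2 * τ ^ (1 - α) * ((((n - 1 - k : ℕ) : ℝ) + 1)⁻¹ + ((k : ℝ) + 1)⁻¹) +
          2 * τ ^ (1 - α) * (τ ^ (1 - α) + τ) * (1 + Real.log n) * ((k : ℝ) + 1) ^ (-α)) * ‖x‖ := by
  have hC := h.smoothing.nonneg
  have hκ := h.κ_nonneg
  have hl := h.l_nonneg
  have hK := h.K_nonneg
  have h0 := h.nonneg
  have ha : 0 < 1 - α := by linarith [h.lt_one]
  set a := 1 - α with ha'
  set S := τ ^ a with hS
  have hS0 : 0 < S := Real.rpow_pos_of_pos hτ _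
  set P := 1 + κ * (S / a) with hP
  have hP0 : 0 ≤ P := by positivity
  set m := n - 1 - k with hm
  have hL0 : 0 ≤ Real.log n := Real.log_natCast_nonneg n
  set L := 1 + Real.log n with hL
  have hx' := norm_nonneg x
  have hk1 : (k : ℝ) + 1 ≤ n := by exact_mod_cast hk
  have hkτ : (k : ℝ) * τ + τ ≤ t := by nlinarith
  -- For `m = 0` no power of `F` smooths on the left, and for `k ≤ 1` the time `kτ` is too short to
  -- restart at its half. There one of the harmonic weights is at least `1/2`, so the crude bound
  -- fits.
  by_cases hkm : k ≤ 1 ∨ m = 0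
  · have hτt : τ ≤ t := by
      have : (0 : ℝ) ≤ k * τ := by positivity
      linarith
    have h2 : 1 ≤ 2 * (((m : ℝ) + 1)⁻¹ + ((k : ℝ) + 1)⁻¹) := by
      rcases hkm with hk' | hm'
      · have h3 : (k : ℝ) ≤ 1 := by exact_mod_cast hk'
        have h4 : (2 : ℝ)⁻¹ ≤ ((k : ℝ) + 1)⁻¹ := by gcongr; linarith
        have h5 : (0 : ℝ) ≤ ((m : ℝ) + 1)⁻¹ := by positivity
        linarith
      · have h5 : (0 : ℝ) ≤ ((k : ℝ) + 1)⁻¹ := by positivity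
        simp only [hm', Nat.cast_zero, zero_add, inv_one]
        linarith
    have h3 : 2 * κ / a ≤ termConst C κ l K a P := le_add_of_nonneg_left (by positivity)
    have h4 : (0 : ℝ) ≤ 2 * S * (S + τ) * L * ((k : ℝ) + 1) ^ (-α) := by positivity
    calc _ ≤ 2 * κ * (S / a) * ‖UH.rop (k * τ) x‖ :=
          (h.norm_step_pow_le τ _ _).trans (h.norm_step_sub_le (h.rop_mem hx _) hτ hτt)
      _ ≤ 2 * κ * (S / a) * ‖x‖ := by gcongr; exact h.contrH.norm_rop_apply_le _ _
      _ = 2 * κ / a * (S * 1) * ‖x‖ := by ring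
      _ ≤ termConst C κ l K a P * (S * (2 * (((m : ℝ) + 1)⁻¹ + ((k : ℝ) + 1)⁻¹))) * ‖x‖ := by
          gcongr
          exact (by positivity : (0 : ℝ) ≤ 2 * κ / a).trans h3
      _ ≤ _ := by
          gcongr
          · exact (by positivity : (0 : ℝ) ≤ 2 * κ / a).trans h3
          · linarith
  · push Not at hkm
    obtain ⟨hk2, hm0⟩ := hkm
    have hm1 : (1 : ℝ) ≤ m := by exact_mod_cast Nat.one_le_iff_ne_zero.2 hm0
    have hk2' : (2 : ℝ) ≤ k := by exact_mod_cast hk2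
    have hmn : m ≤ n := by omega
    have hmn' : (m : ℝ) ≤ n := by exact_mod_cast hmn
    have hN := fun z y (hz : UA.IsGen z y) => h.norm_step_pow_gen_le hτ (Nat.pos_of_ne_zero hm0)
      hmn (by rw [← hn]; gcongr) hz
    refine (h.norm_step_pow_step_sub_le hx hτ (by gcongr) hkτ (by positivity) hN).trans ?_
    gcongr ?_ * _
    set r := τ ^ (-α) with hr
    have hr0 : 0 < r := Real.rpow_pos_of_pos hτ _
    have hSr : S = r * τ := by
      rw [hS, hr, ha', show 1 - α = -α + 1 by ring, Real.rpow_add_one hτ.ne']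
    set p := (k : ℝ) ^ (-α) with hp
    have hp0 : 0 < p := Real.rpow_pos_of_pos (by linarith) _
    have hp1 : p ≤ 1 := Real.rpow_le_one_of_one_le_of_nonpos (by linarith) (by linarith)
    have hw : ((k : ℝ) * τ) ^ (-α) = p * r := Real.mul_rpow (by linarith) hτ.le
    have hw' : ((k : ℝ) * τ) ^ (-1 - α) = (k : ℝ)⁻¹ * τ⁻¹ * (p * r) := by
      rw [sub_eq_add_neg, Real.rpow_add (by positivity), hw, Real.rpow_neg_one, mul_inv]
    have hpk : p ≤ 2 * ((k : ℝ) + 1) ^ (-α) := by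
      have h2 : p ≤ (((k : ℝ) + 1) / 2) ^ (-α) :=
        Real.rpow_le_rpow_of_nonpos (by linarith) (by linarith) (by linarith)
      exact h2.trans (half_rpow_neg_le h.lt_one.le (by linarith))
    have hlogk : Real.log k ≤ L := by
      have : Real.log k ≤ Real.log n := Real.log_le_log (by linarith) (by linarith)
      linarith
    have hlogk0 : 0 ≤ Real.log k := Real.log_natCast_nonneg k
    have hm2 : (m : ℝ)⁻¹ ≤ 2 * ((m : ℝ) + 1)⁻¹ := by
      rw [← div_eq_mul_inv, inv_eq_one_div, div_le_div_iff₀ (by linarith) (by linarith)]; linarith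
    have hk3 : (k : ℝ)⁻¹ ≤ 2 * ((k : ℝ) + 1)⁻¹ := by
      rw [← div_eq_mul_inv, inv_eq_one_div, div_le_div_iff₀ (by linarith) (by linarith)]; linarith
    have hmi : (0 : ℝ) ≤ (m : ℝ)⁻¹ := by positivity
    have hki : (0 : ℝ) ≤ (k : ℝ)⁻¹ := by positivity
    rw [hw, hw', mul_div_cancel_right₀ _ hτ.ne', ← ha', ← hS, ← hP, ← hL]
    have hL1 : 1 ≤ L := by linarith
    -- In terms of `S = τ^(1-α)` and `p = k^(-α)` the estimate is a combination of six monomials,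
    -- each at most `E`.
    set E := S * ((m : ℝ)⁻¹ + (k : ℝ)⁻¹) + S * (S + τ) * L * p with hE
    have b1 : S * p * (m : ℝ)⁻¹ ≤ E := by
      have h2 : S * p * (m : ℝ)⁻¹ ≤ S * 1 * (m : ℝ)⁻¹ := by gcongr
      have h3 : 0 ≤ S * (k : ℝ)⁻¹ := by positivity
      have h4 : 0 ≤ S * (S + τ) * L * p := by positivity
      rw [hE, mul_add]; linarith
    have b2 : S * p * (k : ℝ)⁻¹ ≤ E := by
      have h2 : S * p * (k : ℝ)⁻¹ ≤ S * 1 * (k : ℝ)⁻¹ := by gcongr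
      have h3 : 0 ≤ S * (m : ℝ)⁻¹ := by positivity
      have h4 : 0 ≤ S * (S + τ) * L * p := by positivity
      rw [hE, mul_add]; linarith
    have b3 : S * (S + τ) * L * p ≤ E := le_add_of_nonneg_left (by positivity)
    have b4 : S * S * L * p ≤ E := le_trans (by gcongr; linarith) b3
    have b5 : S * τ * p ≤ E := by
      refine le_trans ?_ b3
      calc S * τ * p = S * τ * 1 * p := by ring
        _ ≤ S * (S + τ) * L * p := by gcongr; linarith
    have b6 : S * S * p ≤ E := by
      refine le_trans ?_ b4
      calc S * S * p = S * S * 1 * p := by ring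
        _ ≤ S * S * L * p := by gcongr
    have b7 : S * S * p * Real.log k ≤ E := by
      refine le_trans ?_ b4
      calc S * S * p * Real.log k ≤ S * S * p * L := by gcongr
        _ = S * S * L * p := by ring
    have hE0 : 0 ≤ E := (by positivity : 0 ≤ S * S * p).trans b6
    calc _ = κ * P * (1 + K) * (C * (S * p * (m : ℝ)⁻¹) + 4 * C * κ * (S * S * L * p) +
            l * (S * τ * p)) + 16 * C * κ * (S * p * (k : ℝ)⁻¹) + 9 * κ ^ 2 / a * (S * S * p) +
            8 * C * κ ^ 2 * (S * S * p * Real.log k) := by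
          rw [hSr]; field_simp
      _ ≤ termConst C κ l K a P * E :=
          le_termConst_mul hC hκ hl hK ha hP0 hE0 b1 b4 b5 b2 b6 b7
      _ ≤ _ := by
          gcongr
          · simp only [termConst]; positivity
          · calc E ≤ S * (2 * ((m : ℝ) + 1)⁻¹ + 2 * ((k : ℝ) + 1)⁻¹) +
                  S * (S + τ) * L * (2 * ((k : ℝ) + 1) ^ (-α)) := by rw [hE]; gcongr
              _ = _ := by ring

/-- The two harmonic sums cost `1 + log n` each. The sum of `(k+1)^(-α)` costs `n^(1-α)`, which one
factor `τ^(1-α)` cancels up to `t^(1-α)`. -/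
lemma norm_step_pow_sub_le (h : HasTrotterBounds UA UB UH D g C c α κ l K t) {x : X}
    (hx : x ∈ UA.generator.domain) {τ : ℝ} (hτ : 0 < τ) {n : ℕ} (hn : n * τ = t) :
    ‖((UB.rop τ * UA.rop τ) ^ n) x - UH.rop t x‖ ≤
      termConst C κ l K (1 - α) (1 + κ * (τ ^ (1 - α) / (1 - α))) *
        (4 * τ ^ (1 - α) + 2 * τ ^ (1 - α) * (τ ^ (1 - α) + τ) *
          ((n : ℝ) ^ (1 - α) / (1 - α))) * (1 + Real.log n) * ‖x‖ := by
  have hC := h.smoothing.nonneg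
  have hκ := h.κ_nonneg
  have hl := h.l_nonneg
  have hK := h.K_nonneg
  have ha : 0 < 1 - α := by linarith [h.lt_one]
  have hL0 : 0 ≤ Real.log n := Real.log_natCast_nonneg n
  have e1 := pow_apply_sub_eq_sum (UB.rop τ * UA.rop τ) (fun k : ℕ => UH.rop (k * τ) x) n
  simp only [Nat.cast_zero, zero_mul, hn, rop_zero] at e1
  change ((UB.rop τ * UA.rop τ) ^ n) x - _ = _ at e1
  rw [e1]
  have hs1 : ∑ k ∈ Finset.range n, (((n - 1 - k : ℕ) : ℝ) + 1)⁻¹ ≤ 1 + Real.log n :=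
    (Finset.sum_range_reflect (fun k : ℕ => ((k : ℝ) + 1)⁻¹) n).trans_le (sum_inv_le le_rfl)
  have hs2 := sum_inv_le (le_refl n)
  have hs3 := sum_rpow_neg_le h.nonneg h.lt_one n
  have hterm : ∀ k ∈ Finset.range n, ‖((UB.rop τ * UA.rop τ) ^ (n - 1 - k))
      ((UB.rop τ * UA.rop τ) (UH.rop (k * τ) x) - UH.rop (((k + 1 : ℕ) : ℝ) * τ) x)‖ ≤
      termConst C κ l K (1 - α) (1 + κ * (τ ^ (1 - α) / (1 - α))) *
        (2 * τ ^ (1 - α) * ((((n - 1 - k : ℕ) : ℝ) + 1)⁻¹ + ((k : ℝ) + 1)⁻¹) +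
          2 * τ ^ (1 - α) * (τ ^ (1 - α) + τ) * (1 + Real.log n) * ((k : ℝ) + 1) ^ (-α)) *
        ‖x‖ := fun k hk => by
    have e2 : UH.rop (((k + 1 : ℕ) : ℝ) * τ) x = UH.rop τ (UH.rop (k * τ) x) := by
      rw [← UH.rop_add_apply hτ.le (by positivity)]; congr 2; push_cast; ring
    rw [e2]
    exact h.norm_telescope_term_le hx hτ hn (Finset.mem_range.1 hk)
  refine (norm_sum_le_of_le _ hterm).trans ?_
  rw [← Finset.sum_mul, ← Finset.mul_sum, Finset.sum_add_distrib, ← Finset.mul_sum,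
    ← Finset.mul_sum, Finset.sum_add_distrib]
  have hS0 : 0 < τ ^ (1 - α) := Real.rpow_pos_of_pos hτ _
  have hQ : 0 ≤ termConst C κ l K (1 - α) (1 + κ * (τ ^ (1 - α) / (1 - α))) := by
    simp only [termConst]; positivity
  rw [mul_assoc (termConst _ _ _ _ _ _) (_ + _) (1 + _)]
  gcongr
  calc _ ≤ 2 * τ ^ (1 - α) * ((1 + Real.log n) + (1 + Real.log n)) +
        2 * τ ^ (1 - α) * (τ ^ (1 - α) + τ) * (1 + Real.log n) *
          ((n : ℝ) ^ (1 - α) / (1 - α)) := by gcongr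
    _ = _ := by ring

end HasTrotterBounds

end C0Semigroup

/-! ### Dependence on `t` and the final estimate -/

lemma rpow_le_one_add {t a : ℝ} (ht : 0 ≤ t) (h0 : 0 ≤ a) (h1 : a ≤ 1) : t ^ a ≤ 1 + t := by
  have := rpow_one_add_le_one_add_mul_self (s := t - 1) (by linarith) h0 h1
  rw [add_sub_cancel] at this
  nlinarith

namespace C0Semigroup

variable {X : Type*} [NormedAddCommGroup X] [NormedSpace ℂ X]

/-- The worst term has one factor `u` from `κ`, two from `P` and one from `C + 4 C κ + l`, hence the
fourth power. -/
lemma HasTrotterBounds.termConst_le {C κ l K a P P₀ u : ℝ} (hC : 0 ≤ C) (hκ : 0 ≤ κ) (hl : 0 ≤ l)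
    (hK : 0 ≤ K) (ha : 0 < a) (hP₀ : 0 ≤ P₀) (hu : 1 ≤ u) (hP : P ≤ P₀ * u ^ 2) :
    termConst C (κ * u) l K a P ≤ termConst C κ l K a P₀ * u ^ 4 := by
  have hu0 : 0 ≤ u := by linarith
  have h1 : u ≤ u ^ 4 := le_self_pow₀ hu (by norm_num)
  have h2 : u ^ 2 ≤ u ^ 4 := pow_le_pow_right₀ hu (by norm_num)
  have h3 : C + 4 * C * (κ * u) + l ≤ (C + 4 * C * κ + l) * u := by
    have := mul_le_mul_of_nonneg_left hu (add_nonneg hC hl)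
    linarith
  calc termConst C (κ * u) l K a P
      ≤ κ * u * (P₀ * u ^ 2) * (1 + K) * ((C + 4 * C * κ + l) * u) + 16 * C * κ * u +
        9 * κ ^ 2 / a * u ^ 2 + 8 * C * κ ^ 2 * u ^ 2 + 2 * κ / a * u := by
        have : κ * u * P * (1 + K) * (C + 4 * C * (κ * u) + l) ≤
            κ * u * (P₀ * u ^ 2) * (1 + K) * ((C + 4 * C * κ + l) * u) := by gcongr
        simp only [termConst]
        refine le_of_sub_nonneg ((sub_nonneg.2 this).trans_eq ?_)
        ring
    _ ≤ κ * u * (P₀ * u ^ 2) * (1 + K) * ((C + 4 * C * κ + l) * u) + 16 * C * κ * u ^ 4 +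
        9 * κ ^ 2 / a * u ^ 4 + 8 * C * κ ^ 2 * u ^ 4 + 2 * κ / a * u ^ 4 := by gcongr
    _ = _ := by simp only [termConst]; ring

variable {UA UB UH : C0Semigroup X} {D g : ℝ → X →L[ℂ] X} {C c α : ℝ} [CompleteSpace X]

lemma IsPerturbed.exists_hasTrotterBounds (h : IsPerturbed UA UB UH D g C c α)
    (hadj : adjointDomain UA.generator ⊆ adjointDomain UB.generator) :
    ∃ κ K : ℝ, ∀ t : ℝ, 0 ≤ t → HasTrotterBounds UA UB UH D g C c α (κ * (2 + t)) 1 K t ∧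
      0 ≤ κ ∧ 0 ≤ K := by
  obtain ⟨k, hk0, hk⟩ := h.exists_norm_gen_le
  obtain ⟨R, -, hR, hR'⟩ := h.contrA.exists_resolvent one_pos
  obtain ⟨K, hK0, hK⟩ := exists_norm_resolvent_comp_le hR' hadj
  have hc := h.c_nonneg
  -- The sum `c + k` serves both `g` and `B e^{-sH}`; the factor `2 + t` turns `1 + s^(-α)` into a
  -- multiple of `s^(-α)` for `s ≤ t`.
  refine ⟨c + k, K, fun t ht => ⟨?_, add_nonneg hc hk0, hK0⟩⟩
  have hC := h.smoothing.nonneg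
  refine { h with
    κ_nonneg := by positivity
    l_nonneg := zero_le_one
    K_nonneg := hK0
    norm_g_le_rpow := fun s hs hst => ?_
    norm_g_sub_le_rpow := fun a b ha hab hat => ?_
    norm_gen_le := fun x hx s hs hst => ?_
    left_smoothing := fun s hs y => ?_ }
  · refine (h.norm_g_le hs hst).trans ?_
    gcongr
    linarith
  · refine (h.norm_g_sub_le ha hab hat).trans ?_
    have : 0 ≤ b - a := by linarith
    gcongr
    linarith
  · refine (hk x hx s hs).trans ?_
    have := one_add_rpow_neg_le h.nonneg h.lt_one.le hs hst
    rw [mul_assoc (c + k)]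
    gcongr
    linarith
  · lift s to ℝ≥0 using hs
    refine ⟨R (y - UB.rop s y), _, hR _, sub_add_cancel _ _,
      (hK _ _ (isGen_intOp h.contrB s y)).trans ?_⟩
    rw [mul_assoc]
    exact mul_le_mul_of_nonneg_left (norm_intOp_apply_le h.contrB s y) hK0

/-- Trotter's product formula with an error estimate in operator norm. -/
lemma IsPerturbed.exists_norm_step_pow_sub_le (h : IsPerturbed UA UB UH D g C c α)
    (hadj : adjointDomain UA.generator ⊆ adjointDomain UB.generator) :
    ∃ M : ℝ, 0 < M ∧ ∀ (t : ℝ≥0) (n : ℕ), 2 < n →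
      ‖(UB.op (t / n) * UA.op (t / n)) ^ n - UH.op t‖ ≤
        Real.exp t * M * (Real.log n / (n : ℝ) ^ (1 - α)) := by
  obtain ⟨κ, K, hb⟩ := h.exists_hasTrotterBounds hadj
  obtain ⟨-, hκ, hK⟩ := hb 0 le_rfl
  have hC := h.smoothing.nonneg
  have h0 := h.nonneg
  have ha : 0 < 1 - α := by linarith [h.lt_one]
  set a := 1 - α with ha'
  have ha1 : a ≤ 1 := by linarith
  set P₀ := 1 + κ / a with hP₀
  have hP₀0 : 0 ≤ P₀ := by positivity
  set Q := HasTrotterBounds.termConst C κ 1 K a P₀ with hQ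
  have hQ0 : 0 ≤ Q := by simp only [hQ, HasTrotterBounds.termConst]; positivity
  set M := Q * (4 * (1 + a⁻¹)) * (720 * Real.exp 2) * 2 with hM
  have hM0 : 0 ≤ M := by positivity
  refine ⟨M + 1, by positivity, fun t n hn => ?_⟩
  have hn3 : (3 : ℝ) ≤ n := by exact_mod_cast hn
  have hn0 : (0 : ℝ) < n := by linarith
  -- Here `n > 2` enters: `n ≥ 3 > e`, so `1 + log n ≤ 2 log n`.
  have hlog : 1 ≤ Real.log n := by
    rw [Real.le_log_iff_exp_le hn0]
    exact Real.exp_one_lt_d9.le.trans (by norm_num; linarith)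
  have hlog0 : 0 ≤ Real.log n := by linarith
  rcases eq_or_lt_of_le (zero_le (a := t)) with rfl | ht
  · rw [zero_div, UA.op_zero, UB.op_zero, UH.op_zero, mul_one, one_pow, sub_self, norm_zero]
    positivity
  have ht' : (0 : ℝ) < t := ht
  set τ : ℝ := (t : ℝ) / n with hτ'
  have hτ : 0 < τ := by positivity
  have hnτ : n * τ = t := by rw [hτ']; field_simp
  have eτ : ((t / n : ℝ≥0) : ℝ) = τ := by push_cast; rfl
  rw [← UA.rop_coe, ← UB.rop_coe, ← UH.rop_coe, eτ]
  set u : ℝ := 2 + t with hu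
  have hu1 : 1 ≤ u := by linarith
  have hna : 0 < (n : ℝ) ^ a := Real.rpow_pos_of_pos hn0 _
  have hna' : (n : ℝ) ^ a ≤ n := by
    simpa using Real.rpow_le_rpow_of_exponent_le (by linarith : (1 : ℝ) ≤ n) ha1
  have hta : (t : ℝ) ^ a ≤ u := (rpow_le_one_add ht'.le ha.le ha1).trans (by linarith)
  have hS : τ ^ a = (t : ℝ) ^ a / (n : ℝ) ^ a := Real.div_rpow ht'.le hn0.le _
  have hS0 : 0 < τ ^ a := Real.rpow_pos_of_pos hτ _
  have hS1 : τ ^ a ≤ u / (n : ℝ) ^ a := by rw [hS]; gcongr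
  have hτ1 : τ ≤ u / (n : ℝ) ^ a := by
    rw [hτ']
    gcongr
    linarith
  have hSu : τ ^ a ≤ u := by
    refine hS1.trans (div_le_self (by linarith) ?_)
    exact Real.one_le_rpow (by linarith) ha.le
  have hP : 1 + κ * u * (τ ^ a / a) ≤ P₀ * u ^ 2 := by
    have h1 : κ * u * (τ ^ a / a) ≤ κ * u * (u / a) := by gcongr
    have h2 : (1 : ℝ) ≤ u ^ 2 := one_le_pow₀ hu1
    have h3 : κ * u * (u / a) = κ / a * u ^ 2 := by ring
    rw [hP₀, add_mul]
    linarith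
  have hconst := HasTrotterBounds.termConst_le hC hκ zero_le_one hK ha hP₀0 hu1 hP
  have hsum : 4 * τ ^ a + 2 * τ ^ a * (τ ^ a + τ) * ((n : ℝ) ^ a / a) ≤
      4 * (1 + a⁻¹) * u ^ 2 * ((n : ℝ) ^ a)⁻¹ := by
    have h1 : τ ^ a * (n : ℝ) ^ a ≤ u := by rwa [hS, div_mul_cancel₀ _ hna.ne']
    calc _ = 4 * τ ^ a + 2 * (τ ^ a * (n : ℝ) ^ a) * (τ ^ a + τ) / a := by ring
      _ ≤ 4 * (u / (n : ℝ) ^ a) + 2 * u * (u / (n : ℝ) ^ a + u / (n : ℝ) ^ a) / a := by gcongr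
      _ = (4 * u + 4 * u ^ 2 * a⁻¹) * ((n : ℝ) ^ a)⁻¹ := by ring
      _ ≤ (4 * u ^ 2 + 4 * u ^ 2 * a⁻¹) * ((n : ℝ) ^ a)⁻¹ := by
          gcongr
          exact le_self_pow₀ hu1 (by norm_num)
      _ = _ := by ring
  -- The power `6` is `4` from the constants plus `2` from the sum; `u^6 / 6! ≤ e^u` gives `720 =
  -- 6!` and `e^2`.
  have hexp : u ^ 6 ≤ 720 * Real.exp 2 * Real.exp t := by
    have := Real.pow_div_factorial_le_exp u (by linarith) 6
    rw [div_le_iff₀ (by positivity), hu, Real.exp_add] at this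
    norm_num [Nat.factorial] at this
    linarith
  have hdom : ∀ x ∈ UA.generator.domain, ‖((UB.rop τ * UA.rop τ) ^ n - UH.rop t) x‖ ≤
      Real.exp t * (M + 1) * (Real.log n / (n : ℝ) ^ a) * ‖x‖ := by
    intro x hx
    rw [sub_apply]
    refine ((hb t t.2).1.norm_step_pow_sub_le hx hτ hnτ).trans ?_
    rw [← ha', ← hu]
    gcongr ?_ * _
    calc _ ≤ Q * u ^ 4 * (4 * (1 + a⁻¹) * u ^ 2 * ((n : ℝ) ^ a)⁻¹) * (2 * Real.log n) := by
          gcongr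
          linarith
      _ = Q * (4 * (1 + a⁻¹)) * u ^ 6 * 2 * (Real.log n / (n : ℝ) ^ a) := by ring
      _ ≤ Q * (4 * (1 + a⁻¹)) * (720 * Real.exp 2 * Real.exp t) * 2 *
            (Real.log n / (n : ℝ) ^ a) := by gcongr
      _ = Real.exp t * M * (Real.log n / (n : ℝ) ^ a) := by rw [hM]; ring
      _ ≤ _ := by gcongr; linarith
  -- The bound holds on the dense domain of `A` and extends because it is a closed condition.
  refine ContinuousLinearMap.opNorm_le_bound _ (by positivity) fun x => ?_
  have hclosed : IsClosed {x : X | ‖((UB.rop τ * UA.rop τ) ^ n - UH.rop t) x‖ ≤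
      Real.exp t * (M + 1) * (Real.log n / (n : ℝ) ^ a) * ‖x‖} :=
    isClosed_le (by fun_prop) (by fun_prop)
  exact hclosed.closure_subset_iff.2 hdom (h.smoothing.dense_domain h.contrA x)

end C0Semigroup

theorem theorem8p2p6 {X : Type*} [NormedAddCommGroup X] [NormedSpace ℂ X] [CompleteSpace X]
    (UA UB : C0Semigroup X)
    (θ : ℝ) (hθ_pos : 0 < θ) (hθ_le : θ ≤ Real.pi / 2)
    (hA : UA.IsHolomorphicContraction θ) (hB : UB.IsContraction)
    (α : ℝ) (hα_nonneg : 0 ≤ α) (hα_lt : α < 1)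
    (hdom : (UA.fracPow α).domain ≤ UB.generator.domain)
    (hadj : adjointDomain UA.generator ⊆ adjointDomain UB.generator) :
    ∃ UH : C0Semigroup X, UH.IsContraction ∧
      UH.generator = UA.generator + UB.generator ∧ UH.generator.domain = UA.generator.domain ∧
      ∃ M₁ M₂ M₂' η : ℝ, 0 < M₁ ∧ 0 < M₂ ∧ 0 < M₂' ∧ 0 < η ∧
        (0 < α → ∀ (t : ℝ≥0) (n : ℕ), 2 < n →
          ‖(UB.op (t / n) * UA.op (t / n)) ^ n - UH.op t‖ ≤
            Real.exp (η * t) * (M₁ + M₂ * (t : ℝ) ^ (1 - α)) *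
              (Real.log n / (n : ℝ) ^ (1 - α))) ∧
        (α = 0 → ∀ (t : ℝ≥0) (n : ℕ), 2 < n →
          ‖(UB.op (t / n) * UA.op (t / n)) ^ n - UH.op t‖ ≤
            Real.exp (η * t) * (M₁ + M₂' * t) * (2 * Real.log n ^ 2 / n)) := by
  obtain ⟨D, C, hD⟩ := hA.exists_isSmoothing hθ_pos
  obtain ⟨g, c, hg⟩ :=
    C0Semigroup.exists_isRelativelySmoothing hA.1 hD hB hα_nonneg hα_lt hdom
  obtain ⟨UH, hH, hgen⟩ := hg.exists_semigroup
  have hP : C0Semigroup.IsPerturbed UA UB UH D g C c α :=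
    { hg with contrH := hH, generator_eq := hgen }
  obtain ⟨M, hM, hbound⟩ := hP.exists_norm_step_pow_sub_le hadj
  -- The estimate already holds with `M` and `η = 1` alone, so the other constants can be any
  -- positive numbers. For `α = 0`, `log n ≤ 2 (log n)^2` since `log n ≥ 1`.
  refine ⟨UH, hH, hgen, hP.domain_eq, M, 1, 1, 1, hM, one_pos, one_pos, one_pos,
    fun _ t n hn => (hbound t n hn).trans ?_, fun hα t n hn => (hbound t n hn).trans ?_⟩
  · have : 0 ≤ (t : ℝ) ^ (1 - α) := Real.rpow_nonneg t.2 _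
    have : 0 ≤ Real.log n := Real.log_natCast_nonneg n
    rw [one_mul, one_mul]
    gcongr
    linarith
  · have hn3 : (3 : ℝ) ≤ n := by exact_mod_cast hn
    have hlog : 1 ≤ Real.log n := by
      rw [Real.le_log_iff_exp_le (by linarith)]
      exact Real.exp_one_lt_d9.le.trans (by norm_num; linarith)
    have ht : (0 : ℝ) ≤ t := t.2
    rw [one_mul, hα, sub_zero, Real.rpow_one]
    gcongr
    · linarith
    · nlinarith
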